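/- Consider the primary flow of the principal hierarchy of $B_2$ with parameter $c$, $$u_t=\partial_x\!\left[v-2\left(c+\tfrac34\right)u^2\right],\qquad v_t=\partial_x\!\left[-\tfrac43\left(c+\tfrac12\right)(c+1)u^3\right],$$ in the Frobenius case $c=-\tfrac34$, i.e. $u_t=\partial_x[v]$, $v_t=\partial_x[\tfrac1{12}u^3]$, on an open set $U\subset\{(u,v)\in\mathbb R^2: u\neq 0\}$. A second order deformation of a flow $u_t=\partial_x g_1(u,v)$, $v_t=\partial_x g_2(u,v)$ on $U$ is a system $$u_t=\partial_x\!\left[g_1+\varepsilon^2(a_{13}u_{xx}+a_{14}v_{xx}+a_{15}u_x^2+a_{16}v_x^2+a_{17}u_xv_x)\right],$$ $$v_t=\partial_x\!\left[g_2+\varepsilon^2(a_{23}u_{xx}+a_{24}v_{xx}+a_{25}u_x^2+a_{26}v_x^2+a_{27}u_xv_x)\right]$$ with $a_{ij}\in C^\infty(U)$. A symmetry of the primary flow is a flow $u_\tau=\partial_x g_1(u,v)$, $v_\tau=\partial_x g_2(u,v)$, with $g_1,g_2\in C^\infty(U)$, that commutes with it. Given a second order deformation of the primary flow, an extension of a symmetry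 is a second order deformation of that symmetry which commutes with the deformed primary flow up to order $\varepsilon^2$, i.e. the commutator of the two flows is $O(\varepsilon^3)$. The deformation is called integrable (up to order $\varepsilon^2$) if every symmetry of the primary flow has an extension. Theorem. (i) Let an integrable second order deformation of the primary flow with $c=-\tfrac34$ be given on $U$. Then there is a Miura transformation $$\tilde u=u+\varepsilon^2\partial_x(\beta_{11}u_x+\beta_{12}v_x),\qquad \tilde v=v+\varepsilon^2\partial_x(\beta_{21}u_x+\beta_{22}v_x),\qquad \beta_{ij}\in C^\infty(U),$$ such that near each point of $U$ there are smooth functions $F_1,F_2$ of one variable for which the transformation brings the system, up to $O(\varepsilon^3)$, to the normal form $$u_t=\partial_x\!\left[v+\varepsilon^2(a_{15}u_x^2+a_{16}v_x^2+a_{17}u_xv_x)\right],$$ $$v_t=\partial_x\!\left[\tfrac1{12}u^3+\varepsilon^2\left(a_{23}u_{xx}+a_{24}v_{xx}+a_{25}u_x^2-4\tfrac{a_{25}}{u^2}v_x^2\right)\right],$$ where, with $F=F_1(\tfrac14u^2+v)+F_2(-\tfrac14u^2+v)$, $$a_{15}=-\tfrac34F_{uv},\quad a_{16}=\tfrac1{u^2}F_{uv},\quad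 a_{17}=-\tfrac12F_{vv},\quad a_{23}=F_u,\quad a_{24}=F_v,\quad a_{25}=\tfrac{u^2}8F_{vv}-\tfrac1{4u}F_u .$$ (ii) Conversely, let $F_1$ and $F_2$ be arbitrary smooth functions on the images of $U$ under $\tfrac14u^2+v$ and $-\tfrac14u^2+v$ respectively. Then the normal form with these $F_1,F_2$ is integrable on $U$: every symmetry of the primary flow has an extension. Moreover, any extensions of any two symmetries commute with each other up to order $\varepsilon^2$. -/

import Mathlib

open scoped ContDiff

noncomputable section

namespace B2

/-- An infinite jet of a pair of functions `(u, v)` of `x` at a point: `z s 0 = ∂ₓˢ u` and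
`z s 1 = ∂ₓˢ v`. Functions on jets are the functions of `u, v, uₓ, vₓ, uₓₓ, …`; all those used
below depend on finitely many derivatives only. -/
abbrev Jet : Type := ℕ → Fin 2 → ℝ

/-- The value `(u, v)` of a jet. -/
def base (z : Jet) : ℝ × ℝ := (z 0 0, z 0 1)

/-- The total derivative `∂ₓ f = ∑ u^k_(s+1) ∂f/∂u^k_(s)`: the derivative of `f` in the direction
of the vector with components `u^k_(s+1)`. -/
def totalD (f : Jet → ℝ) : Jet → ℝ :=
  fun z => deriv (fun t : ℝ => f (fun s k => z s k + t * z (s + 1) k)) 0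

/-- The time derivative of `f` along the evolutionary system `u^k_t = X k`, that is
`∑ (∂ₓˢ X k) ∂f/∂u^k_(s)`: the derivative of `f` in the direction of the vector with components
`∂ₓˢ X k`. -/
def timeD (X : Fin 2 → Jet → ℝ) (f : Jet → ℝ) : Jet → ℝ :=
  fun z => deriv (fun t : ℝ => f (fun s k => z s k + t * (totalD^[s] (X k)) z)) 0

/-- The commutator `∂_τ (u^i_t) - ∂_t (u^i_τ)` of the flows `u^i_t = X i` and `u^i_τ = Y i`. -/
def flowComm (X Y : Fin 2 → Jet → ℝ) (i : Fin 2) : Jet → ℝ :=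
  fun z => timeD Y (X i) z - timeD X (Y i) z

/-- The right-hand side of the system of conservation laws `u^i_t = ∂ₓ (α i)`. -/
def consLaw (α : Fin 2 → Jet → ℝ) : Fin 2 → Jet → ℝ := fun i => totalD (α i)

/-- The two `ε`-dependent flows commute up to order `ε²` over `U`: at every jet with value in `U`
the commutator is `O(ε³)`. -/
def CommuteUpToOrderTwo (U : Set (ℝ × ℝ)) (X Y : ℝ → Fin 2 → Jet → ℝ) : Prop :=
  ∀ z : Jet, base z ∈ U → ∀ i : Fin 2,
    Asymptotics.IsBigO (nhds (0 : ℝ)) (fun ε : ℝ => flowComm (X ε) (Y ε) i z)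
      (fun ε : ℝ => ε ^ 3)

/-- The general homogeneous differential polynomial of degree one, `a₀ uₓ + a₁ vₓ`. -/
def degOne (a : Fin 2 → ℝ × ℝ → ℝ) : Jet → ℝ :=
  fun z => a 0 (base z) * z 1 0 + a 1 (base z) * z 1 1

/-- The general homogeneous differential polynomial of degree two,
`a₀ uₓₓ + a₁ vₓₓ + a₂ uₓ² + a₃ vₓ² + a₄ uₓ vₓ`. -/
def degTwo (a : Fin 5 → ℝ × ℝ → ℝ) : Jet → ℝ :=
  fun z => a 0 (base z) * z 2 0 + a 1 (base z) * z 2 1 + a 2 (base z) * z 1 0 ^ 2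
    + a 3 (base z) * z 1 1 ^ 2 + a 4 (base z) * (z 1 0 * z 1 1)

/-- The flow `u^i_t = ∂ₓ (g i (u, v))`. -/
def dispersionless (g : Fin 2 → ℝ × ℝ → ℝ) : Fin 2 → Jet → ℝ :=
  consLaw fun i z => g i (base z)

/-- The second order deformation `u^i_t = ∂ₓ (g i (u, v) + ε² (degree two))` of the flow
`u^i_t = ∂ₓ (g i (u, v))`. -/
def deformed (g : Fin 2 → ℝ × ℝ → ℝ) (a : Fin 2 → Fin 5 → ℝ × ℝ → ℝ) (ε : ℝ) :
    Fin 2 → Jet → ℝ :=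
  consLaw fun i z => g i (base z) + ε ^ 2 * degTwo (a i) z

/-- The densities of the primary flow of the principal hierarchy of `B₂` with parameter `c`. -/
def primary (c : ℝ) : Fin 2 → ℝ × ℝ → ℝ :=
  ![fun p => p.2 - 2 * (c + 3 / 4) * p.1 ^ 2,
    fun p => -(4 / 3) * (c + 1 / 2) * (c + 1) * p.1 ^ 3]

/-- `u^i_τ = ∂ₓ (g i (u, v))` is a symmetry over `U` of the dispersionless flow with densities
`ρ`. -/
def IsSymmetry (U : Set (ℝ × ℝ)) (ρ g : Fin 2 → ℝ × ℝ → ℝ) : Prop :=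
  (∀ i, ContDiffOn ℝ ∞ (g i) U) ∧
    ∀ z : Jet, base z ∈ U → ∀ i, flowComm (dispersionless ρ) (dispersionless g) i z = 0

/-- The second order deformation of the flow of `g` with coefficients `b` extends the symmetry
`g` of `ρ` to a symmetry, up to order `ε²`, of the deformation of `ρ` with coefficients `a`. -/
def IsExtension (U : Set (ℝ × ℝ)) (ρ : Fin 2 → ℝ × ℝ → ℝ) (a : Fin 2 → Fin 5 → ℝ × ℝ → ℝ)
    (g : Fin 2 → ℝ × ℝ → ℝ) (b : Fin 2 → Fin 5 → ℝ × ℝ → ℝ) : Prop :=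
  (∀ i k, ContDiffOn ℝ ∞ (b i k) U) ∧ CommuteUpToOrderTwo U (deformed ρ a) (deformed g b)

/-- The deformation of `ρ` with coefficients `a` is integrable up to order `ε²` over `U`: every
symmetry of the dispersionless limit can be extended. -/
def IsIntegrable (U : Set (ℝ × ℝ)) (ρ : Fin 2 → ℝ × ℝ → ℝ)
    (a : Fin 2 → Fin 5 → ℝ × ℝ → ℝ) : Prop :=
  ∀ g, IsSymmetry U ρ g → ∃ b, IsExtension U ρ a g b

/-- The Miura transformation `w^i = u^i + ε² ∂ₓ (β i 0 uₓ + β i 1 vₓ)`. -/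
def miura (β : Fin 2 → Fin 2 → ℝ × ℝ → ℝ) (ε : ℝ) : Fin 2 → Jet → ℝ :=
  fun i z => z 0 i + ε ^ 2 * totalD (degOne (β i)) z

/-- The jet of the transformed functions `w`. -/
def jetOf (w : Fin 2 → Jet → ℝ) (z : Jet) : Jet := fun s k => (totalD^[s] (w k)) z

/-- Over `V` the Miura transformation with coefficients `β` turns the system `u^i_t = X i` into the
system `w^i_t = Y i (w, wₓ, …)`, up to order `ε²`. -/
def MiuraCarries (V : Set (ℝ × ℝ)) (β : Fin 2 → Fin 2 → ℝ × ℝ → ℝ)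
    (X Y : ℝ → Fin 2 → Jet → ℝ) : Prop :=
  ∀ z : Jet, base z ∈ V → ∀ i : Fin 2,
    Asymptotics.IsBigO (nhds (0 : ℝ))
      (fun ε : ℝ => timeD (X ε) (miura β ε i) z - Y ε i (jetOf (miura β ε) z))
      (fun ε : ℝ => ε ^ 3)

/-- The Riemann invariant `u² / 4 + v`. -/
def r₁ (p : ℝ × ℝ) : ℝ := p.1 ^ 2 / 4 + p.2

/-- The Riemann invariant `-u² / 4 + v`. -/
def r₂ (p : ℝ × ℝ) : ℝ := -(p.1 ^ 2) / 4 + p.2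

/-- `F = F₁(u² / 4 + v) + F₂(-u² / 4 + v)`. -/
def potential (F₁ F₂ : ℝ → ℝ) : ℝ × ℝ → ℝ := fun p => F₁ (r₁ p) + F₂ (r₂ p)

/-- The partial derivative `∂F/∂u`. -/
def dU (F : ℝ × ℝ → ℝ) : ℝ × ℝ → ℝ := fun p => deriv (fun t => F (t, p.2)) p.1

/-- The partial derivative `∂F/∂v`. -/
def dV (F : ℝ × ℝ → ℝ) : ℝ × ℝ → ℝ := fun p => deriv (fun t => F (p.1, t)) p.2

/-- The coefficient `(u² / 8) F_vv - F_u / (4 u)` of `uₓ²` in the second density. -/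
def coeff25 (F : ℝ × ℝ → ℝ) : ℝ × ℝ → ℝ :=
  fun p => p.1 ^ 2 / 8 * dV (dV F) p - 1 / (4 * p.1) * dU F p

/-- The coefficients of the normal form, in the order `uₓₓ, vₓₓ, uₓ², vₓ², uₓ vₓ`. -/
def normalForm (F : ℝ × ℝ → ℝ) : Fin 2 → Fin 5 → ℝ × ℝ → ℝ :=
  ![![fun _ => 0,
      fun _ => 0,
      fun p => -(3 / 4) * dU (dV F) p,
      fun p => 1 / p.1 ^ 2 * dU (dV F) p,
      fun p => -(1 / 2) * dV (dV F) p],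
    ![dU F,
      dV F,
      coeff25 F,
      fun p => -4 * (coeff25 F p / p.1 ^ 2),
      fun _ => 0]]

end B2

end

/-! All flows here are conservation laws, so a commutator of two of them is a total derivative. For
second order deformations its `ε²` part is `∂ₓ` of a differential polynomial of degree three, and
`∂ₓ` is injective on such polynomials (`eq_zero_of_totalD_degThree`). Besides the commutation of the
dispersionless limits, commuting up to order `ε²` therefore amounts to twenty linear equations
between coefficient functions, ten per component (`commuteUpToOrderTwo_iff`). Symmetries of the
primary flow are the pairs with `∂_v g₁ = ∂_u g₀` and `∂_u g₁ = (u²/4) ∂_v g₀`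
(`isSymmetry_primaryFrob_iff`), so `g₀` solves the wave equation `g_uu = (u²/4) g_vv`.

The twenty equations, read as a system for the extension `b` of a symmetry, have at most one
solution where `u ≠ 0`: suitable combinations cancel all derivatives
(`eq_zero_of_commCoeff_primaryFrob`).

For the converse direction the extension is given explicitly by `extCoeff`, bilinear in derivatives
of `F` and of `g₀`. The only property of `F` that matters is `F_uu = F_u / u + (u²/4) F_vv`, which
every sum of functions of the two Riemann invariants has (`isPotential_potential`). Modulo the two
wave equations, commutation with the primary flow and mutual commutation are polynomial identities
(`commCoeff_primaryFrob_extCoeff`, `commCoeff_extCoeff_comm`). By uniqueness every extension is the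
explicit one, hence any two commute.

For the normal form, a Miura transformation with coefficients `K` adds `gaugeCoeff f K` to the
deformation of the flow of `f`, and this preserves the commutation equations
(`commCoeff_gaugeCoeff_comm`). The coefficients `K` that normalise the deformation are found by
algebra and differentiation alone, since the derivatives of the unknowns cancel; so the
transformation exists on all of `U` (`isNormalized_normalized`). A single symmetry, with first
density `u v`, then suffices: eliminating `b` from its twenty equations leaves exactly the relations
of `IsReduced` between the remaining coefficients (`isReduced_of_commCoeff`). They say that `(a₂₃,
a₂₄)` satisfies the first order system of `(F_u, F_v)` and express the other coefficients through
this pair. In Riemann invariants that system integrates to `F₁` and `F₂` on a neighbourhood of each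
point (`exists_potential`). Finally `miuraCarries_deformed` passes from the linearised action
`gaugeCoeff` to the actual transformation modulo `O(ε³)`. -/

namespace B2

/-! ### Calculus of partial derivatives in the plane -/

/-- `f` is differentiable at `p` with partial derivatives `a`, `b`. -/
def HasGrad (f : ℝ × ℝ → ℝ) (a b : ℝ) (p : ℝ × ℝ) : Prop :=
  HasFDerivAt f (a • ContinuousLinearMap.fst ℝ ℝ ℝ + b • ContinuousLinearMap.snd ℝ ℝ ℝ) p

namespace HasGrad

variable {f g : ℝ × ℝ → ℝ} {a b c d : ℝ} {p : ℝ × ℝ}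

theorem congr_val (h : HasGrad f a b p) (ha : a = c) (hb : b = d) : HasGrad f c d p := by
  subst ha hb; exact h

theorem add (hf : HasGrad f a b p) (hg : HasGrad g c d p) :
    HasGrad (fun q => f q + g q) (a + c) (b + d) p := by
  refine (HasFDerivAt.fun_add hf hg).congr_fderiv ?_
  ext <;> simp

theorem neg (hf : HasGrad f a b p) : HasGrad (fun q => -f q) (-a) (-b) p := by
  refine (HasFDerivAt.fun_neg hf).congr_fderiv ?_
  ext <;> simp

theorem sub (hf : HasGrad f a b p) (hg : HasGrad g c d p) :
    HasGrad (fun q => f q - g q) (a - c) (b - d) p := by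
  refine (HasFDerivAt.fun_sub hf hg).congr_fderiv ?_
  ext <;> simp

theorem mul (hf : HasGrad f a b p) (hg : HasGrad g c d p) :
    HasGrad (fun q => f q * g q) (a * g p + f p * c) (b * g p + f p * d) p := by
  refine (HasFDerivAt.fun_mul hf hg).congr_fderiv ?_
  ext <;> simp <;> ring

theorem const (r : ℝ) : HasGrad (fun _ => r) 0 0 p := by
  refine (hasFDerivAt_const r p).congr_fderiv ?_
  ext <;> simp

theorem fst : HasGrad (fun q => q.1) 1 0 p := by
  refine (hasFDerivAt_fst (𝕜 := ℝ)).congr_fderiv ?_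
  ext <;> simp

theorem snd : HasGrad (fun q => q.2) 0 1 p := by
  refine (hasFDerivAt_snd (𝕜 := ℝ)).congr_fderiv ?_
  ext <;> simp

theorem comp {φ : ℝ → ℝ} {φ' : ℝ} (hφ : HasDerivAt φ φ' (f p)) (hf : HasGrad f a b p) :
    HasGrad (fun q => φ (f q)) (φ' * a) (φ' * b) p := by
  refine (hφ.comp_hasFDerivAt p hf).congr_fderiv ?_
  ext <;> simp

theorem pow (n : ℕ) (hf : HasGrad f a b p) :
    HasGrad (fun q => f q ^ n) (n * f p ^ (n - 1) * a) (n * f p ^ (n - 1) * b) p :=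
  comp (φ := fun x => x ^ n) (hasDerivAt_pow n (f p)) hf

theorem inv (hf : HasGrad f a b p) (h : f p ≠ 0) :
    HasGrad (fun q => (f q)⁻¹) (-(f p ^ 2)⁻¹ * a) (-(f p ^ 2)⁻¹ * b) p :=
  comp (φ := fun x => x⁻¹) (hasDerivAt_inv h) hf

theorem congr (hf : HasGrad f a b p) (h : g =ᶠ[nhds p] f) : HasGrad g a b p :=
  HasFDerivAt.congr_of_eventuallyEq hf h

/-- Both `totalD` and `timeD` differentiate along a straight line in jet space, and a coefficient
function sees only the projection of that line to the `(u, v)`-plane. This is the chain rule for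
that projection. -/
theorem hasDerivAt_line (hf : HasGrad f a b p) {x y x' y' : ℝ} (hp : p = (x, y)) :
    HasDerivAt (fun t : ℝ => f (x + t * x', y + t * y')) (a * x' + b * y') 0 := by
  subst hp
  have h1 : HasDerivAt (fun t : ℝ => (x + t * x', y + t * y')) (x', y') 0 := by
    refine HasDerivAt.prodMk ?_ ?_
    · simpa using ((hasDerivAt_id (0 : ℝ)).mul_const x').const_add x
    · simpa using ((hasDerivAt_id (0 : ℝ)).mul_const y').const_add y
  have h2 : HasFDerivAt f (a • ContinuousLinearMap.fst ℝ ℝ ℝ + b • ContinuousLinearMap.snd ℝ ℝ ℝ)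
      (x + 0 * x', y + 0 * y') := by
    rw [zero_mul, zero_mul, add_zero, add_zero]; exact hf
  refine (h2.comp_hasDerivAt (0 : ℝ) h1).congr_deriv ?_
  simp

theorem dU_eq (hf : HasGrad f a b p) : dU f p = a := by
  have h1 : HasDerivAt (fun t : ℝ => (t, p.2)) ((1 : ℝ), (0 : ℝ)) p.1 :=
    (hasDerivAt_id _).prodMk (hasDerivAt_const _ _)
  have h2 : HasFDerivAt f (a • ContinuousLinearMap.fst ℝ ℝ ℝ + b • ContinuousLinearMap.snd ℝ ℝ ℝ)
      (p.1, p.2) := hf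
  have h3 := h2.comp_hasDerivAt p.1 h1
  exact h3.deriv.trans (by simp)

theorem dV_eq (hf : HasGrad f a b p) : dV f p = b := by
  have h1 : HasDerivAt (fun t : ℝ => (p.1, t)) ((0 : ℝ), (1 : ℝ)) p.2 :=
    (hasDerivAt_const _ _).prodMk (hasDerivAt_id _)
  have h2 : HasFDerivAt f (a • ContinuousLinearMap.fst ℝ ℝ ℝ + b • ContinuousLinearMap.snd ℝ ℝ ℝ)
      (p.1, p.2) := hf
  have h3 := h2.comp_hasDerivAt p.2 h1
  exact h3.deriv.trans (by simp)

end HasGrad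

variable {U : Set (ℝ × ℝ)} {f g : ℝ × ℝ → ℝ} {p : ℝ × ℝ}

theorem dU_congr (h : g =ᶠ[nhds p] f) : dU g p = dU f p := by
  refine Filter.EventuallyEq.deriv_eq ?_
  have : Filter.Tendsto (fun t : ℝ => (t, p.2)) (nhds p.1) (nhds p) :=
    (by fun_prop : Continuous fun t : ℝ => (t, p.2)).tendsto' _ _ rfl
  exact this.eventually h

theorem dV_congr (h : g =ᶠ[nhds p] f) : dV g p = dV f p := by
  refine Filter.EventuallyEq.deriv_eq ?_
  have : Filter.Tendsto (fun t : ℝ => (p.1, t)) (nhds p.2) (nhds p) :=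
    (by fun_prop : Continuous fun t : ℝ => (p.1, t)).tendsto' _ _ rfl
  exact this.eventually h

theorem dU_congr_on (hU : IsOpen U) (hp : p ∈ U) (h : ∀ q ∈ U, g q = f q) : dU g p = dU f p :=
  dU_congr (Filter.eventually_of_mem (hU.mem_nhds hp) h)

theorem dV_congr_on (hU : IsOpen U) (hp : p ∈ U) (h : ∀ q ∈ U, g q = f q) : dV g p = dV f p :=
  dV_congr (Filter.eventually_of_mem (hU.mem_nhds hp) h)

theorem _root_.HasFDerivAt.hasGrad {L : ℝ × ℝ →L[ℝ] ℝ} (h : HasFDerivAt f L p) :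
    HasGrad f (L (1, 0)) (L (0, 1)) p := by
  refine h.congr_fderiv ?_
  ext <;> simp

theorem hasGrad_fderiv (hf : ContDiffOn ℝ ∞ f U) (hU : IsOpen U) (hp : p ∈ U) :
    HasGrad f (fderiv ℝ f p (1, 0)) (fderiv ℝ f p (0, 1)) p :=
  (((hf.contDiffAt (hU.mem_nhds hp)).differentiableAt (by simp)).hasFDerivAt).hasGrad

theorem hasGrad_of_contDiffOn (hf : ContDiffOn ℝ ∞ f U) (hU : IsOpen U) (hp : p ∈ U) :
    HasGrad f (dU f p) (dV f p) p := by
  have h := hasGrad_fderiv hf hU hp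
  exact h.congr_val h.dU_eq.symm h.dV_eq.symm

theorem contDiffOn_dU (hf : ContDiffOn ℝ ∞ f U) (hU : IsOpen U) : ContDiffOn ℝ ∞ (dU f) U := by
  have h1 : ContDiffOn ℝ ∞ (fun q => fderiv ℝ f q (1, 0)) U :=
    (hf.fderiv_of_isOpen hU (by simp)).clm_apply contDiffOn_const
  exact h1.congr fun q hq => (hasGrad_fderiv hf hU hq).dU_eq

theorem contDiffOn_dV (hf : ContDiffOn ℝ ∞ f U) (hU : IsOpen U) : ContDiffOn ℝ ∞ (dV f) U := by
  have h1 : ContDiffOn ℝ ∞ (fun q => fderiv ℝ f q (0, 1)) U :=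
    (hf.fderiv_of_isOpen hU (by simp)).clm_apply contDiffOn_const
  exact h1.congr fun q hq => (hasGrad_fderiv hf hU hq).dV_eq

theorem dU_dV (hf : ContDiffOn ℝ ∞ f U) (hU : IsOpen U) (hp : p ∈ U) :
    dU (dV f) p = dV (dU f) p := by
  have hat := hf.contDiffAt (hU.mem_nhds hp)
  have hs : IsSymmSndFDerivAt ℝ f p := hat.isSymmSndFDerivAt (by simpa using WithTop.coe_le_coe.mpr (le_top : (2 : ℕ∞) ≤ ⊤))
  have h2 : DifferentiableAt ℝ (fderiv ℝ f) p :=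
    (hat.fderiv_right (m := 1) (by norm_cast)).differentiableAt (by simp)
  -- With `e` a basis vector, both mixed derivatives become values of the second Fréchet derivative
  -- on the two basis vectors, in opposite orders.
  have key : ∀ e : ℝ × ℝ, HasGrad (fun q => fderiv ℝ f q e)
      (fderiv ℝ (fderiv ℝ f) p (1, 0) e) (fderiv ℝ (fderiv ℝ f) p (0, 1) e) p := by
    intro e
    have := (h2.hasFDerivAt.clm_apply (hasFDerivAt_const e p)).hasGrad
    simpa using this
  rw [dU_congr_on hU hp (fun q hq => (hasGrad_fderiv hf hU hq).dV_eq),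
    dV_congr_on hU hp (fun q hq => (hasGrad_fderiv hf hU hq).dU_eq),
    (key (0, 1)).dU_eq, (key (1, 0)).dV_eq]
  exact hs _ _

end B2

/-! ### Differential functions on jets and their derivations -/

namespace B2

/-- The derivative of `f` at the jet `z` in the direction `w`. -/
noncomputable def dirD (f : Jet → ℝ) (z w : Jet) : ℝ :=
  deriv (fun t : ℝ => f (fun s k => z s k + t * w s k)) 0

/-- The jet of the derivative. -/
def shift (z : Jet) : Jet := fun s k => z (s + 1) k

theorem totalD_eq (f : Jet → ℝ) (z : Jet) : totalD f z = dirD f z (shift z) := rfl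

theorem timeD_eq (X : Fin 2 → Jet → ℝ) (f : Jet → ℝ) (z : Jet) :
    timeD X f z = dirD f z (jetOf X z) := rfl

/-- Differential functions over `U`: polynomials in the derivatives whose coefficients are smooth
functions on `U`. Values at jets outside of `U` are disregarded. -/
inductive IsDiffFn (U : Set (ℝ × ℝ)) : (Jet → ℝ) → Prop
  | ofBase (a : ℝ × ℝ → ℝ) (ha : ContDiffOn ℝ ∞ a U) : IsDiffFn U fun z => a (base z)
  | coord (s : ℕ) (k : Fin 2) : IsDiffFn U fun z => z s k
  | add {f g : Jet → ℝ} (hf : IsDiffFn U f) (hg : IsDiffFn U g) : IsDiffFn U fun z => f z + g z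
  | mul {f g : Jet → ℝ} (hf : IsDiffFn U f) (hg : IsDiffFn U g) : IsDiffFn U fun z => f z * g z
  | congr {f g : Jet → ℝ} (hf : IsDiffFn U f) (h : ∀ z, base z ∈ U → g z = f z) : IsDiffFn U g

variable {U : Set (ℝ × ℝ)} {f g : Jet → ℝ} {z w w' : Jet}

theorem eventually_base_mem (hU : IsOpen U) (hz : base z ∈ U) (w : Jet) :
    ∀ᶠ t : ℝ in nhds 0, base (fun s k => z s k + t * w s k) ∈ U := by
  have hc : Continuous fun t : ℝ => (z 0 0 + t * w 0 0, z 0 1 + t * w 0 1) := by fun_prop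
  refine hc.continuousAt.preimage_mem_nhds (hU.mem_nhds ?_)
  simpa [base] using hz

/-- Openness of `U` keeps the line through `z` over `U` for small `t`, so values at jets outside `U`
play no role. This is what lets formulas valid only over `U` be differentiated. -/
theorem dirD_congr (hU : IsOpen U) (hz : base z ∈ U) (h : ∀ y, base y ∈ U → g y = f y) :
    dirD g z w = dirD f z w := by
  refine Filter.EventuallyEq.deriv_eq ?_
  filter_upwards [eventually_base_mem hU hz w] with t ht using h _ ht

namespace IsDiffFn

theorem const (c : ℝ) : IsDiffFn U fun _ => c := ofBase (fun _ => c) contDiffOn_const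

theorem const_mul (c : ℝ) (hf : IsDiffFn U f) : IsDiffFn U fun z => c * f z := (const c).mul hf

theorem neg (hf : IsDiffFn U f) : IsDiffFn U fun z => -f z :=
  (hf.const_mul (-1)).congr fun z _ => by ring

theorem sub (hf : IsDiffFn U f) (hg : IsDiffFn U g) : IsDiffFn U fun z => f z - g z :=
  (hf.add hg.neg).congr fun z _ => by ring

theorem differentiableAt (hU : IsOpen U) (hf : IsDiffFn U f) (hz : base z ∈ U) (w : Jet) :
    DifferentiableAt ℝ (fun t : ℝ => f (fun s k => z s k + t * w s k)) 0 := by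
  induction hf with
  | ofBase a ha =>
    exact ((hasGrad_of_contDiffOn ha hU hz).hasDerivAt_line
      (x := z 0 0) (y := z 0 1) rfl).differentiableAt
  | coord s k => fun_prop
  | add _ _ h1 h2 => exact h1.add h2
  | mul _ _ h1 h2 => exact h1.mul h2
  | congr _ h h1 =>
    refine h1.congr_of_eventuallyEq ?_
    filter_upwards [eventually_base_mem hU hz w] with t ht using h _ ht

end IsDiffFn

theorem dirD_base {a : ℝ × ℝ → ℝ} (ha : ContDiffOn ℝ ∞ a U) (hU : IsOpen U) (hz : base z ∈ U) :
    dirD (fun z => a (base z)) z w = dU a (base z) * w 0 0 + dV a (base z) * w 0 1 :=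
  ((hasGrad_of_contDiffOn ha hU hz).hasDerivAt_line (x := z 0 0) (y := z 0 1) rfl).deriv

theorem dirD_coord (s : ℕ) (k : Fin 2) (z w : Jet) : dirD (fun z => z s k) z w = w s k := by
  have h : HasDerivAt (fun t : ℝ => z s k + t * w s k) (w s k) 0 := by
    simpa using ((hasDerivAt_id (0 : ℝ)).mul_const (w s k)).const_add (z s k)
  exact h.deriv

theorem dirD_const (c : ℝ) (z w : Jet) : dirD (fun _ => c) z w = 0 := deriv_const _ _

theorem dirD_add (hU : IsOpen U) (hf : IsDiffFn U f) (hg : IsDiffFn U g) (hz : base z ∈ U) :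
    dirD (fun z => f z + g z) z w = dirD f z w + dirD g z w :=
  deriv_fun_add (hf.differentiableAt hU hz w) (hg.differentiableAt hU hz w)

theorem dirD_mul (hU : IsOpen U) (hf : IsDiffFn U f) (hg : IsDiffFn U g) (hz : base z ∈ U) :
    dirD (fun z => f z * g z) z w = dirD f z w * g z + f z * dirD g z w := by
  have := deriv_fun_mul (hf.differentiableAt hU hz w) (hg.differentiableAt hU hz w)
  simpa [dirD] using this

theorem dirD_const_mul (hU : IsOpen U) (c : ℝ) (hf : IsDiffFn U f) (hz : base z ∈ U) :
    dirD (fun z => c * f z) z w = c * dirD f z w := by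
  rw [dirD_mul hU (IsDiffFn.const c) hf hz, dirD_const]; ring

theorem dirD_sub (hU : IsOpen U) (hf : IsDiffFn U f) (hg : IsDiffFn U g) (hz : base z ∈ U) :
    dirD (fun z => f z - g z) z w = dirD f z w - dirD g z w :=
  deriv_fun_sub (hf.differentiableAt hU hz w) (hg.differentiableAt hU hz w)

/-- A derivative along lines need not be linear in the direction for an arbitrary function. For
differential functions it is, by induction from the gradient of a coefficient and the Leibniz rule.
-/
theorem dirD_add_smul (hU : IsOpen U) (hf : IsDiffFn U f) (hz : base z ∈ U) (c : ℝ) (w w' : Jet) :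
    dirD f z (fun s k => w s k + c * w' s k) = dirD f z w + c * dirD f z w' := by
  induction hf with
  | ofBase a ha => rw [dirD_base ha hU hz, dirD_base ha hU hz, dirD_base ha hU hz]; ring
  | coord s k => simp only [dirD_coord]
  | add hf hg h1 h2 =>
    rw [dirD_add hU hf hg hz, dirD_add hU hf hg hz, dirD_add hU hf hg hz, h1, h2]; ring
  | mul hf hg h1 h2 =>
    rw [dirD_mul hU hf hg hz, dirD_mul hU hf hg hz, dirD_mul hU hf hg hz, h1, h2]; ring
  | congr hf h h1 => simpa only [dirD_congr hU hz h] using h1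

/-- Differentiation along a vector field with differential functions as components. -/
theorem IsDiffFn.dirD (hU : IsOpen U) (hf : IsDiffFn U f) {Y : Jet → Jet}
    (hY : ∀ s k, IsDiffFn U fun z => Y z s k) : IsDiffFn U fun z => dirD f z (Y z) := by
  induction hf with
  | ofBase a ha =>
    exact (((ofBase _ (contDiffOn_dU ha hU)).mul (hY 0 0)).add
      ((ofBase _ (contDiffOn_dV ha hU)).mul (hY 0 1))).congr fun z hz => dirD_base ha hU hz
  | coord s k => exact (hY s k).congr fun z _ => dirD_coord s k z _
  | add hf hg h1 h2 => exact (h1.add h2).congr fun z hz => dirD_add hU hf hg hz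
  | mul hf hg h1 h2 => exact ((h1.mul hg).add (hf.mul h2)).congr fun z hz => dirD_mul hU hf hg hz
  | congr hf h h1 => exact h1.congr fun z hz => dirD_congr hU hz h

theorem IsDiffFn.totalD (hU : IsOpen U) (hf : IsDiffFn U f) : IsDiffFn U (totalD f) :=
  hf.dirD hU fun s k => coord (s + 1) k

theorem IsDiffFn.iterate_totalD (hU : IsOpen U) (hf : IsDiffFn U f) (n : ℕ) :
    IsDiffFn U (B2.totalD^[n] f) := by
  induction n with
  | zero => exact hf
  | succ n ih => rw [Function.iterate_succ_apply']; exact ih.totalD hU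

theorem IsDiffFn.timeD (hU : IsOpen U) (hf : IsDiffFn U f) {X : Fin 2 → Jet → ℝ}
    (hX : ∀ k, IsDiffFn U (X k)) : IsDiffFn U (timeD X f) :=
  hf.dirD hU fun s k => (hX k).iterate_totalD hU s

theorem totalD_congr (hU : IsOpen U) (hz : base z ∈ U) (h : ∀ y, base y ∈ U → g y = f y) :
    totalD g z = totalD f z := dirD_congr hU hz h

theorem timeD_congr (hU : IsOpen U) (hz : base z ∈ U) (h : ∀ y, base y ∈ U → g y = f y)
    (X : Fin 2 → Jet → ℝ) : timeD X g z = timeD X f z := dirD_congr hU hz h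

theorem iterate_totalD_congr (hU : IsOpen U) (h : ∀ y, base y ∈ U → g y = f y) (n : ℕ) :
    ∀ z, base z ∈ U → totalD^[n] g z = totalD^[n] f z := by
  induction n with
  | zero => exact h
  | succ n ih =>
    intro z hz
    rw [Function.iterate_succ_apply', Function.iterate_succ_apply']
    exact totalD_congr hU hz ih

theorem totalD_add (hU : IsOpen U) (hf : IsDiffFn U f) (hg : IsDiffFn U g) (hz : base z ∈ U) :
    totalD (fun z => f z + g z) z = totalD f z + totalD g z := dirD_add hU hf hg hz

theorem totalD_mul (hU : IsOpen U) (hf : IsDiffFn U f) (hg : IsDiffFn U g) (hz : base z ∈ U) :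
    totalD (fun z => f z * g z) z = totalD f z * g z + f z * totalD g z := dirD_mul hU hf hg hz

theorem totalD_sub (hU : IsOpen U) (hf : IsDiffFn U f) (hg : IsDiffFn U g) (hz : base z ∈ U) :
    totalD (fun z => f z - g z) z = totalD f z - totalD g z := dirD_sub hU hf hg hz

theorem totalD_const_mul (hU : IsOpen U) (c : ℝ) (hf : IsDiffFn U f) (hz : base z ∈ U) :
    totalD (fun z => c * f z) z = c * totalD f z := dirD_const_mul hU c hf hz

theorem totalD_base {a : ℝ × ℝ → ℝ} (ha : ContDiffOn ℝ ∞ a U) (hU : IsOpen U) (hz : base z ∈ U) :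
    totalD (fun z => a (base z)) z = dU a (base z) * z 1 0 + dV a (base z) * z 1 1 :=
  dirD_base ha hU hz

theorem totalD_coord (s : ℕ) (k : Fin 2) (z : Jet) : totalD (fun z => z s k) z = z (s + 1) k :=
  dirD_coord s k z (shift z)

theorem iterate_totalD_coord (n s : ℕ) (k : Fin 2) :
    totalD^[n] (fun z => z s k) = fun z => z (s + n) k := by
  induction n with
  | zero => rfl
  | succ n ih =>
    rw [Function.iterate_succ_apply', ih]
    exact funext fun z => totalD_coord _ _ _

theorem iterate_totalD_add_smul (hU : IsOpen U) (hf : IsDiffFn U f) (hg : IsDiffFn U g) (c : ℝ)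
    (n : ℕ) : ∀ z, base z ∈ U →
      totalD^[n] (fun z => f z + c * g z) z = totalD^[n] f z + c * totalD^[n] g z := by
  induction n with
  | zero => exact fun z _ => rfl
  | succ n ih =>
    intro z hz
    simp only [Function.iterate_succ_apply']
    rw [totalD_congr hU hz ih,
      totalD_add hU (hf.iterate_totalD hU n) ((hg.iterate_totalD hU n).const_mul c) hz,
      totalD_const_mul hU c (hg.iterate_totalD hU n) hz]

theorem timeD_add_smul (hU : IsOpen U) {X Y : Fin 2 → Jet → ℝ} (hf : IsDiffFn U f)
    (hX : ∀ k, IsDiffFn U (X k)) (hY : ∀ k, IsDiffFn U (Y k)) (c : ℝ) (hz : base z ∈ U) :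
    timeD (fun k z => X k z + c * Y k z) f z = timeD X f z + c * timeD Y f z := by
  have h : jetOf (fun k z => X k z + c * Y k z) z
      = fun s k => jetOf X z s k + c * jetOf Y z s k := by
    funext s k
    exact iterate_totalD_add_smul hU (hX k) (hY k) c s z hz
  rw [timeD_eq, h, dirD_add_smul hU hf hz]; rfl

theorem timeD_congr_flow (hU : IsOpen U) {X Y : Fin 2 → Jet → ℝ} (hz : base z ∈ U)
    (h : ∀ k y, base y ∈ U → X k y = Y k y) (f : Jet → ℝ) : timeD X f z = timeD Y f z := by
  have h' : jetOf X z = jetOf Y z := by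
    funext s k
    exact iterate_totalD_congr hU (h k) s z hz
  rw [timeD_eq, h']; rfl

/-- Derivations along evolutionary flows commute with the total derivative. -/
theorem timeD_totalD (hU : IsOpen U) {X : Fin 2 → Jet → ℝ} (hX : ∀ k, IsDiffFn U (X k))
    (hf : IsDiffFn U f) : ∀ z, base z ∈ U → timeD X (totalD f) z = totalD (timeD X f) z := by
  induction hf with
  -- The only case with analytic content: after expansion the two sides differ by the order of a
  -- mixed second derivative of `a`. The case of a coordinate holds by the definition of
  -- prolongation, and sums and products follow from the Leibniz rule.
  | ofBase a ha =>
    intro z hz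
    have hu := IsDiffFn.ofBase _ (contDiffOn_dU ha hU)
    have hv := IsDiffFn.ofBase _ (contDiffOn_dV ha hU)
    have e1 : ∀ y, base y ∈ U → totalD (fun z => a (base z)) y
        = dU a (base y) * y 1 0 + dV a (base y) * y 1 1 := fun y hy => dirD_base ha hU hy
    have e2 : ∀ y, base y ∈ U → timeD X (fun z => a (base z)) y
        = dU a (base y) * X 0 y + dV a (base y) * X 1 y := fun y hy => dirD_base ha hU hy
    rw [timeD_congr hU hz e1, totalD_congr hU hz e2,
      totalD_add hU (hu.mul (hX 0)) (hv.mul (hX 1)) hz, totalD_mul hU hu (hX 0) hz,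
      totalD_mul hU hv (hX 1) hz, totalD_base (contDiffOn_dU ha hU) hU hz,
      totalD_base (contDiffOn_dV ha hU) hU hz, timeD_eq,
      dirD_add hU (hu.mul (.coord 1 0)) (hv.mul (.coord 1 1)) hz, dirD_mul hU hu (.coord 1 0) hz,
      dirD_mul hU hv (.coord 1 1) hz, dirD_base (contDiffOn_dU ha hU) hU hz,
      dirD_base (contDiffOn_dV ha hU) hU hz, dirD_coord, dirD_coord, dU_dV ha hU hz]
    simp only [jetOf, Function.iterate_zero, id, Function.iterate_one]
    ring
  | coord s k =>
    intro z _
    have e1 : totalD (fun z => z s k) = fun z => z (s + 1) k := funext fun z => totalD_coord s k z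
    have e2 : timeD X (fun z => z s k) = totalD^[s] (X k) := funext fun z => dirD_coord s k z (jetOf X z)
    rw [e1, e2, timeD_eq, dirD_coord, jetOf, Function.iterate_succ_apply']
  | @add f g hf hg h1 h2 =>
    intro z hz
    have e1 : ∀ y, base y ∈ U → totalD (fun z => f z + g z) y = totalD f y + totalD g y :=
      fun y hy => dirD_add hU hf hg hy
    have e2 : ∀ y, base y ∈ U → timeD X (fun z => f z + g z) y = timeD X f y + timeD X g y :=
      fun y hy => dirD_add hU hf hg hy
    rw [timeD_congr hU hz e1, totalD_congr hU hz e2, totalD_add hU (hf.timeD hU hX)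
      (hg.timeD hU hX) hz, timeD_eq, dirD_add hU (hf.totalD hU) (hg.totalD hU) hz,
      ← h1 z hz, ← h2 z hz]
    rfl
  | @mul f g hf hg h1 h2 =>
    intro z hz
    have e1 : ∀ y, base y ∈ U → totalD (fun z => f z * g z) y
        = totalD f y * g y + f y * totalD g y := fun y hy => dirD_mul hU hf hg hy
    have e2 : ∀ y, base y ∈ U → timeD X (fun z => f z * g z) y
        = timeD X f y * g y + f y * timeD X g y := fun y hy => dirD_mul hU hf hg hy
    rw [timeD_congr hU hz e1, totalD_congr hU hz e2, totalD_add hU ((hf.timeD hU hX).mul hg)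
      (hf.mul (hg.timeD hU hX)) hz, totalD_mul hU (hf.timeD hU hX) hg hz,
      totalD_mul hU hf (hg.timeD hU hX) hz, timeD_eq,
      dirD_add hU ((hf.totalD hU).mul hg) (hf.mul (hg.totalD hU)) hz,
      dirD_mul hU (hf.totalD hU) hg hz, dirD_mul hU hf (hg.totalD hU) hz,
      ← timeD_eq, ← timeD_eq, ← timeD_eq, ← timeD_eq, h1 z hz, h2 z hz]
    ring
  | @congr f g hf h h1 =>
    intro z hz
    rw [timeD_congr hU hz fun y hy => totalD_congr hU hy h,
      totalD_congr hU hz fun y hy => timeD_congr hU hy h X, h1 z hz]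

end B2

/-! ### Differential polynomials of degree two and three -/

namespace B2

variable {U : Set (ℝ × ℝ)} {p : ℝ × ℝ} {z : Jet}

/-- The general homogeneous differential polynomial of degree three. -/
def degThree (m : Fin 10 → ℝ × ℝ → ℝ) : Jet → ℝ :=
  fun z => m 0 (base z) * z 3 0 + m 1 (base z) * z 3 1 + m 2 (base z) * (z 2 0 * z 1 0)
    + m 3 (base z) * (z 2 0 * z 1 1) + m 4 (base z) * (z 2 1 * z 1 0)
    + m 5 (base z) * (z 2 1 * z 1 1) + m 6 (base z) * z 1 0 ^ 3
    + m 7 (base z) * (z 1 0 ^ 2 * z 1 1) + m 8 (base z) * (z 1 0 * z 1 1 ^ 2)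
    + m 9 (base z) * z 1 1 ^ 3

/-- The coefficients of the total derivative of `degTwo b`. -/
noncomputable def totalCoeff (b : Fin 5 → ℝ × ℝ → ℝ) (p : ℝ × ℝ) : Fin 10 → ℝ :=
  ![b 0 p, b 1 p, dU (b 0) p + 2 * b 2 p, dV (b 0) p + b 4 p, dU (b 1) p + b 4 p,
    dV (b 1) p + 2 * b 3 p, dU (b 2) p, dV (b 2) p + dU (b 4) p, dU (b 3) p + dV (b 4) p,
    dV (b 3) p]

/-- The coefficients of the derivative of `degTwo b` along the flow `u^i_t = ∂ₓ (f i (u, v))`. -/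
noncomputable def timeCoeff (f : Fin 2 → ℝ × ℝ → ℝ) (b : Fin 5 → ℝ × ℝ → ℝ) (p : ℝ × ℝ) :
    Fin 10 → ℝ :=
  ![b 0 p * dU (f 0) p + b 1 p * dU (f 1) p,
    b 0 p * dV (f 0) p + b 1 p * dV (f 1) p,
    dU (b 0) p * dU (f 0) p + dV (b 0) p * dU (f 1) p + 3 * b 0 p * dU (dU (f 0)) p
      + 3 * b 1 p * dU (dU (f 1)) p + 2 * b 2 p * dU (f 0) p + b 4 p * dU (f 1) p,
    dU (b 0) p * dV (f 0) p + dV (b 0) p * dV (f 1) p + 3 * b 0 p * dU (dV (f 0)) p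
      + 3 * b 1 p * dU (dV (f 1)) p + 2 * b 3 p * dU (f 1) p + b 4 p * dU (f 0) p,
    dU (b 1) p * dU (f 0) p + dV (b 1) p * dU (f 1) p + 3 * b 0 p * dU (dV (f 0)) p
      + 3 * b 1 p * dU (dV (f 1)) p + 2 * b 2 p * dV (f 0) p + b 4 p * dV (f 1) p,
    dU (b 1) p * dV (f 0) p + dV (b 1) p * dV (f 1) p + 3 * b 0 p * dV (dV (f 0)) p
      + 3 * b 1 p * dV (dV (f 1)) p + 2 * b 3 p * dV (f 1) p + b 4 p * dV (f 0) p,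
    b 0 p * dU (dU (dU (f 0))) p + b 1 p * dU (dU (dU (f 1))) p + dU (b 2) p * dU (f 0) p
      + dV (b 2) p * dU (f 1) p + 2 * b 2 p * dU (dU (f 0)) p + b 4 p * dU (dU (f 1)) p,
    3 * b 0 p * dU (dU (dV (f 0))) p + 3 * b 1 p * dU (dU (dV (f 1))) p
      + dU (b 2) p * dV (f 0) p + dV (b 2) p * dV (f 1) p + 4 * b 2 p * dU (dV (f 0)) p
      + 2 * b 3 p * dU (dU (f 1)) p + b 4 p * (dU (dU (f 0)) p + 2 * dU (dV (f 1)) p)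
      + dU (b 4) p * dU (f 0) p + dV (b 4) p * dU (f 1) p,
    3 * b 0 p * dU (dV (dV (f 0))) p + 3 * b 1 p * dU (dV (dV (f 1))) p
      + dU (b 3) p * dU (f 0) p + dV (b 3) p * dU (f 1) p + 2 * b 2 p * dV (dV (f 0)) p
      + 4 * b 3 p * dU (dV (f 1)) p + b 4 p * (2 * dU (dV (f 0)) p + dV (dV (f 1)) p)
      + dU (b 4) p * dV (f 0) p + dV (b 4) p * dV (f 1) p,
    b 0 p * dV (dV (dV (f 0))) p + b 1 p * dV (dV (dV (f 1))) p + dU (b 3) p * dV (f 0) p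
      + dV (b 3) p * dV (f 1) p + 2 * b 3 p * dV (dV (f 1)) p + b 4 p * dV (dV (f 0)) p]

/-- The coefficients of the contribution of the dispersionless flow of `f` and of the deformation
`b` of the other flow to the `i`-th component of the commutator at order `ε²`. -/
noncomputable def commCoeff (f : Fin 2 → ℝ × ℝ → ℝ) (b : Fin 2 → Fin 5 → ℝ × ℝ → ℝ) (i : Fin 2)
    (j : Fin 10) (p : ℝ × ℝ) : ℝ :=
  dU (f i) p * totalCoeff (b 0) p j + dV (f i) p * totalCoeff (b 1) p j - timeCoeff f (b i) p j

theorem isDiffFn_degTwo {b : Fin 5 → ℝ × ℝ → ℝ} (hb : ∀ k, ContDiffOn ℝ ∞ (b k) U) :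
    IsDiffFn U (degTwo b) := by
  have B := fun k => IsDiffFn.ofBase _ (hb k)
  have C := fun s k => IsDiffFn.coord (U := U) s k
  refine (((((B 0).mul (C 2 0)).add ((B 1).mul (C 2 1))).add ((B 2).mul ((C 1 0).mul (C 1 0)))).add
    ((B 3).mul ((C 1 1).mul (C 1 1)))).add ((B 4).mul ((C 1 0).mul (C 1 1))) |>.congr ?_
  intro z _
  simp only [degTwo]; ring

theorem isDiffFn_degThree {m : Fin 10 → ℝ × ℝ → ℝ} (hm : ∀ k, ContDiffOn ℝ ∞ (m k) U) :
    IsDiffFn U (degThree m) := by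
  have B := fun k => IsDiffFn.ofBase _ (hm k)
  have C := fun s k => IsDiffFn.coord (U := U) s k
  refine ((((((((((B 0).mul (C 3 0)).add ((B 1).mul (C 3 1))).add
    ((B 2).mul ((C 2 0).mul (C 1 0)))).add ((B 3).mul ((C 2 0).mul (C 1 1)))).add
    ((B 4).mul ((C 2 1).mul (C 1 0)))).add ((B 5).mul ((C 2 1).mul (C 1 1)))).add
    ((B 6).mul (((C 1 0).mul (C 1 0)).mul (C 1 0)))).add
    ((B 7).mul (((C 1 0).mul (C 1 0)).mul (C 1 1)))).add
    ((B 8).mul ((C 1 0).mul ((C 1 1).mul (C 1 1))))).add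
    ((B 9).mul (((C 1 1).mul (C 1 1)).mul (C 1 1))) |>.congr ?_
  intro z _
  simp only [degThree]; ring

theorem dirD_degTwo {b : Fin 5 → ℝ × ℝ → ℝ} (hU : IsOpen U) (hb : ∀ k, ContDiffOn ℝ ∞ (b k) U)
    (hz : base z ∈ U) (w : Jet) :
    dirD (degTwo b) z w =
      (dU (b 0) (base z) * w 0 0 + dV (b 0) (base z) * w 0 1) * z 2 0 + b 0 (base z) * w 2 0
      + ((dU (b 1) (base z) * w 0 0 + dV (b 1) (base z) * w 0 1) * z 2 1 + b 1 (base z) * w 2 1)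
      + ((dU (b 2) (base z) * w 0 0 + dV (b 2) (base z) * w 0 1) * z 1 0 ^ 2
        + b 2 (base z) * (2 * z 1 0 * w 1 0))
      + ((dU (b 3) (base z) * w 0 0 + dV (b 3) (base z) * w 0 1) * z 1 1 ^ 2
        + b 3 (base z) * (2 * z 1 1 * w 1 1))
      + ((dU (b 4) (base z) * w 0 0 + dV (b 4) (base z) * w 0 1) * (z 1 0 * z 1 1)
        + b 4 (base z) * (w 1 0 * z 1 1 + z 1 0 * w 1 1)) := by
  have B := fun k => (hasGrad_of_contDiffOn (hb k) hU hz).hasDerivAt_line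
    (x := z 0 0) (y := z 0 1) (x' := w 0 0) (y' := w 0 1) rfl
  have C : ∀ s k, HasDerivAt (fun t : ℝ => z s k + t * w s k) (w s k) 0 := fun s k => by
    simpa using ((hasDerivAt_id (0 : ℝ)).mul_const (w s k)).const_add (z s k)
  have := (((((B 0).mul (C 2 0)).add ((B 1).mul (C 2 1))).add ((B 2).mul ((C 1 0).pow 2))).add
    ((B 3).mul ((C 1 1).pow 2))).add ((B 4).mul ((C 1 0).mul (C 1 1)))
  refine (this.deriv).trans ?_
  simp [base]

theorem totalD_degTwo {b : Fin 5 → ℝ × ℝ → ℝ} (hU : IsOpen U) (hb : ∀ k, ContDiffOn ℝ ∞ (b k) U)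
    (hz : base z ∈ U) :
    totalD (degTwo b) z = degThree (fun j p => totalCoeff b p j) z := by
  rw [totalD_eq, dirD_degTwo hU hb hz]
  simp [shift, degThree, totalCoeff]
  ring

theorem dV_dU_dU {f : ℝ × ℝ → ℝ} (hf : ContDiffOn ℝ ∞ f U) (hU : IsOpen U) (hp : p ∈ U) :
    dV (dU (dU f)) p = dU (dU (dV f)) p := by
  rw [← dU_dV (contDiffOn_dU hf hU) hU hp]
  exact dU_congr_on hU hp fun q hq => (dU_dV hf hU hq).symm

theorem totalD_totalD_base {f : ℝ × ℝ → ℝ} (hU : IsOpen U) (hf : ContDiffOn ℝ ∞ f U)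
    (hz : base z ∈ U) :
    totalD (totalD fun z => f (base z)) z = degTwo
      ![dU f, dV f, dU (dU f), dV (dV f), fun p => 2 * dU (dV f) p] z := by
  have hu := contDiffOn_dU hf hU
  have hv := contDiffOn_dV hf hU
  have C := fun s k => IsDiffFn.coord (U := U) s k
  rw [totalD_congr hU hz (f := fun y => dU f (base y) * y 1 0 + dV f (base y) * y 1 1)
    (fun y hy => totalD_base hf hU hy), totalD_add hU ((IsDiffFn.ofBase _ hu).mul (C 1 0))
    ((IsDiffFn.ofBase _ hv).mul (C 1 1)) hz, totalD_mul hU (IsDiffFn.ofBase _ hu) (C 1 0) hz,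
    totalD_mul hU (IsDiffFn.ofBase _ hv) (C 1 1) hz, totalD_base hu hU hz, totalD_base hv hU hz,
    totalD_coord, totalD_coord]
  simp [degTwo, ← dU_dV hf hU hz]
  ring

theorem iterate_totalD_base_three {f : ℝ × ℝ → ℝ} (hU : IsOpen U) (hf : ContDiffOn ℝ ∞ f U)
    (hz : base z ∈ U) :
    totalD^[3] (fun z => f (base z)) z = degThree
      ![dU f, dV f, fun p => 3 * dU (dU f) p, fun p => 3 * dU (dV f) p, fun p => 3 * dU (dV f) p,
        fun p => 3 * dV (dV f) p, dU (dU (dU f)), fun p => 3 * dU (dU (dV f)) p,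
        fun p => 3 * dU (dV (dV f)) p, dV (dV (dV f))] z := by
  have hu := contDiffOn_dU hf hU
  have hv := contDiffOn_dV hf hU
  have huv := contDiffOn_dU hv hU
  rw [Function.iterate_succ_apply',
    totalD_congr hU hz (g := totalD^[2] fun z => f (base z))
      fun y hy => totalD_totalD_base hU hf hy, totalD_degTwo hU ?_ hz]
  · have e := (HasGrad.mul (HasGrad.const 2) (hasGrad_of_contDiffOn huv hU hz))
    simp [degThree, totalCoeff, e.dU_eq, e.dV_eq, ← dU_dV hf hU hz, dV_dU_dU hf hU hz,
      ← dU_dV hv hU hz]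
    ring
  · intro k
    fin_cases k
    exacts [hu, hv, contDiffOn_dU hu hU, contDiffOn_dV hv hU, contDiffOn_const.mul huv]

/-- A polynomial of degree two involves jets up to order two, so only `u_t`, `∂ₓ u_t` and `∂ₓ² u_t`
enter. This is why third derivatives of `f` occur in `timeCoeff`. -/
theorem timeD_dispersionless_degTwo {f : Fin 2 → ℝ × ℝ → ℝ} {b : Fin 5 → ℝ × ℝ → ℝ}
    (hU : IsOpen U) (hf : ∀ i, ContDiffOn ℝ ∞ (f i) U) (hb : ∀ k, ContDiffOn ℝ ∞ (b k) U)
    (hz : base z ∈ U) :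
    timeD (dispersionless f) (degTwo b) z = degThree (fun j p => timeCoeff f b p j) z := by
  have e0 : ∀ k, jetOf (dispersionless f) z 0 k
      = dU (f k) (base z) * z 1 0 + dV (f k) (base z) * z 1 1 := fun k =>
    totalD_base (hf k) hU hz
  have e1 : ∀ k, jetOf (dispersionless f) z 1 k = _ := fun k => totalD_totalD_base hU (hf k) hz
  have e2 : ∀ k, jetOf (dispersionless f) z 2 k = _ := fun k =>
    iterate_totalD_base_three hU (hf k) hz
  rw [timeD_eq, dirD_degTwo hU hb hz]
  simp only [e0, e1, e2]
  simp [degThree, degTwo, timeCoeff]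
  ring

/-- Evolutionary derivations commute with `∂ₓ`, so the outer `∂ₓ` can be pulled out of both terms
and the commutator can be computed on densities. -/
theorem flowComm_consLaw (hU : IsOpen U) {α β : Fin 2 → Jet → ℝ} (hα : ∀ i, IsDiffFn U (α i))
    (hβ : ∀ i, IsDiffFn U (β i)) (hz : base z ∈ U) (i : Fin 2) :
    flowComm (consLaw α) (consLaw β) i z =
      totalD (fun y => timeD (consLaw β) (α i) y - timeD (consLaw α) (β i) y) z := by
  have hA : ∀ i, IsDiffFn U (consLaw α i) := fun i => (hα i).totalD hU
  have hB : ∀ i, IsDiffFn U (consLaw β i) := fun i => (hβ i).totalD hU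
  rw [totalD_sub hU ((hα i).timeD hU hB) ((hβ i).timeD hU hA) hz,
    ← timeD_totalD hU hB (hα i) z hz, ← timeD_totalD hU hA (hβ i) z hz]
  rfl

end B2

/-! ### Expansion of the commutator in powers of `ε` -/

namespace B2

variable {U : Set (ℝ × ℝ)} {p : ℝ × ℝ} {z : Jet}

theorem contDiffOn_totalCoeff {b : Fin 5 → ℝ × ℝ → ℝ} (hU : IsOpen U)
    (hb : ∀ k, ContDiffOn ℝ ∞ (b k) U) (j : Fin 10) :
    ContDiffOn ℝ ∞ (fun p => totalCoeff b p j) U := by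
  have hu := fun k => contDiffOn_dU (hb k) hU
  have hv := fun k => contDiffOn_dV (hb k) hU
  fin_cases j <;> simp [totalCoeff] <;> fun_prop

theorem contDiffOn_timeCoeff {f : Fin 2 → ℝ × ℝ → ℝ} {b : Fin 5 → ℝ × ℝ → ℝ} (hU : IsOpen U)
    (hf : ∀ k, ContDiffOn ℝ ∞ (f k) U) (hb : ∀ k, ContDiffOn ℝ ∞ (b k) U) (j : Fin 10) :
    ContDiffOn ℝ ∞ (fun p => timeCoeff f b p j) U := by
  have hu := fun k => contDiffOn_dU (hb k) hU
  have hv := fun k => contDiffOn_dV (hb k) hU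
  have fu := fun k => contDiffOn_dU (hf k) hU
  have fv := fun k => contDiffOn_dV (hf k) hU
  have fuu := fun k => contDiffOn_dU (fu k) hU
  have fuv := fun k => contDiffOn_dU (fv k) hU
  have fvv := fun k => contDiffOn_dV (fv k) hU
  have f3 := fun k => contDiffOn_dU (fuu k) hU
  have f4 := fun k => contDiffOn_dU (fuv k) hU
  have f5 := fun k => contDiffOn_dU (fvv k) hU
  have f6 := fun k => contDiffOn_dV (fvv k) hU
  fin_cases j <;> simp [timeCoeff] <;> fun_prop

theorem contDiffOn_commCoeff {f : Fin 2 → ℝ × ℝ → ℝ} {b : Fin 2 → Fin 5 → ℝ × ℝ → ℝ}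
    (hU : IsOpen U) (hf : ∀ k, ContDiffOn ℝ ∞ (f k) U) (hb : ∀ i k, ContDiffOn ℝ ∞ (b i k) U)
    (i : Fin 2) (j : Fin 10) : ContDiffOn ℝ ∞ (commCoeff f b i j) U :=
  (((contDiffOn_dU (hf i) hU).mul (contDiffOn_totalCoeff hU (hb 0) j)).add
    ((contDiffOn_dV (hf i) hU).mul (contDiffOn_totalCoeff hU (hb 1) j))).sub
    (contDiffOn_timeCoeff hU hf (hb i) j)

/-- The value at `ε = 0` gives `c₀ = 0`; dividing by `ε²` away from zero and passing to the limit
then gives `c₂ = 0`. -/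
theorem isBigO_even_cubed {c₀ c₂ c₄ : ℝ} :
    (fun ε : ℝ => c₀ + ε ^ 2 * c₂ + ε ^ 4 * c₄) =O[nhds 0] (fun ε : ℝ => ε ^ 3)
      ↔ c₀ = 0 ∧ c₂ = 0 := by
  constructor
  · intro h
    have h0 : c₀ = 0 := by
      have hc : Continuous fun ε : ℝ => c₀ + ε ^ 2 * c₂ + ε ^ 4 * c₄ := by fun_prop
      have h1 : Filter.Tendsto (fun ε : ℝ => ε ^ 3) (nhds 0) (nhds 0) :=
        (by fun_prop : Continuous fun ε : ℝ => ε ^ 3).tendsto' _ _ (by simp)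
      exact tendsto_nhds_unique (hc.tendsto' 0 c₀ (by simp)) (h.trans_tendsto h1)
    subst h0
    refine ⟨rfl, ?_⟩
    have hc : Continuous fun ε : ℝ => c₂ + ε ^ 2 * c₄ := by fun_prop
    have h1 : Filter.Tendsto (fun ε : ℝ => c₂ + ε ^ 2 * c₄) (nhdsWithin 0 {0}ᶜ) (nhds c₂) :=
      (hc.tendsto' 0 c₂ (by simp)).mono_left nhdsWithin_le_nhds
    have h2 : (fun ε : ℝ => c₂ + ε ^ 2 * c₄) =O[nhdsWithin 0 {0}ᶜ] (fun ε : ℝ => ε) := by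
      have h3 := (Asymptotics.isBigO_refl (fun ε : ℝ => (ε ^ 2)⁻¹) (nhdsWithin 0 {0}ᶜ)).mul
        (h.mono nhdsWithin_le_nhds)
      refine h3.congr' ?_ ?_ <;> filter_upwards [self_mem_nhdsWithin] with ε hε <;>
        have hε : ε ≠ 0 := hε <;> field_simp
      ring
    have h4 : Filter.Tendsto (fun ε : ℝ => ε) (nhdsWithin 0 {0}ᶜ) (nhds 0) :=
      Filter.tendsto_id.mono_left nhdsWithin_le_nhds
    exact tendsto_nhds_unique h1 (h2.trans_tendsto h4)
  · rintro ⟨rfl, rfl⟩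
    have h1 : (fun ε : ℝ => ε ^ 4 * c₄) =O[nhds 0] (fun ε : ℝ => ε ^ 3) := by
      have h2 : (fun ε : ℝ => ε * c₄) =O[nhds 0] (fun _ : ℝ => (1 : ℝ)) :=
        (by fun_prop : Continuous fun ε : ℝ => ε * c₄).continuousAt.isBigO_one ℝ
      refine ((Asymptotics.isBigO_refl (fun ε : ℝ => ε ^ 3) _).mul h2).congr ?_ ?_ <;>
        intro ε <;> ring
    simpa using h1

theorem dirD_degThree {m : Fin 10 → ℝ × ℝ → ℝ} (hU : IsOpen U) (hm : ∀ k, ContDiffOn ℝ ∞ (m k) U)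
    (hz : base z ∈ U) (w : Jet) :
    dirD (degThree m) z w =
      ((dU (m 0) (base z) * w 0 0 + dV (m 0) (base z) * w 0 1) * z 3 0 + m 0 (base z) * w 3 0)
      + ((dU (m 1) (base z) * w 0 0 + dV (m 1) (base z) * w 0 1) * z 3 1 + m 1 (base z) * w 3 1)
      + ((dU (m 2) (base z) * w 0 0 + dV (m 2) (base z) * w 0 1) * (z 2 0 * z 1 0)
        + m 2 (base z) * (w 2 0 * z 1 0 + z 2 0 * w 1 0))
      + ((dU (m 3) (base z) * w 0 0 + dV (m 3) (base z) * w 0 1) * (z 2 0 * z 1 1)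
        + m 3 (base z) * (w 2 0 * z 1 1 + z 2 0 * w 1 1))
      + ((dU (m 4) (base z) * w 0 0 + dV (m 4) (base z) * w 0 1) * (z 2 1 * z 1 0)
        + m 4 (base z) * (w 2 1 * z 1 0 + z 2 1 * w 1 0))
      + ((dU (m 5) (base z) * w 0 0 + dV (m 5) (base z) * w 0 1) * (z 2 1 * z 1 1)
        + m 5 (base z) * (w 2 1 * z 1 1 + z 2 1 * w 1 1))
      + ((dU (m 6) (base z) * w 0 0 + dV (m 6) (base z) * w 0 1) * z 1 0 ^ 3
        + m 6 (base z) * (3 * z 1 0 ^ 2 * w 1 0))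
      + ((dU (m 7) (base z) * w 0 0 + dV (m 7) (base z) * w 0 1) * (z 1 0 ^ 2 * z 1 1)
        + m 7 (base z) * (2 * z 1 0 * w 1 0 * z 1 1 + z 1 0 ^ 2 * w 1 1))
      + ((dU (m 8) (base z) * w 0 0 + dV (m 8) (base z) * w 0 1) * (z 1 0 * z 1 1 ^ 2)
        + m 8 (base z) * (w 1 0 * z 1 1 ^ 2 + z 1 0 * (2 * z 1 1 * w 1 1)))
      + ((dU (m 9) (base z) * w 0 0 + dV (m 9) (base z) * w 0 1) * z 1 1 ^ 3
        + m 9 (base z) * (3 * z 1 1 ^ 2 * w 1 1)) := by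
  have B := fun k => (hasGrad_of_contDiffOn (hm k) hU hz).hasDerivAt_line
    (x := z 0 0) (y := z 0 1) (x' := w 0 0) (y' := w 0 1) rfl
  have C : ∀ s k, HasDerivAt (fun t : ℝ => z s k + t * w s k) (w s k) 0 := fun s k => by
    simpa using ((hasDerivAt_id (0 : ℝ)).mul_const (w s k)).const_add (z s k)
  have := ((((((((((B 0).mul (C 3 0)).add ((B 1).mul (C 3 1))).add
    ((B 2).mul ((C 2 0).mul (C 1 0)))).add ((B 3).mul ((C 2 0).mul (C 1 1)))).add
    ((B 4).mul ((C 2 1).mul (C 1 0)))).add ((B 5).mul ((C 2 1).mul (C 1 1)))).add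
    ((B 6).mul ((C 1 0).pow 3))).add
    ((B 7).mul (((C 1 0).pow 2).mul (C 1 1)))).add
    ((B 8).mul ((C 1 0).mul ((C 1 1).pow 2)))).add
    ((B 9).mul ((C 1 1).pow 3))
  refine (this.deriv).trans ?_
  simp [base]

/-- A jet with prescribed derivatives up to order four. -/
def jetMk (p : ℝ × ℝ) (x₁ y₁ x₂ y₂ x₃ y₃ x₄ y₄ : ℝ) : Jet := fun s k =>
  match s with
  | 0 => ![p.1, p.2] k
  | 1 => ![x₁, y₁] k
  | 2 => ![x₂, y₂] k
  | 3 => ![x₃, y₃] k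
  | 4 => ![x₄, y₄] k
  | _ => 0

theorem dU_eq_zero_of_eqOn {f : ℝ × ℝ → ℝ} (hU : IsOpen U) (h : ∀ q ∈ U, f q = 0) (hp : p ∈ U) :
    dU f p = 0 :=
  (dU_congr_on hU hp h).trans (HasGrad.const 0).dU_eq

theorem dV_eq_zero_of_eqOn {f : ℝ × ℝ → ℝ} (hU : IsOpen U) (h : ∀ q ∈ U, f q = 0) (hp : p ∈ U) :
    dV f p = 0 :=
  (dV_congr_on hU hp h).trans (HasGrad.const 0).dV_eq

/-- A total derivative is linear in the jets of highest order, with coefficients taken from the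
original polynomial. Evaluation at jets with few nonzero entries therefore reads off one coefficient
after another; derivatives of coefficients already known to vanish on `U` drop out. -/
theorem eq_zero_of_totalD_degThree {m : Fin 10 → ℝ × ℝ → ℝ} (hU : IsOpen U)
    (hm : ∀ k, ContDiffOn ℝ ∞ (m k) U) (h : ∀ z, base z ∈ U → totalD (degThree m) z = 0) :
    ∀ k, ∀ p ∈ U, m k p = 0 := by
  have key : ∀ p ∈ U, ∀ x₁ y₁ x₂ y₂ x₃ y₃ x₄ y₄ : ℝ, _ := fun p hp x₁ y₁ x₂ y₂ x₃ y₃ x₄ y₄ => by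
    have h1 := h (jetMk p x₁ y₁ x₂ y₂ x₃ y₃ x₄ y₄) (by simpa [base, jetMk] using hp)
    rw [totalD_eq, dirD_degThree hU hm (by simpa [base, jetMk] using hp)] at h1
    simp only [base, jetMk, shift, Matrix.cons_val_zero, Matrix.cons_val_one, zero_add,
      Nat.reduceAdd, Prod.mk.eta] at h1
    exact h1
  have k0 : ∀ p ∈ U, m 0 p = 0 := fun p hp => by linear_combination key p hp 0 0 0 0 0 0 1 0
  have k1 : ∀ p ∈ U, m 1 p = 0 := fun p hp => by linear_combination key p hp 0 0 0 0 0 0 0 1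
  have k2 : ∀ p ∈ U, m 2 p = 0 := fun p hp => by linear_combination key p hp 0 0 1 0 0 0 0 0
  have k5 : ∀ p ∈ U, m 5 p = 0 := fun p hp => by linear_combination key p hp 0 0 0 1 0 0 0 0
  -- The subtracted jet, with `vₓ = 1` only, removes the contribution of `∂_v m₉`; the same device
  -- isolates the cubic coefficients below.
  have k3 : ∀ p ∈ U, m 3 p = 0 := fun p hp => by
    linear_combination key p hp 0 1 0 0 1 0 0 0 - key p hp 0 1 0 0 0 0 0 0
      - dV_eq_zero_of_eqOn hU k0 hp
  have k4 : ∀ p ∈ U, m 4 p = 0 := fun p hp => by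
    linear_combination key p hp 0 0 1 1 0 0 0 0 - k2 p hp - k3 p hp - k5 p hp
  intro k p hp
  fin_cases k
  · exact k0 p hp
  · exact k1 p hp
  · exact k2 p hp
  · exact k3 p hp
  · exact k4 p hp
  · exact k5 p hp
  · change m 6 p = 0
    linear_combination (key p hp 1 0 1 0 0 0 0 0 - key p hp 1 0 0 0 0 0 0 0 - k2 p hp
      - dU_eq_zero_of_eqOn hU k2 hp) / 3
  · change m 7 p = 0
    linear_combination key p hp 1 0 0 1 0 0 0 0 - key p hp 1 0 0 0 0 0 0 0 - k5 p hp
      - dU_eq_zero_of_eqOn hU k4 hp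
  · change m 8 p = 0
    linear_combination key p hp 0 1 1 0 0 0 0 0 - key p hp 0 1 0 0 0 0 0 0 - k2 p hp
      - dV_eq_zero_of_eqOn hU k3 hp
  · change m 9 p = 0
    linear_combination (key p hp 0 1 0 1 0 0 0 0 - key p hp 0 1 0 0 0 0 0 0 - k5 p hp
      - dV_eq_zero_of_eqOn hU k5 hp) / 3

theorem timeD_base {X : Fin 2 → Jet → ℝ} {a : ℝ × ℝ → ℝ} (ha : ContDiffOn ℝ ∞ a U)
    (hU : IsOpen U) (hz : base z ∈ U) :
    timeD X (fun z => a (base z)) z = dU a (base z) * X 0 z + dV a (base z) * X 1 z :=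
  dirD_base ha hU hz

theorem deformed_eq {f : Fin 2 → ℝ × ℝ → ℝ} {a : Fin 2 → Fin 5 → ℝ × ℝ → ℝ} (hU : IsOpen U)
    (hf : ∀ i, ContDiffOn ℝ ∞ (f i) U) (ha : ∀ i k, ContDiffOn ℝ ∞ (a i k) U) (ε : ℝ) (i : Fin 2)
    (hz : base z ∈ U) :
    deformed f a ε i z = dispersionless f i z + ε ^ 2 * totalD (degTwo (a i)) z := by
  have hA := isDiffFn_degTwo (ha i)
  simp only [deformed, consLaw, dispersionless]
  rw [totalD_add hU (IsDiffFn.ofBase _ (hf i)) (hA.const_mul _) hz, totalD_const_mul hU _ hA hz]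

theorem isDiffFn_dispersionless {f : Fin 2 → ℝ × ℝ → ℝ} (hU : IsOpen U)
    (hf : ∀ i, ContDiffOn ℝ ∞ (f i) U) (i : Fin 2) : IsDiffFn U (dispersionless f i) :=
  (IsDiffFn.ofBase _ (hf i)).totalD hU

theorem timeD_deformed {f : Fin 2 → ℝ × ℝ → ℝ} {a : Fin 2 → Fin 5 → ℝ × ℝ → ℝ} {φ : Jet → ℝ}
    (hU : IsOpen U) (hf : ∀ i, ContDiffOn ℝ ∞ (f i) U) (ha : ∀ i k, ContDiffOn ℝ ∞ (a i k) U)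
    (hφ : IsDiffFn U φ) (ε : ℝ) (hz : base z ∈ U) :
    timeD (deformed f a ε) φ z = timeD (dispersionless f) φ z
      + ε ^ 2 * timeD (fun k => totalD (degTwo (a k))) φ z := by
  rw [timeD_congr_flow hU hz (fun k y hy => deformed_eq hU hf ha ε k hy),
    timeD_add_smul hU hφ (isDiffFn_dispersionless hU hf)
      (fun k => (isDiffFn_degTwo (ha k)).totalD hU) _ hz]

/-- The commutator of two deformed flows, expanded in powers of `ε`. -/
theorem exists_flowComm_deformed {f g : Fin 2 → ℝ × ℝ → ℝ} {a b : Fin 2 → Fin 5 → ℝ × ℝ → ℝ}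
    (hU : IsOpen U) (hf : ∀ i, ContDiffOn ℝ ∞ (f i) U) (hg : ∀ i, ContDiffOn ℝ ∞ (g i) U)
    (ha : ∀ i k, ContDiffOn ℝ ∞ (a i k) U) (hb : ∀ i k, ContDiffOn ℝ ∞ (b i k) U)
    (hz : base z ∈ U) (i : Fin 2) :
    ∃ c : ℝ, ∀ ε, flowComm (deformed f a ε) (deformed g b ε) i z =
      flowComm (dispersionless f) (dispersionless g) i z
      + ε ^ 2 * totalD (degThree fun j p => commCoeff f b i j p - commCoeff g a i j p) z
      + ε ^ 4 * c := by
  have hA := fun i => isDiffFn_degTwo (ha i)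
  have hB := fun i => isDiffFn_degTwo (hb i)
  have hF := fun i => IsDiffFn.ofBase _ (hf i)
  have hG := fun i => IsDiffFn.ofBase _ (hg i)
  have hDf := isDiffFn_dispersionless hU hf
  have hDg := isDiffFn_dispersionless hU hg
  have hDA := fun i => (hA i).totalD hU
  have hDB := fun i => (hB i).totalD hU
  have hM : IsDiffFn U (degThree fun j p => commCoeff f b i j p - commCoeff g a i j p) :=
    isDiffFn_degThree fun j =>
      (contDiffOn_commCoeff hU hf hb i j).sub (contDiffOn_commCoeff hU hg ha i j)
  have hR := ((hA i).timeD hU hDB).sub ((hB i).timeD hU hDA)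
  have hQ := ((hF i).timeD hU hDg).sub ((hG i).timeD hU hDf)
  -- Both flows are affine in `ε²`, so the expansion stops at `ε⁴`, whose coefficient is the
  -- commutator of the two corrections.
  refine ⟨totalD (fun y => timeD (fun k => totalD (degTwo (b k))) (degTwo (a i)) y
    - timeD (fun k => totalD (degTwo (a k))) (degTwo (b i)) y) z, fun ε => ?_⟩
  have hα : ∀ i, IsDiffFn U fun z => f i (base z) + ε ^ 2 * degTwo (a i) z := fun i =>
    (hF i).add ((hA i).const_mul _)
  have hβ : ∀ i, IsDiffFn U fun z => g i (base z) + ε ^ 2 * degTwo (b i) z := fun i =>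
    (hG i).add ((hB i).const_mul _)
  have e1 := flowComm_consLaw hU hα hβ hz i
  have e2 : flowComm (dispersionless f) (dispersionless g) i z =
      totalD (fun y => timeD (dispersionless g) (fun z => f i (base z)) y
        - timeD (dispersionless f) (fun z => g i (base z)) y) z :=
    flowComm_consLaw hU hF hG hz i
  change flowComm (deformed f a ε) (deformed g b ε) i z = _ at e1
  rw [e1, e2, ← totalD_const_mul hU _ hM hz, ← totalD_const_mul hU _ hR hz,
    ← totalD_add hU hQ (hM.const_mul _) hz, ← totalD_add hU (hQ.add (hM.const_mul _))
      (hR.const_mul _) hz]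
  refine totalD_congr hU hz fun y hy => ?_
  have x1 : timeD (consLaw fun i z => g i (base z) + ε ^ 2 * degTwo (b i) z)
      (fun z => f i (base z) + ε ^ 2 * degTwo (a i) z) y =
      timeD (dispersionless g) (fun z => f i (base z)) y
      + ε ^ 2 * (dU (f i) (base y) * totalD (degTwo (b 0)) y
        + dV (f i) (base y) * totalD (degTwo (b 1)) y)
      + ε ^ 2 * (timeD (dispersionless g) (degTwo (a i)) y
        + ε ^ 2 * timeD (fun k => totalD (degTwo (b k))) (degTwo (a i)) y) := by
    rw [← timeD_deformed hU hg hb (hA i) ε hy, ← timeD_base (hf i) hU hy (X := fun k =>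
      totalD (degTwo (b k))), ← timeD_deformed hU hg hb (hF i) ε hy, timeD_eq,
      dirD_add hU (hF i) ((hA i).const_mul _) hy, dirD_const_mul hU _ (hA i) hy]
    rfl
  have x2 : timeD (consLaw fun i z => f i (base z) + ε ^ 2 * degTwo (a i) z)
      (fun z => g i (base z) + ε ^ 2 * degTwo (b i) z) y =
      timeD (dispersionless f) (fun z => g i (base z)) y
      + ε ^ 2 * (dU (g i) (base y) * totalD (degTwo (a 0)) y
        + dV (g i) (base y) * totalD (degTwo (a 1)) y)
      + ε ^ 2 * (timeD (dispersionless f) (degTwo (b i)) y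
        + ε ^ 2 * timeD (fun k => totalD (degTwo (a k))) (degTwo (b i)) y) := by
    rw [← timeD_deformed hU hf ha (hB i) ε hy, ← timeD_base (hg i) hU hy (X := fun k =>
      totalD (degTwo (a k))), ← timeD_deformed hU hf ha (hG i) ε hy, timeD_eq,
      dirD_add hU (hG i) ((hB i).const_mul _) hy, dirD_const_mul hU _ (hB i) hy]
    rfl
  rw [x1, x2, totalD_degTwo hU (hb 0) hy, totalD_degTwo hU (hb 1) hy, totalD_degTwo hU (ha 0) hy,
    totalD_degTwo hU (ha 1) hy, timeD_dispersionless_degTwo hU hg (ha i) hy,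
    timeD_dispersionless_degTwo hU hf (hb i) hy]
  simp only [degThree, commCoeff]
  ring

/-- The bridge from asymptotics to algebra: each coefficient in the expansion of the commutator is
tested separately, and injectivity of `∂ₓ` in degree three turns the `ε²` part into pointwise
equations. -/
theorem commuteUpToOrderTwo_iff {f g : Fin 2 → ℝ × ℝ → ℝ} {a b : Fin 2 → Fin 5 → ℝ × ℝ → ℝ}
    (hU : IsOpen U) (hf : ∀ i, ContDiffOn ℝ ∞ (f i) U) (hg : ∀ i, ContDiffOn ℝ ∞ (g i) U)
    (ha : ∀ i k, ContDiffOn ℝ ∞ (a i k) U) (hb : ∀ i k, ContDiffOn ℝ ∞ (b i k) U) :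
    CommuteUpToOrderTwo U (deformed f a) (deformed g b) ↔
      (∀ z, base z ∈ U → ∀ i, flowComm (dispersionless f) (dispersionless g) i z = 0) ∧
      ∀ i j, ∀ p ∈ U, commCoeff f b i j p = commCoeff g a i j p := by
  have h1 : CommuteUpToOrderTwo U (deformed f a) (deformed g b) ↔
      ∀ z, base z ∈ U → ∀ i, flowComm (dispersionless f) (dispersionless g) i z = 0 ∧
        totalD (degThree fun j p => commCoeff f b i j p - commCoeff g a i j p) z = 0 := by
    refine forall_congr' fun z => forall_congr' fun hz => forall_congr' fun i => ?_
    obtain ⟨c, hc⟩ := exists_flowComm_deformed hU hf hg ha hb hz i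
    rw [funext hc, isBigO_even_cubed]
  rw [h1]
  constructor
  · intro h
    refine ⟨fun z hz i => (h z hz i).1, fun i j p hp => sub_eq_zero.1 ?_⟩
    exact eq_zero_of_totalD_degThree (m := fun j p => commCoeff f b i j p - commCoeff g a i j p) hU
      (fun j => (contDiffOn_commCoeff hU hf hb i j).sub (contDiffOn_commCoeff hU hg ha i j))
      (fun z hz => (h z hz i).2) j p hp
  · rintro ⟨h2, h3⟩ z hz i
    refine ⟨h2 z hz i, ?_⟩
    rw [totalD_congr hU hz (f := fun _ => 0), totalD_eq, dirD_const]
    intro y hy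
    simp [degThree, h3 _ _ _ hy]

end B2

/-! ### Commuting dispersionless flows -/

namespace B2

variable {U : Set (ℝ × ℝ)} {p : ℝ × ℝ} {z : Jet}

theorem dirD_degOne {q : Fin 2 → ℝ × ℝ → ℝ} (hU : IsOpen U) (hq : ∀ k, ContDiffOn ℝ ∞ (q k) U)
    (hz : base z ∈ U) (w : Jet) :
    dirD (degOne q) z w =
      (dU (q 0) (base z) * w 0 0 + dV (q 0) (base z) * w 0 1) * z 1 0 + q 0 (base z) * w 1 0
      + ((dU (q 1) (base z) * w 0 0 + dV (q 1) (base z) * w 0 1) * z 1 1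
        + q 1 (base z) * w 1 1) := by
  have B := fun k => (hasGrad_of_contDiffOn (hq k) hU hz).hasDerivAt_line
    (x := z 0 0) (y := z 0 1) (x' := w 0 0) (y' := w 0 1) rfl
  have C : ∀ s k, HasDerivAt (fun t : ℝ => z s k + t * w s k) (w s k) 0 := fun s k => by
    simpa using ((hasDerivAt_id (0 : ℝ)).mul_const (w s k)).const_add (z s k)
  have := ((B 0).mul (C 1 0)).add ((B 1).mul (C 1 1))
  refine (this.deriv).trans ?_
  simp [base]

theorem isDiffFn_degOne {q : Fin 2 → ℝ × ℝ → ℝ} (hq : ∀ k, ContDiffOn ℝ ∞ (q k) U) :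
    IsDiffFn U (degOne q) :=
  ((IsDiffFn.ofBase _ (hq 0)).mul (.coord 1 0)).add ((IsDiffFn.ofBase _ (hq 1)).mul (.coord 1 1))

/-- The coefficients of the commutator of two dispersionless flows. -/
noncomputable def commCoeffZero (f g : Fin 2 → ℝ × ℝ → ℝ) (i k : Fin 2) (p : ℝ × ℝ) : ℝ :=
  ![dU (f i) p * dU (g 0) p + dV (f i) p * dU (g 1) p
      - (dU (g i) p * dU (f 0) p + dV (g i) p * dU (f 1) p),
    dU (f i) p * dV (g 0) p + dV (f i) p * dV (g 1) p
      - (dU (g i) p * dV (f 0) p + dV (g i) p * dV (f 1) p)] k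

theorem contDiffOn_commCoeffZero {f g : Fin 2 → ℝ × ℝ → ℝ} (hU : IsOpen U)
    (hf : ∀ i, ContDiffOn ℝ ∞ (f i) U) (hg : ∀ i, ContDiffOn ℝ ∞ (g i) U) (i k : Fin 2) :
    ContDiffOn ℝ ∞ (commCoeffZero f g i k) U := by
  have fu := fun k => contDiffOn_dU (hf k) hU
  have fv := fun k => contDiffOn_dV (hf k) hU
  have gu := fun k => contDiffOn_dU (hg k) hU
  have gv := fun k => contDiffOn_dV (hg k) hU
  unfold commCoeffZero
  fin_cases k <;> simp <;> fun_prop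

/-- The commutator is `∂ₓ` of a polynomial of degree one whose coefficients are the entries of the
commutator of the two Jacobian matrices. -/
theorem flowComm_dispersionless_eq_zero_iff {f g : Fin 2 → ℝ × ℝ → ℝ} (hU : IsOpen U)
    (hf : ∀ i, ContDiffOn ℝ ∞ (f i) U) (hg : ∀ i, ContDiffOn ℝ ∞ (g i) U) :
    (∀ z, base z ∈ U → ∀ i, flowComm (dispersionless f) (dispersionless g) i z = 0) ↔
      ∀ i k, ∀ p ∈ U, commCoeffZero f g i k p = 0 := by
  have hF := fun i => IsDiffFn.ofBase _ (hf i)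
  have hG := fun i => IsDiffFn.ofBase _ (hg i)
  have hq := contDiffOn_commCoeffZero hU hf hg
  have e : ∀ z, base z ∈ U → ∀ i, flowComm (dispersionless f) (dispersionless g) i z
      = totalD (degOne (commCoeffZero f g i)) z := by
    intro z hz i
    refine (flowComm_consLaw hU hF hG hz i).trans (totalD_congr hU hz fun y hy => ?_)
    simp only [timeD_base (hf i) hU hy, timeD_base (hg i) hU hy, consLaw]
    simp only [totalD_base (hf _) hU hy, totalD_base (hg _) hU hy, degOne, commCoeffZero,
      Matrix.cons_val_zero, Matrix.cons_val_one]
    ring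
  constructor
  · intro h i k p hp
    -- At a jet with vanishing first derivatives only the terms in `uₓₓ` and `vₓₓ` survive, without
    -- derivatives of the coefficients.
    have key : ∀ x y : ℝ, _ := fun x y => by
      have h1 := h (jetMk p 0 0 x y 0 0 0 0) (by simpa [base, jetMk] using hp) i
      rw [e _ (by simpa [base, jetMk] using hp), totalD_eq, dirD_degOne hU (hq i)
        (by simpa [base, jetMk] using hp)] at h1
      simp only [base, jetMk, shift, Matrix.cons_val_zero, Matrix.cons_val_one, zero_add,
        Nat.reduceAdd, Prod.mk.eta] at h1
      exact h1
    fin_cases k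
    · change commCoeffZero f g i 0 p = 0
      linear_combination key 1 0
    · change commCoeffZero f g i 1 p = 0
      linear_combination key 0 1
  · intro h z hz i
    rw [e z hz i, totalD_congr hU hz (f := fun _ => 0), totalD_eq, dirD_const]
    intro y hy
    simp [degOne, h _ _ _ hy]

/-! ### The linear system for extensions along the primary flow -/

/-- The densities `v`, `u³ / 12` of the primary flow in the Frobenius case. -/
noncomputable abbrev primaryFrob : Fin 2 → ℝ × ℝ → ℝ := primary (-3 / 4)

theorem hasGrad_primaryFrob_zero : HasGrad (primaryFrob 0) 0 1 p := by
  have h : primaryFrob 0 = fun p => p.2 := by funext p; simp [primaryFrob, primary]; norm_num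
  rw [h]; exact HasGrad.snd

theorem hasGrad_primaryFrob_one : HasGrad (primaryFrob 1) (p.1 ^ 2 / 4) 0 p := by
  have h : primaryFrob 1 = fun p => 1 / 12 * p.1 ^ 3 := by
    funext p; simp [primaryFrob, primary]; norm_num
  rw [h]
  refine (HasGrad.mul (HasGrad.const (1 / 12)) (HasGrad.fst.pow 3)).congr_val ?_ ?_ <;> simp
  ring

theorem contDiff_primaryFrob (i : Fin 2) : ContDiff ℝ ∞ (primaryFrob i) := by
  fin_cases i <;> simp [primaryFrob, primary] <;> fun_prop

theorem dU_const (c : ℝ) : dU (fun _ => c) = fun _ => 0 :=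
  funext fun _ => (HasGrad.const c).dU_eq

theorem dV_const (c : ℝ) : dV (fun _ => c) = fun _ => 0 :=
  funext fun _ => (HasGrad.const c).dV_eq

theorem dU_primaryFrob_zero : dU (primaryFrob 0) = fun _ => 0 :=
  funext fun _ => hasGrad_primaryFrob_zero.dU_eq

theorem dV_primaryFrob_zero : dV (primaryFrob 0) = fun _ => 1 :=
  funext fun _ => hasGrad_primaryFrob_zero.dV_eq

theorem dU_primaryFrob_one : dU (primaryFrob 1) = fun p => p.1 ^ 2 / 4 :=
  funext fun _ => hasGrad_primaryFrob_one.dU_eq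

theorem dV_primaryFrob_one : dV (primaryFrob 1) = fun _ => 0 :=
  funext fun _ => hasGrad_primaryFrob_one.dV_eq

theorem dU_sq_div : dU (fun p => p.1 ^ 2 / 4) = fun p => p.1 / 2 := by
  funext p
  refine ((HasGrad.fst.pow 2).mul (HasGrad.const (1 / 4))).congr
    (.of_forall fun q => by simp; ring) |>.dU_eq.trans ?_
  simp; ring

theorem dU_div_two : dU (fun p => p.1 / 2) = fun _ => 1 / 2 := by
  funext p
  refine (HasGrad.fst.mul (HasGrad.const (1 / 2))).congr
    (.of_forall fun q => by simp; ring) |>.dU_eq.trans ?_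
  simp

/-- The equations `commCoeff primaryFrob b = r`, written out. -/
theorem commCoeff_primaryFrob (b : Fin 2 → Fin 5 → ℝ × ℝ → ℝ) (p : ℝ × ℝ) :
    (fun j => commCoeff primaryFrob b 0 j p) =
      ![b 1 0 p - p.1 ^ 2 / 4 * b 0 1 p,
        b 1 1 p - b 0 0 p,
        dU (b 1 0) p + 2 * b 1 2 p - p.1 ^ 2 / 4 * dV (b 0 0) p - 3 / 2 * p.1 * b 0 1 p
          - p.1 ^ 2 / 4 * b 0 4 p,
        dV (b 1 0) p + b 1 4 p - dU (b 0 0) p - p.1 ^ 2 / 2 * b 0 3 p,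
        dU (b 1 1) p + b 1 4 p - p.1 ^ 2 / 4 * dV (b 0 1) p - 2 * b 0 2 p,
        dV (b 1 1) p + 2 * b 1 3 p - dU (b 0 1) p - b 0 4 p,
        dU (b 1 2) p - b 0 1 p / 2 - p.1 ^ 2 / 4 * dV (b 0 2) p - p.1 / 2 * b 0 4 p,
        dV (b 1 2) p + dU (b 1 4) p - dU (b 0 2) p - p.1 ^ 2 / 4 * dV (b 0 4) p
          - p.1 * b 0 3 p,
        dU (b 1 3) p + dV (b 1 4) p - p.1 ^ 2 / 4 * dV (b 0 3) p - dU (b 0 4) p,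
        dV (b 1 3) p - dU (b 0 3) p] ∧
    (fun j => commCoeff primaryFrob b 1 j p) =
      ![p.1 ^ 2 / 4 * b 0 0 p - p.1 ^ 2 / 4 * b 1 1 p,
        p.1 ^ 2 / 4 * b 0 1 p - b 1 0 p,
        p.1 ^ 2 / 4 * (dU (b 0 0) p + 2 * b 0 2 p) - p.1 ^ 2 / 4 * dV (b 1 0) p
          - 3 / 2 * p.1 * b 1 1 p - p.1 ^ 2 / 4 * b 1 4 p,
        p.1 ^ 2 / 4 * (dV (b 0 0) p + b 0 4 p) - dU (b 1 0) p - p.1 ^ 2 / 2 * b 1 3 p,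
        p.1 ^ 2 / 4 * (dU (b 0 1) p + b 0 4 p) - p.1 ^ 2 / 4 * dV (b 1 1) p - 2 * b 1 2 p,
        p.1 ^ 2 / 4 * (dV (b 0 1) p + 2 * b 0 3 p) - dU (b 1 1) p - b 1 4 p,
        p.1 ^ 2 / 4 * dU (b 0 2) p - b 1 1 p / 2 - p.1 ^ 2 / 4 * dV (b 1 2) p
          - p.1 / 2 * b 1 4 p,
        p.1 ^ 2 / 4 * (dV (b 0 2) p + dU (b 0 4) p) - dU (b 1 2) p - p.1 ^ 2 / 4 * dV (b 1 4) p
          - p.1 * b 1 3 p,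
        p.1 ^ 2 / 4 * (dU (b 0 3) p + dV (b 0 4) p) - p.1 ^ 2 / 4 * dV (b 1 3) p - dU (b 1 4) p,
        p.1 ^ 2 / 4 * dV (b 0 3) p - dU (b 1 3) p] := by
  constructor <;> funext j <;> fin_cases j <;>
    simp [commCoeff, totalCoeff, timeCoeff, dU_primaryFrob_zero, dV_primaryFrob_zero,
      dU_primaryFrob_one, dV_primaryFrob_one, dU_const, dV_const, dU_sq_div, dU_div_two] <;> ring

/-- This is uniqueness of extensions. Although the system is differential, it has no kernel: the
equations from the two components can be combined so that all derivatives cancel, leaving a power of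
`u` times one unknown. Here `u ≠ 0` is essential. -/
theorem eq_zero_of_commCoeff_primaryFrob {b : Fin 2 → Fin 5 → ℝ × ℝ → ℝ} (hU : IsOpen U)
    (hu : ∀ p ∈ U, p.1 ≠ 0) (hb : ∀ i k, ContDiffOn ℝ ∞ (b i k) U)
    (h : ∀ i j, ∀ p ∈ U, commCoeff primaryFrob b i j p = 0) : ∀ i k, ∀ p ∈ U, b i k p = 0 := by
  have E1 := fun p hp j => (congrFun (commCoeff_primaryFrob b p).1 j).symm.trans (h 0 j p hp)
  have E2 := fun p hp j => (congrFun (commCoeff_primaryFrob b p).2 j).symm.trans (h 1 j p hp)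
  have hH : ∀ p : ℝ × ℝ, HasGrad (fun q : ℝ × ℝ => q.1 ^ 2 / 4) (p.1 / 2) 0 p := fun p =>
    (((HasGrad.fst.pow 2).mul (HasGrad.const (1 / 4))).congr
      (.of_forall fun q => by simp; ring)).congr_val (by simp; ring) (by simp)
  have G := fun i k p (hp : p ∈ U) => hasGrad_of_contDiffOn (hb i k) hU hp
  have c3 : ∀ p ∈ U, b 1 0 p = p.1 ^ 2 / 4 * b 0 1 p := fun p hp => by
    have := E1 p hp 0; simp at this; linear_combination this
  have c4 : ∀ p ∈ U, b 1 1 p = b 0 0 p := fun p hp => by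
    have := E1 p hp 1; simp at this; linear_combination this
  have c3u : ∀ p ∈ U, dU (b 1 0) p = p.1 / 2 * b 0 1 p + p.1 ^ 2 / 4 * dU (b 0 1) p :=
    fun p hp => (dU_congr_on hU hp c3).trans ((hH p).mul (G 0 1 p hp)).dU_eq
  have c3v : ∀ p ∈ U, dV (b 1 0) p = p.1 ^ 2 / 4 * dV (b 0 1) p :=
    fun p hp => (dV_congr_on hU hp c3).trans (((hH p).mul (G 0 1 p hp)).dV_eq.trans (by ring))
  have c4u : ∀ p ∈ U, dU (b 1 1) p = dU (b 0 0) p := fun p hp => dU_congr_on hU hp c4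
  have c4v : ∀ p ∈ U, dV (b 1 1) p = dV (b 0 0) p := fun p hp => dV_congr_on hU hp c4
  have b4 : ∀ p ∈ U, b 0 1 p = 0 := fun p hp => by
    have h1 := E1 p hp 2
    have h2 := E2 p hp 4
    have h3 := E1 p hp 5
    have h4 := E2 p hp 3
    simp [c3u p hp, c4v p hp] at h1 h2 h3 h4
    refine (mul_eq_zero.1 (?_ : p.1 * b 0 1 p = 0)).resolve_left (hu p hp)
    -- The sum in parentheses equals `-(3/2) u b₀₁`; every derivative and every other unknown occurs
    -- in it with opposite signs.
    linear_combination -2 / 3 * (h1 + h2 + p.1 ^ 2 / 4 * h3 + h4)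
  have b4u := fun p hp => dU_eq_zero_of_eqOn (p := p) hU b4 hp
  have b4v := fun p hp => dV_eq_zero_of_eqOn (p := p) hU b4 hp
  have b3 : ∀ p ∈ U, b 0 0 p = 0 := fun p hp => by
    have h1 := E1 p hp 3
    have h2 := E2 p hp 5
    have h3 := E1 p hp 4
    have h4 := E2 p hp 2
    simp [c3v p hp, c4u p hp, c4 p hp, b4v p hp] at h1 h2 h3 h4
    refine (mul_eq_zero.1 (?_ : p.1 * b 0 0 p = 0)).resolve_left (hu p hp)
    -- The first bracket is `(u²/2) ∂_u b₀₀ - (3/2) u b₀₀` and the second is `-2 ∂_u b₀₀`, so the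
    -- derivative is eliminated.
    linear_combination -2 / 3 * (h4 + p.1 ^ 2 / 4 * h3) - p.1 ^ 2 / 6 * (h1 + h2)
  have b3u := fun p hp => dU_eq_zero_of_eqOn (p := p) hU b3 hp
  have b3v := fun p hp => dV_eq_zero_of_eqOn (p := p) hU b3 hp
  have b7 : ∀ p ∈ U, b 0 4 p = 2 * b 1 3 p := fun p hp => by
    have h1 := E1 p hp 5
    simp [c4v p hp, b4u p hp, b3v p hp] at h1
    linear_combination -h1
  have c7 : ∀ p ∈ U, b 1 4 p = 2 * (p.1 ^ 2 / 4 * b 0 3 p) := fun p hp => by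
    have h1 := E1 p hp 3
    simp [c3v p hp, b4v p hp, b3u p hp] at h1
    linear_combination h1
  have b5 : ∀ p ∈ U, b 0 2 p = p.1 ^ 2 / 4 * b 0 3 p := fun p hp => by
    have h1 := E1 p hp 4
    simp [c4u p hp, b4v p hp, b3u p hp] at h1
    linear_combination -h1 / 2 + c7 p hp / 2
  have c5 : ∀ p ∈ U, b 1 2 p = p.1 ^ 2 / 4 * b 1 3 p := fun p hp => by
    have h1 := E1 p hp 2
    simp [c3u p hp, b4u p hp, b3v p hp, b4 p hp] at h1
    linear_combination h1 / 2 + p.1 ^ 2 / 8 * b7 p hp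
  have c5u : ∀ p ∈ U, dU (b 1 2) p = p.1 / 2 * b 1 3 p + p.1 ^ 2 / 4 * dU (b 1 3) p :=
    fun p hp => (dU_congr_on hU hp c5).trans ((hH p).mul (G 1 3 p hp)).dU_eq
  have c5v : ∀ p ∈ U, dV (b 1 2) p = p.1 ^ 2 / 4 * dV (b 1 3) p :=
    fun p hp => (dV_congr_on hU hp c5).trans (((hH p).mul (G 1 3 p hp)).dV_eq.trans (by ring))
  have b5u : ∀ p ∈ U, dU (b 0 2) p = p.1 / 2 * b 0 3 p + p.1 ^ 2 / 4 * dU (b 0 3) p :=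
    fun p hp => (dU_congr_on hU hp b5).trans ((hH p).mul (G 0 3 p hp)).dU_eq
  have b5v : ∀ p ∈ U, dV (b 0 2) p = p.1 ^ 2 / 4 * dV (b 0 3) p :=
    fun p hp => (dV_congr_on hU hp b5).trans (((hH p).mul (G 0 3 p hp)).dV_eq.trans (by ring))
  -- Only `b₀₃` and `b₁₃` are still free. The `uₓ³` and `vₓ³` equations of opposite components
  -- contain the same derivatives of these two, up to powers of `u`.
  have c6 : ∀ p ∈ U, b 1 3 p = 0 := fun p hp => by
    have h1 := E1 p hp 6
    have h2 := E2 p hp 9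
    simp [c5u p hp, b5v p hp, b4 p hp, b7 p hp] at h1 h2
    refine (mul_eq_zero.1 (?_ : p.1 * b 1 3 p = 0)).resolve_left (hu p hp)
    linear_combination -2 * (h1 + p.1 ^ 2 / 4 * h2)
  have b6 : ∀ p ∈ U, b 0 3 p = 0 := fun p hp => by
    have h1 := E2 p hp 6
    have h2 := E1 p hp 9
    simp [c5v p hp, b5u p hp, c4 p hp, b3 p hp, c7 p hp] at h1 h2
    refine (mul_eq_zero.1 (?_ : p.1 ^ 3 * b 0 3 p = 0)).resolve_left (pow_ne_zero 3 (hu p hp))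
    linear_combination -8 * (h1 + p.1 ^ 4 / 16 * h2)
  intro i k p hp
  fin_cases i <;> fin_cases k <;>
    simp [b3 p hp, b4 p hp, b6 p hp, c6 p hp, c4 p hp, c3 p hp, b7 p hp, c7 p hp, b5 p hp, c5 p hp]

theorem commCoeff_sub {f : Fin 2 → ℝ × ℝ → ℝ} {b b' : Fin 2 → Fin 5 → ℝ × ℝ → ℝ}
    (hU : IsOpen U) (hb : ∀ i k, ContDiffOn ℝ ∞ (b i k) U) (hb' : ∀ i k, ContDiffOn ℝ ∞ (b' i k) U)
    (hp : p ∈ U) (i : Fin 2) (j : Fin 10) :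
    commCoeff f (fun i k p => b i k p - b' i k p) i j p
      = commCoeff f b i j p - commCoeff f b' i j p := by
  have G := fun i k => (hasGrad_of_contDiffOn (hb i k) hU hp).sub
    (hasGrad_of_contDiffOn (hb' i k) hU hp)
  fin_cases j <;>
    simp [commCoeff, totalCoeff, timeCoeff, (G _ _).dU_eq, (G _ _).dV_eq] <;> ring

theorem commCoeff_congr {f : Fin 2 → ℝ × ℝ → ℝ} {b b' : Fin 2 → Fin 5 → ℝ × ℝ → ℝ}
    (hU : IsOpen U) (h : ∀ i k, ∀ q ∈ U, b i k q = b' i k q) (hp : p ∈ U) (i : Fin 2)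
    (j : Fin 10) : commCoeff f b i j p = commCoeff f b' i j p := by
  have e := fun i k => h i k p hp
  have eu := fun i k => dU_congr_on hU hp (h i k)
  have ev := fun i k => dV_congr_on hU hp (h i k)
  fin_cases j <;> simp [commCoeff, totalCoeff, timeCoeff, e, eu, ev]

end B2

/-! ### Symmetries and potentials as solutions of wave equations -/

namespace B2

variable {U : Set (ℝ × ℝ)} {p : ℝ × ℝ}

/-- The densities of a symmetry of the primary flow with `c = -3/4`. -/
structure IsWave (U : Set (ℝ × ℝ)) (g : Fin 2 → ℝ × ℝ → ℝ) : Prop where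
  smooth : ∀ i, ContDiffOn ℝ ∞ (g i) U
  dV_one : ∀ p ∈ U, dV (g 1) p = dU (g 0) p
  dU_one : ∀ p ∈ U, dU (g 1) p = p.1 ^ 2 / 4 * dV (g 0) p

/-- The first component of the commutator already gives both conditions. Conversely they make the
Jacobian of `g` a combination of the identity and the Jacobian of the primary flow, so the second
component vanishes too. -/
theorem isSymmetry_primaryFrob_iff (hU : IsOpen U) {g : Fin 2 → ℝ × ℝ → ℝ} :
    IsSymmetry U primaryFrob g ↔ IsWave U g := by
  constructor
  · rintro ⟨hg, h⟩
    rw [flowComm_dispersionless_eq_zero_iff hU (fun i => (contDiff_primaryFrob i).contDiffOn) hg]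
      at h
    refine ⟨hg, fun p hp => ?_, fun p hp => ?_⟩
    · have := h 0 1 p hp
      simp [commCoeffZero, dU_primaryFrob_zero, dV_primaryFrob_zero, dV_primaryFrob_one] at this
      linear_combination this
    · have := h 0 0 p hp
      simp [commCoeffZero, dU_primaryFrob_zero, dV_primaryFrob_zero, dU_primaryFrob_one] at this
      linear_combination this
  · intro h
    refine ⟨h.smooth, ?_⟩
    rw [flowComm_dispersionless_eq_zero_iff hU (fun i => (contDiff_primaryFrob i).contDiffOn)
      h.smooth]
    intro i k p hp
    fin_cases i <;> fin_cases k <;>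
      simp [commCoeffZero, dU_primaryFrob_zero, dV_primaryFrob_zero, dV_primaryFrob_one,
        dU_primaryFrob_one, h.dU_one p hp, h.dV_one p hp] <;> ring

theorem hasGrad_sq_div (p : ℝ × ℝ) : HasGrad (fun q : ℝ × ℝ => q.1 ^ 2 / 4) (p.1 / 2) 0 p :=
  (((HasGrad.fst.pow 2).mul (HasGrad.const (1 / 4))).congr
    (.of_forall fun q => by simp; ring)).congr_val (by simp; ring) (by simp)

/-- Symmetries of the primary flow commute with each other. -/
theorem IsWave.commCoeffZero_eq_zero {g g' : Fin 2 → ℝ × ℝ → ℝ} (hg : IsWave U g)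
    (hg' : IsWave U g') (i k : Fin 2) (hp : p ∈ U) : commCoeffZero g g' i k p = 0 := by
  fin_cases i <;> fin_cases k <;>
    simp [commCoeffZero, hg.dU_one p hp, hg.dV_one p hp, hg'.dU_one p hp, hg'.dV_one p hp] <;> ring

theorem dV_dU (hU : IsOpen U) {f : ℝ × ℝ → ℝ} (hf : ContDiffOn ℝ ∞ f U) (hp : p ∈ U) :
    dV (dU f) p = dU (dV f) p := (dU_dV hf hU hp).symm

theorem dV_dU_dV (hU : IsOpen U) {f : ℝ × ℝ → ℝ} (hf : ContDiffOn ℝ ∞ f U) (hp : p ∈ U) :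
    dV (dU (dV f)) p = dU (dV (dV f)) p := dV_dU hU (contDiffOn_dV hf hU) hp

namespace IsWave

variable {g : Fin 2 → ℝ × ℝ → ℝ}

theorem contDiffOn_dV_zero (hg : IsWave U g) (hU : IsOpen U) : ContDiffOn ℝ ∞ (dV (g 0)) U :=
  contDiffOn_dV (hg.smooth 0) hU

theorem contDiffOn_dV_dV_zero (hg : IsWave U g) (hU : IsOpen U) :
    ContDiffOn ℝ ∞ (dV (dV (g 0))) U := contDiffOn_dV (hg.contDiffOn_dV_zero hU) hU

theorem contDiffOn_dV_dV_dV_zero (hg : IsWave U g) (hU : IsOpen U) :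
    ContDiffOn ℝ ∞ (dV (dV (dV (g 0)))) U := contDiffOn_dV (hg.contDiffOn_dV_dV_zero hU) hU

/-- Cross-differentiating the two first order equations eliminates `g 1`. As `u²/4` does not depend
on `v`, the derivatives of `g 0` in `v` satisfy the same wave equation, so repeated derivatives in
`u` can always be traded for derivatives in `v`. -/
theorem dU_dU_zero (hg : IsWave U g) (hU : IsOpen U) (hp : p ∈ U) :
    dU (dU (g 0)) p = p.1 ^ 2 / 4 * dV (dV (g 0)) p := by
  rw [dU_congr_on hU hp fun q hq => (hg.dV_one q hq).symm, dU_dV (hg.smooth 1) hU hp,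
    dV_congr_on hU hp hg.dU_one,
    ((hasGrad_sq_div p).mul (hasGrad_of_contDiffOn (hg.contDiffOn_dV_zero hU) hU hp)).dV_eq]
  ring

theorem dU_dU_dV_zero (hg : IsWave U g) (hU : IsOpen U) (hp : p ∈ U) :
    dU (dU (dV (g 0))) p = p.1 ^ 2 / 4 * dV (dV (dV (g 0))) p := by
  rw [← dV_dU_dU (hg.smooth 0) hU hp, dV_congr_on hU hp fun q hq => hg.dU_dU_zero hU hq,
    ((hasGrad_sq_div p).mul (hasGrad_of_contDiffOn (hg.contDiffOn_dV_dV_zero hU) hU hp)).dV_eq]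
  ring

theorem dU_dU_dV_dV_zero (hg : IsWave U g) (hU : IsOpen U) (hp : p ∈ U) :
    dU (dU (dV (dV (g 0)))) p = p.1 ^ 2 / 4 * dV (dV (dV (dV (g 0)))) p := by
  rw [← dV_dU_dU (hg.contDiffOn_dV_zero hU) hU hp,
    dV_congr_on hU hp fun q hq => hg.dU_dU_dV_zero hU hq,
    ((hasGrad_sq_div p).mul (hasGrad_of_contDiffOn (hg.contDiffOn_dV_dV_dV_zero hU) hU hp)).dV_eq]
  ring

theorem hasGrad_dV (hg : IsWave U g) (hU : IsOpen U) (hp : p ∈ U) :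
    HasGrad (dV (g 0)) (dU (dV (g 0)) p) (dV (dV (g 0)) p) p :=
  hasGrad_of_contDiffOn (hg.contDiffOn_dV_zero hU) hU hp

theorem hasGrad_dV_dV (hg : IsWave U g) (hU : IsOpen U) (hp : p ∈ U) :
    HasGrad (dV (dV (g 0))) (dU (dV (dV (g 0))) p) (dV (dV (dV (g 0))) p) p :=
  hasGrad_of_contDiffOn (hg.contDiffOn_dV_dV_zero hU) hU hp

theorem hasGrad_dV_dV_dV (hg : IsWave U g) (hU : IsOpen U) (hp : p ∈ U) :
    HasGrad (dV (dV (dV (g 0)))) (dU (dV (dV (dV (g 0)))) p) (dV (dV (dV (dV (g 0)))) p) p :=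
  hasGrad_of_contDiffOn (hg.contDiffOn_dV_dV_dV_zero hU) hU hp

theorem hasGrad_dU_dV (hg : IsWave U g) (hU : IsOpen U) (hp : p ∈ U) :
    HasGrad (dU (dV (g 0))) (p.1 ^ 2 / 4 * dV (dV (dV (g 0))) p) (dU (dV (dV (g 0))) p) p :=
  (hasGrad_of_contDiffOn (contDiffOn_dU (hg.contDiffOn_dV_zero hU) hU) hU hp).congr_val
    (hg.dU_dU_dV_zero hU hp) (dV_dU_dV hU (hg.smooth 0) hp)

theorem hasGrad_dU_dV_dV (hg : IsWave U g) (hU : IsOpen U) (hp : p ∈ U) :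
    HasGrad (dU (dV (dV (g 0)))) (p.1 ^ 2 / 4 * dV (dV (dV (dV (g 0)))) p)
      (dU (dV (dV (dV (g 0)))) p) p :=
  (hasGrad_of_contDiffOn (contDiffOn_dU (hg.contDiffOn_dV_dV_zero hU) hU) hU hp).congr_val
    (hg.dU_dU_dV_dV_zero hU hp) (dV_dU_dV hU (hg.contDiffOn_dV_zero hU) hp)

theorem dU_dU_dU_zero (hg : IsWave U g) (hU : IsOpen U) (hp : p ∈ U) :
    dU (dU (dU (g 0))) p = p.1 / 2 * dV (dV (g 0)) p + p.1 ^ 2 / 4 * dU (dV (dV (g 0))) p :=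
  (dU_congr_on hU hp fun _ hq => hg.dU_dU_zero hU hq).trans
    ((hasGrad_sq_div p).mul (hg.hasGrad_dV_dV hU hp)).dU_eq

theorem dU_dU_one (hg : IsWave U g) (hU : IsOpen U) (hp : p ∈ U) :
    dU (dU (g 1)) p = p.1 / 2 * dV (g 0) p + p.1 ^ 2 / 4 * dU (dV (g 0)) p :=
  (dU_congr_on hU hp hg.dU_one).trans ((hasGrad_sq_div p).mul (hg.hasGrad_dV hU hp)).dU_eq

theorem dU_dV_one (hg : IsWave U g) (hU : IsOpen U) (hp : p ∈ U) :
    dU (dV (g 1)) p = p.1 ^ 2 / 4 * dV (dV (g 0)) p :=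
  (dU_congr_on hU hp hg.dV_one).trans (hg.dU_dU_zero hU hp)

theorem dV_dV_one (hg : IsWave U g) (hU : IsOpen U) (hp : p ∈ U) :
    dV (dV (g 1)) p = dU (dV (g 0)) p :=
  (dV_congr_on hU hp hg.dV_one).trans (dV_dU hU (hg.smooth 0) hp)

theorem dU_dU_dU_one (hg : IsWave U g) (hU : IsOpen U) (hp : p ∈ U) :
    dU (dU (dU (g 1))) p = 1 / 2 * dV (g 0) p + p.1 * dU (dV (g 0)) p
      + p.1 ^ 2 / 4 * (p.1 ^ 2 / 4 * dV (dV (dV (g 0))) p) := by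
  have h : HasGrad (fun q : ℝ × ℝ => q.1 / 2) (1 / 2) 0 p :=
    ((HasGrad.fst.mul (HasGrad.const (1 / 2))).congr
      (.of_forall fun q => by simp; ring)).congr_val (by simp) (by simp)
  rw [dU_congr_on hU hp fun _ hq => hg.dU_dU_one hU hq, ((h.mul (hg.hasGrad_dV hU hp)).add
    ((hasGrad_sq_div p).mul (hg.hasGrad_dU_dV hU hp))).dU_eq]
  ring

theorem dU_dU_dV_one (hg : IsWave U g) (hU : IsOpen U) (hp : p ∈ U) :
    dU (dU (dV (g 1))) p = p.1 / 2 * dV (dV (g 0)) p + p.1 ^ 2 / 4 * dU (dV (dV (g 0))) p :=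
  (dU_congr_on hU hp fun _ hq => hg.dU_dV_one hU hq).trans
    ((hasGrad_sq_div p).mul (hg.hasGrad_dV_dV hU hp)).dU_eq

theorem dU_dV_dV_one (hg : IsWave U g) (hU : IsOpen U) (hp : p ∈ U) :
    dU (dV (dV (g 1))) p = p.1 ^ 2 / 4 * dV (dV (dV (g 0))) p :=
  (dU_congr_on hU hp fun _ hq => hg.dV_dV_one hU hq).trans (hg.dU_dU_dV_zero hU hp)

theorem dV_dV_dV_one (hg : IsWave U g) (hU : IsOpen U) (hp : p ∈ U) :
    dV (dV (dV (g 1))) p = dU (dV (dV (g 0))) p :=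
  (dV_congr_on hU hp fun _ hq => hg.dV_dV_one hU hq).trans (dV_dU_dV hU (hg.smooth 0) hp)

end IsWave

/-- Functions of the form `F₁(u² / 4 + v) + F₂(-u² / 4 + v)`, described by their wave equation. -/
structure IsPotential (U : Set (ℝ × ℝ)) (F : ℝ × ℝ → ℝ) : Prop where
  smooth : ContDiffOn ℝ ∞ F U
  dU_dU : ∀ p ∈ U, dU (dU F) p = dU F p * p.1⁻¹ + p.1 ^ 2 / 4 * dV (dV F) p

namespace IsPotential

variable {F : ℝ × ℝ → ℝ}

theorem hasGrad_dU (hF : IsPotential U F) (hU : IsOpen U) (hp : p ∈ U) :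
    HasGrad (dU F) (dU F p * p.1⁻¹ + p.1 ^ 2 / 4 * dV (dV F) p) (dU (dV F) p) p :=
  (hasGrad_of_contDiffOn (contDiffOn_dU hF.smooth hU) hU hp).congr_val (hF.dU_dU p hp)
    (dV_dU hU hF.smooth hp)

theorem hasGrad_dV (hF : IsPotential U F) (hU : IsOpen U) (hp : p ∈ U) :
    HasGrad (dV F) (dU (dV F) p) (dV (dV F) p) p :=
  hasGrad_of_contDiffOn (contDiffOn_dV hF.smooth hU) hU hp

theorem hasGrad_dV_dV (hF : IsPotential U F) (hU : IsOpen U) (hp : p ∈ U) :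
    HasGrad (dV (dV F)) (dU (dV (dV F)) p) (dV (dV (dV F)) p) p :=
  hasGrad_of_contDiffOn (contDiffOn_dV (contDiffOn_dV hF.smooth hU) hU) hU hp

/-- The coefficients of the equation for `F` depend on `u` alone, so `dV F` satisfies it as well. -/
theorem hasGrad_dU_dV (hF : IsPotential U F) (hU : IsOpen U) (hu : ∀ p ∈ U, p.1 ≠ 0)
    (hp : p ∈ U) :
    HasGrad (dU (dV F)) (dU (dV F) p * p.1⁻¹ + p.1 ^ 2 / 4 * dV (dV (dV F)) p)
      (dU (dV (dV F)) p) p := by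
  refine (hasGrad_of_contDiffOn (contDiffOn_dU (contDiffOn_dV hF.smooth hU) hU) hU hp).congr_val ?_
    (dV_dU_dV hU hF.smooth hp)
  rw [← dV_dU_dU hF.smooth hU hp, dV_congr_on hU hp hF.dU_dU,
    (((hF.hasGrad_dU hU hp).mul (HasGrad.fst.inv (hu p hp))).add
      ((hasGrad_sq_div p).mul (hF.hasGrad_dV_dV hU hp))).dV_eq]
  ring

end IsPotential

end B2

/-! ### The explicit extension of a symmetry -/

namespace B2

variable {U : Set (ℝ × ℝ)} {p : ℝ × ℝ}

/-- The coefficients of the extension of the symmetry with first density `φ` to the normal form with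
potential `F`. -/
noncomputable def extCoeff (F φ : ℝ × ℝ → ℝ) : Fin 2 → Fin 5 → ℝ × ℝ → ℝ :=
  ![![fun p => p.1 * dV F p * dU (dV φ) p + p.1 * dU F p * dV (dV φ) p,
      fun p => p.1 * dV F p * dV (dV φ) p + 4 * p.1⁻¹ * dU F p * dU (dV φ) p,
      fun p => 1 / 8 * p.1 ^ 3 * dV F p * dV (dV (dV φ)) p + 3 / 2 * dV F p * dU (dV φ) p
        + 5 / 4 * dU F p * dV (dV φ) p + 1 / 2 * p.1 * dU F p * dU (dV (dV φ)) p
        - 1 / 16 * p.1 ^ 3 * dV (dV F) p * dV (dV φ) p - 3 / 4 * dU (dV F) p * dV φ p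
        - 1 / 4 * p.1 * dU (dV F) p * dU (dV φ) p,
      fun p => 1 / 2 * p.1 * dV F p * dV (dV (dV φ)) p + 2 * p.1⁻¹ * dU F p * dU (dV (dV φ)) p
        + p.1⁻¹ ^ 2 * dU (dV F) p * dV φ p - 1 / 4 * p.1 * dV (dV F) p * dV (dV φ) p
        - p.1⁻¹ ^ 2 * dU F p * dV (dV φ) p - p.1⁻¹ * dU (dV F) p * dU (dV φ) p,
      fun p => dV F p * dV (dV φ) p + p.1 * dV F p * dU (dV (dV φ)) p
        + p.1 * dU F p * dV (dV (dV φ)) p - 1 / 2 * dV (dV F) p * dV φ p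
        - 1 / 2 * p.1 * dV (dV F) p * dU (dV φ) p - 2 * p.1⁻¹ ^ 2 * dU F p * dU (dV φ) p
        - 1 / 2 * p.1 * dU (dV F) p * dV (dV φ) p],
    ![fun p => 1 / 4 * p.1 ^ 3 * dV F p * dV (dV φ) p + dU F p * dV φ p
        + p.1 * dU F p * dU (dV φ) p,
      fun p => dV F p * dV φ p + p.1 * dV F p * dU (dV φ) p + p.1 * dU F p * dV (dV φ) p,
      fun p => 1 / 2 * p.1 ^ 2 * dV F p * dV (dV φ) p
        + 1 / 8 * p.1 ^ 3 * dV F p * dU (dV (dV φ)) p + 1 / 8 * p.1 ^ 2 * dV (dV F) p * dV φ p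
        + 1 / 8 * p.1 ^ 3 * dU F p * dV (dV (dV φ)) p + 5 / 4 * dU F p * dU (dV φ) p
        - 1 / 16 * p.1 ^ 3 * dV (dV F) p * dU (dV φ) p - 1 / 4 * p.1⁻¹ * dU F p * dV φ p
        - 1 / 16 * p.1 ^ 3 * dU (dV F) p * dV (dV φ) p,
      fun p => 1 / 2 * dV F p * dV (dV φ) p + 1 / 2 * p.1 * dV F p * dU (dV (dV φ)) p
        + p.1⁻¹ ^ 3 * dU F p * dV φ p + 1 / 2 * p.1 * dU F p * dV (dV (dV φ)) p
        - 1 / 2 * dV (dV F) p * dV φ p - 1 / 4 * p.1 * dV (dV F) p * dU (dV φ) p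
        - p.1⁻¹ ^ 2 * dU F p * dU (dV φ) p - 1 / 4 * p.1 * dU (dV F) p * dV (dV φ) p,
      fun p => 1 / 4 * p.1 ^ 3 * dV F p * dV (dV (dV φ)) p + dV F p * dU (dV φ) p
        + 1 / 2 * dU F p * dV (dV φ) p + p.1 * dU F p * dU (dV (dV φ)) p
        - 1 / 8 * p.1 ^ 3 * dV (dV F) p * dV (dV φ) p - 1 / 2 * p.1 * dU (dV F) p * dU (dV φ) p]]

/-- The derivatives of `extCoeff` with respect to `u`. -/
noncomputable def extCoeffDU (F φ : ℝ × ℝ → ℝ) : Fin 2 → Fin 5 → ℝ × ℝ → ℝ :=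
  ![![fun p => 1 / 4 * p.1 ^ 3 * dV F p * dV (dV (dV φ)) p + dV F p * dU (dV φ) p
        + 1 / 4 * p.1 ^ 3 * dV (dV F) p * dV (dV φ) p + 2 * dU F p * dV (dV φ) p
        + p.1 * dU F p * dU (dV (dV φ)) p + p.1 * dU (dV F) p * dU (dV φ) p,
      fun p => dV F p * dV (dV φ) p + p.1 * dV F p * dU (dV (dV φ)) p
        + p.1 * dV (dV F) p * dU (dV φ) p + p.1 * dU F p * dV (dV (dV φ)) p
        + p.1 * dU (dV F) p * dV (dV φ) p,
      fun p => 3 / 4 * p.1 ^ 2 * dV F p * dV (dV (dV φ)) p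
        + 1 / 8 * p.1 ^ 3 * dV F p * dU (dV (dV (dV φ))) p
        + 1 / 8 * p.1 ^ 2 * dV (dV F) p * dV (dV φ) p
        + 1 / 16 * p.1 ^ 3 * dV (dV F) p * dU (dV (dV φ)) p + 5 / 4 * p.1⁻¹ * dU F p * dV (dV φ) p
        + 1 / 8 * p.1 ^ 3 * dU F p * dV (dV (dV (dV φ))) p + 9 / 4 * dU F p * dU (dV (dV φ)) p
        + 1 / 16 * p.1 ^ 3 * dU (dV F) p * dV (dV (dV φ)) p + 1 / 4 * dU (dV F) p * dU (dV φ) p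
        - 3 / 16 * p.1 ^ 2 * dV (dV (dV F)) p * dV φ p
        - 1 / 16 * p.1 ^ 3 * dV (dV (dV F)) p * dU (dV φ) p - 3 / 4 * p.1⁻¹ * dU (dV F) p * dV φ p
        - 1 / 16 * p.1 ^ 3 * dU (dV (dV F)) p * dV (dV φ) p,
      fun p => 1 / 2 * dV F p * dV (dV (dV φ)) p + 1 / 2 * p.1 * dV F p * dU (dV (dV (dV φ))) p
        + 1 / 4 * p.1 * dV (dV F) p * dU (dV (dV φ)) p + 1 / 4 * dV (dV (dV F)) p * dV φ p
        + p.1⁻¹ ^ 3 * dU F p * dV (dV φ) p + 1 / 2 * p.1 * dU F p * dV (dV (dV (dV φ))) p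
        + 1 / 4 * p.1 * dU (dV F) p * dV (dV (dV φ)) p + p.1⁻¹ ^ 2 * dU (dV F) p * dU (dV φ) p
        - 1 / 2 * dV (dV F) p * dV (dV φ) p - 1 / 4 * p.1 * dV (dV (dV F)) p * dU (dV φ) p
        - p.1⁻¹ ^ 2 * dU F p * dU (dV (dV φ)) p - p.1⁻¹ ^ 3 * dU (dV F) p * dV φ p
        - 1 / 4 * p.1 * dU (dV (dV F)) p * dV (dV φ) p,
      fun p => 1 / 4 * p.1 ^ 3 * dV F p * dV (dV (dV (dV φ))) p + 2 * dV F p * dU (dV (dV φ)) p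
        + 1 / 8 * p.1 ^ 3 * dV (dV F) p * dV (dV (dV φ)) p + 3 / 2 * dU F p * dV (dV (dV φ)) p
        + 2 * p.1⁻¹ ^ 3 * dU F p * dU (dV φ) p + p.1 * dU F p * dU (dV (dV (dV φ))) p
        + 1 / 2 * p.1 * dU (dV F) p * dU (dV (dV φ)) p - 3 / 2 * dV (dV F) p * dU (dV φ) p
        - 1 / 8 * p.1 ^ 3 * dV (dV (dV F)) p * dV (dV φ) p - 1 / 2 * dU (dV (dV F)) p * dV φ p
        - 1 / 2 * p.1 * dU (dV (dV F)) p * dU (dV φ) p],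
    ![fun p => 3 / 4 * p.1 ^ 2 * dV F p * dV (dV φ) p
        + 1 / 4 * p.1 ^ 3 * dV F p * dU (dV (dV φ)) p + 1 / 4 * p.1 ^ 2 * dV (dV F) p * dV φ p
        + 1 / 4 * p.1 ^ 3 * dV (dV F) p * dU (dV φ) p + p.1⁻¹ * dU F p * dV φ p
        + 1 / 4 * p.1 ^ 3 * dU F p * dV (dV (dV φ)) p + 3 * dU F p * dU (dV φ) p
        + 1 / 4 * p.1 ^ 3 * dU (dV F) p * dV (dV φ) p,
      fun p => 1 / 4 * p.1 ^ 3 * dV F p * dV (dV (dV φ)) p + 2 * dV F p * dU (dV φ) p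
        + 1 / 4 * p.1 ^ 3 * dV (dV F) p * dV (dV φ) p + 2 * dU F p * dV (dV φ) p
        + p.1 * dU F p * dU (dV (dV φ)) p + dU (dV F) p * dV φ p
        + p.1 * dU (dV F) p * dU (dV φ) p,
      fun p => p.1 * dV F p * dV (dV φ) p + 1 / 32 * p.1 ^ 5 * dV F p * dV (dV (dV (dV φ))) p
        + 7 / 8 * p.1 ^ 2 * dV F p * dU (dV (dV φ)) p + 3 / 16 * p.1 * dV (dV F) p * dV φ p
        + 1 / 64 * p.1 ^ 5 * dV (dV F) p * dV (dV (dV φ)) p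
        + 1 / 4 * p.1 ^ 2 * dV (dV F) p * dU (dV φ) p
        + 13 / 16 * p.1 ^ 2 * dU F p * dV (dV (dV φ)) p + p.1⁻¹ * dU F p * dU (dV φ) p
        + 1 / 8 * p.1 ^ 3 * dU F p * dU (dV (dV (dV φ))) p
        + 1 / 4 * p.1 ^ 2 * dU (dV F) p * dV (dV φ) p
        + 1 / 16 * p.1 ^ 3 * dU (dV F) p * dU (dV (dV φ)) p
        + 1 / 8 * p.1 ^ 2 * dU (dV (dV F)) p * dV φ p
        - 1 / 64 * p.1 ^ 5 * dV (dV (dV F)) p * dV (dV φ) p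
        - 1 / 16 * p.1 ^ 3 * dU (dV (dV F)) p * dU (dV φ) p,
      fun p => 1 / 8 * p.1 ^ 3 * dV F p * dV (dV (dV (dV φ))) p + dV F p * dU (dV (dV φ)) p
        + 1 / 4 * p.1⁻¹ * dV (dV F) p * dV φ p + 1 / 16 * p.1 ^ 3 * dV (dV F) p * dV (dV (dV φ)) p
        + 3 / 4 * dU F p * dV (dV (dV φ)) p + 2 * p.1⁻¹ ^ 3 * dU F p * dU (dV φ) p
        + 1 / 2 * p.1 * dU F p * dU (dV (dV (dV φ))) p
        + 1 / 4 * p.1 * dU (dV F) p * dU (dV (dV φ)) p - dV (dV F) p * dU (dV φ) p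
        - 1 / 16 * p.1 ^ 3 * dV (dV (dV F)) p * dV (dV φ) p - 2 * p.1⁻¹ ^ 4 * dU F p * dV φ p
        - 1 / 2 * dU (dV (dV F)) p * dV φ p - 1 / 4 * p.1 * dU (dV (dV F)) p * dU (dV φ) p,
      fun p => p.1 ^ 2 * dV F p * dV (dV (dV φ)) p
        + 1 / 4 * p.1 ^ 3 * dV F p * dU (dV (dV (dV φ))) p
        + 1 / 8 * p.1 ^ 3 * dV (dV F) p * dU (dV (dV φ)) p + 1 / 2 * p.1⁻¹ * dU F p * dV (dV φ) p
        + 1 / 4 * p.1 ^ 3 * dU F p * dV (dV (dV (dV φ))) p + 5 / 2 * dU F p * dU (dV (dV φ)) p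
        + 1 / 8 * p.1 ^ 3 * dU (dV F) p * dV (dV (dV φ)) p
        - 1 / 4 * p.1 ^ 2 * dV (dV F) p * dV (dV φ) p
        - 1 / 8 * p.1 ^ 3 * dV (dV (dV F)) p * dU (dV φ) p
        - 1 / 8 * p.1 ^ 3 * dU (dV (dV F)) p * dV (dV φ) p]]

/-- The derivatives of `extCoeff` with respect to `v`. -/
noncomputable def extCoeffDV (F φ : ℝ × ℝ → ℝ) : Fin 2 → Fin 5 → ℝ × ℝ → ℝ :=
  ![![fun p => p.1 * dV F p * dU (dV (dV φ)) p + p.1 * dV (dV F) p * dU (dV φ) p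
        + p.1 * dU F p * dV (dV (dV φ)) p + p.1 * dU (dV F) p * dV (dV φ) p,
      fun p => p.1 * dV F p * dV (dV (dV φ)) p + p.1 * dV (dV F) p * dV (dV φ) p
        + 4 * p.1⁻¹ * dU F p * dU (dV (dV φ)) p + 4 * p.1⁻¹ * dU (dV F) p * dU (dV φ) p,
      fun p => 1 / 8 * p.1 ^ 3 * dV F p * dV (dV (dV (dV φ))) p
        + 3 / 2 * dV F p * dU (dV (dV φ)) p + 1 / 16 * p.1 ^ 3 * dV (dV F) p * dV (dV (dV φ)) p
        + 3 / 2 * dV (dV F) p * dU (dV φ) p + 5 / 4 * dU F p * dV (dV (dV φ)) p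
        + 1 / 2 * p.1 * dU F p * dU (dV (dV (dV φ))) p + 1 / 2 * dU (dV F) p * dV (dV φ) p
        + 1 / 4 * p.1 * dU (dV F) p * dU (dV (dV φ)) p
        - 1 / 16 * p.1 ^ 3 * dV (dV (dV F)) p * dV (dV φ) p - 3 / 4 * dU (dV (dV F)) p * dV φ p
        - 1 / 4 * p.1 * dU (dV (dV F)) p * dU (dV φ) p,
      fun p => 1 / 2 * p.1 * dV F p * dV (dV (dV (dV φ))) p
        + 1 / 4 * p.1 * dV (dV F) p * dV (dV (dV φ)) p
        + 2 * p.1⁻¹ * dU F p * dU (dV (dV (dV φ))) p + p.1⁻¹ * dU (dV F) p * dU (dV (dV φ)) p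
        + p.1⁻¹ ^ 2 * dU (dV (dV F)) p * dV φ p - 1 / 4 * p.1 * dV (dV (dV F)) p * dV (dV φ) p
        - p.1⁻¹ ^ 2 * dU F p * dV (dV (dV φ)) p - p.1⁻¹ * dU (dV (dV F)) p * dU (dV φ) p,
      fun p => dV F p * dV (dV (dV φ)) p + p.1 * dV F p * dU (dV (dV (dV φ))) p
        + 1 / 2 * dV (dV F) p * dV (dV φ) p + 1 / 2 * p.1 * dV (dV F) p * dU (dV (dV φ)) p
        + p.1 * dU F p * dV (dV (dV (dV φ))) p + 1 / 2 * p.1 * dU (dV F) p * dV (dV (dV φ)) p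
        - 1 / 2 * dV (dV (dV F)) p * dV φ p - 1 / 2 * p.1 * dV (dV (dV F)) p * dU (dV φ) p
        - 2 * p.1⁻¹ ^ 2 * dU F p * dU (dV (dV φ)) p - 2 * p.1⁻¹ ^ 2 * dU (dV F) p * dU (dV φ) p
        - 1 / 2 * p.1 * dU (dV (dV F)) p * dV (dV φ) p],
    ![fun p => 1 / 4 * p.1 ^ 3 * dV F p * dV (dV (dV φ)) p
        + 1 / 4 * p.1 ^ 3 * dV (dV F) p * dV (dV φ) p + dU F p * dV (dV φ) p
        + p.1 * dU F p * dU (dV (dV φ)) p + dU (dV F) p * dV φ p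
        + p.1 * dU (dV F) p * dU (dV φ) p,
      fun p => dV F p * dV (dV φ) p + p.1 * dV F p * dU (dV (dV φ)) p + dV (dV F) p * dV φ p
        + p.1 * dV (dV F) p * dU (dV φ) p + p.1 * dU F p * dV (dV (dV φ)) p
        + p.1 * dU (dV F) p * dV (dV φ) p,
      fun p => 1 / 2 * p.1 ^ 2 * dV F p * dV (dV (dV φ)) p
        + 1 / 8 * p.1 ^ 3 * dV F p * dU (dV (dV (dV φ))) p
        + 5 / 8 * p.1 ^ 2 * dV (dV F) p * dV (dV φ) p
        + 1 / 16 * p.1 ^ 3 * dV (dV F) p * dU (dV (dV φ)) p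
        + 1 / 8 * p.1 ^ 2 * dV (dV (dV F)) p * dV φ p
        + 1 / 8 * p.1 ^ 3 * dU F p * dV (dV (dV (dV φ))) p + 5 / 4 * dU F p * dU (dV (dV φ)) p
        + 1 / 16 * p.1 ^ 3 * dU (dV F) p * dV (dV (dV φ)) p + 5 / 4 * dU (dV F) p * dU (dV φ) p
        - 1 / 16 * p.1 ^ 3 * dV (dV (dV F)) p * dU (dV φ) p - 1 / 4 * p.1⁻¹ * dU F p * dV (dV φ) p
        - 1 / 4 * p.1⁻¹ * dU (dV F) p * dV φ p
        - 1 / 16 * p.1 ^ 3 * dU (dV (dV F)) p * dV (dV φ) p,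
      fun p => 1 / 2 * dV F p * dV (dV (dV φ)) p + 1 / 2 * p.1 * dV F p * dU (dV (dV (dV φ))) p
        + 1 / 4 * p.1 * dV (dV F) p * dU (dV (dV φ)) p + p.1⁻¹ ^ 3 * dU F p * dV (dV φ) p
        + 1 / 2 * p.1 * dU F p * dV (dV (dV (dV φ))) p + p.1⁻¹ ^ 3 * dU (dV F) p * dV φ p
        + 1 / 4 * p.1 * dU (dV F) p * dV (dV (dV φ)) p - 1 / 2 * dV (dV (dV F)) p * dV φ p
        - 1 / 4 * p.1 * dV (dV (dV F)) p * dU (dV φ) p - p.1⁻¹ ^ 2 * dU F p * dU (dV (dV φ)) p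
        - p.1⁻¹ ^ 2 * dU (dV F) p * dU (dV φ) p - 1 / 4 * p.1 * dU (dV (dV F)) p * dV (dV φ) p,
      fun p => 1 / 4 * p.1 ^ 3 * dV F p * dV (dV (dV (dV φ))) p + dV F p * dU (dV (dV φ)) p
        + 1 / 8 * p.1 ^ 3 * dV (dV F) p * dV (dV (dV φ)) p + dV (dV F) p * dU (dV φ) p
        + 1 / 2 * dU F p * dV (dV (dV φ)) p + p.1 * dU F p * dU (dV (dV (dV φ))) p
        + 1 / 2 * dU (dV F) p * dV (dV φ) p + 1 / 2 * p.1 * dU (dV F) p * dU (dV (dV φ)) p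
        - 1 / 8 * p.1 ^ 3 * dV (dV (dV F)) p * dV (dV φ) p
        - 1 / 2 * p.1 * dU (dV (dV F)) p * dU (dV φ) p]]

/-- The derivatives of `normalForm` with respect to `u`. -/
noncomputable def normalFormDU (F : ℝ × ℝ → ℝ) : Fin 2 → Fin 5 → ℝ × ℝ → ℝ :=
  ![![fun _ => 0,
      fun _ => 0,
      fun p => -3 / 16 * p.1 ^ 2 * dV (dV (dV F)) p - 3 / 4 * p.1⁻¹ * dU (dV F) p,
      fun p => 1 / 4 * dV (dV (dV F)) p - p.1⁻¹ ^ 3 * dU (dV F) p,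
      fun p => -1 / 2 * dU (dV (dV F)) p],
    ![fun p => 1 / 4 * p.1 ^ 2 * dV (dV F) p + p.1⁻¹ * dU F p,
      fun p => dU (dV F) p,
      fun p => 3 / 16 * p.1 * dV (dV F) p + 1 / 8 * p.1 ^ 2 * dU (dV (dV F)) p,
      fun p => 1 / 4 * p.1⁻¹ * dV (dV F) p - 2 * p.1⁻¹ ^ 4 * dU F p - 1 / 2 * dU (dV (dV F)) p,
      fun _ => 0]]

/-- The derivatives of `normalForm` with respect to `v`. -/
noncomputable def normalFormDV (F : ℝ × ℝ → ℝ) : Fin 2 → Fin 5 → ℝ × ℝ → ℝ :=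
  ![![fun _ => 0,
      fun _ => 0,
      fun p => -3 / 4 * dU (dV (dV F)) p,
      fun p => p.1⁻¹ ^ 2 * dU (dV (dV F)) p,
      fun p => -1 / 2 * dV (dV (dV F)) p],
    ![fun p => dU (dV F) p,
      fun p => dV (dV F) p,
      fun p => 1 / 8 * p.1 ^ 2 * dV (dV (dV F)) p - 1 / 4 * p.1⁻¹ * dU (dV F) p,
      fun p => p.1⁻¹ ^ 3 * dU (dV F) p - 1 / 2 * dV (dV (dV F)) p,
      fun _ => 0]]

/-- The wave equations of `F` and `g 0` enter through the gradients `f1`, `f3`, `g2` and `g4`. The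
resulting tables contain at most one derivative in `u` of each function, so later identities need no
further reduction. -/
theorem hasGrad_extCoeff {F : ℝ × ℝ → ℝ} {g : Fin 2 → ℝ × ℝ → ℝ} (hU : IsOpen U)
    (hu : ∀ p ∈ U, p.1 ≠ 0) (hF : IsPotential U F) (hg : IsWave U g) (hp : p ∈ U) (i : Fin 2)
    (k : Fin 5) :
    HasGrad (extCoeff F (g 0) i k) (extCoeffDU F (g 0) i k p) (extCoeffDV F (g 0) i k p) p := by
  have h0 := hu p hp
  have f1 := hF.hasGrad_dU hU hp
  have f2 := hF.hasGrad_dV hU hp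
  have f3 := hF.hasGrad_dU_dV hU hu hp
  have f4 := hF.hasGrad_dV_dV hU hp
  have g1 := hg.hasGrad_dV hU hp
  have g2 := hg.hasGrad_dU_dV hU hp
  have g3 := hg.hasGrad_dV_dV hU hp
  have g4 := hg.hasGrad_dU_dV_dV hU hp
  have g5 := hg.hasGrad_dV_dV_dV hU hp
  have hi : HasGrad (fun q : ℝ × ℝ => q.1⁻¹) (-(p.1 ^ 2)⁻¹ * 1) (-(p.1 ^ 2)⁻¹ * 0) p :=
    HasGrad.fst.inv h0
  fin_cases i <;> fin_cases k <;> simp only [extCoeff, extCoeffDU, extCoeffDV, Fin.zero_eta,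
    Fin.mk_one, Fin.reduceFinMk, Matrix.cons_val_zero, Matrix.cons_val_one, Matrix.cons_val] <;>
    (apply HasGrad.congr_val
     · repeat' first
        | exact f1 | exact f2 | exact f3 | exact f4 | exact g1 | exact g2 | exact g3 | exact g4
        | exact g5 | exact hi | exact HasGrad.fst | exact HasGrad.const _ | with_reducible apply HasGrad.add
        | with_reducible apply HasGrad.sub | with_reducible apply HasGrad.mul | with_reducible apply HasGrad.pow
     all_goals
      push_cast
      field_simp
      try ring)

theorem coeff25_eq (F : ℝ × ℝ → ℝ) :
    coeff25 F = fun p => p.1 ^ 2 / 8 * dV (dV F) p - 1 / (4 * p.1) * dU F p := rfl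

theorem hasGrad_normalForm {F : ℝ × ℝ → ℝ} (hU : IsOpen U) (hu : ∀ p ∈ U, p.1 ≠ 0)
    (hF : IsPotential U F) (hp : p ∈ U) (i : Fin 2) (k : Fin 5) :
    HasGrad (normalForm F i k) (normalFormDU F i k p) (normalFormDV F i k p) p := by
  have h0 := hu p hp
  have f1 := hF.hasGrad_dU hU hp
  have f2 := hF.hasGrad_dV hU hp
  have f3 := hF.hasGrad_dU_dV hU hu hp
  have f4 := hF.hasGrad_dV_dV hU hp
  have hi : HasGrad (fun q : ℝ × ℝ => q.1⁻¹) (-(p.1 ^ 2)⁻¹ * 1) (-(p.1 ^ 2)⁻¹ * 0) p :=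
    HasGrad.fst.inv h0
  fin_cases i <;> fin_cases k <;> simp only [normalForm, coeff25_eq, normalFormDU, normalFormDV,
    Fin.zero_eta, Fin.mk_one, Fin.reduceFinMk, Matrix.cons_val_zero, Matrix.cons_val_one,
    Matrix.cons_val, div_eq_mul_inv, mul_inv, ← inv_pow] <;>
    (apply HasGrad.congr_val
     · repeat' first
        | exact f1 | exact f2 | exact f3 | exact f4 | exact hi | exact HasGrad.fst
        | exact HasGrad.const _ | with_reducible apply HasGrad.add
        | with_reducible apply HasGrad.sub | with_reducible apply HasGrad.mul
        | with_reducible apply HasGrad.pow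
     all_goals
      push_cast
      field_simp
      try ring)

theorem contDiffOn_extCoeff {F : ℝ × ℝ → ℝ} {g : Fin 2 → ℝ × ℝ → ℝ} (hU : IsOpen U)
    (hu : ∀ p ∈ U, p.1 ≠ 0) (hF : IsPotential U F) (hg : IsWave U g) (i : Fin 2) (k : Fin 5) :
    ContDiffOn ℝ ∞ (extCoeff F (g 0) i k) U := by
  have f1 := contDiffOn_dU hF.smooth hU
  have f2 := contDiffOn_dV hF.smooth hU
  have f3 := contDiffOn_dU f2 hU
  have f4 := contDiffOn_dV f2 hU
  have g1 := hg.contDiffOn_dV_zero hU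
  have g2 := hg.contDiffOn_dV_dV_zero hU
  have g3 := hg.contDiffOn_dV_dV_dV_zero hU
  have g4 := contDiffOn_dU g1 hU
  have g5 := contDiffOn_dU g2 hU
  fin_cases i <;> fin_cases k <;> simp only [extCoeff, Fin.zero_eta, Fin.mk_one,
    Fin.reduceFinMk, Matrix.cons_val_zero, Matrix.cons_val_one, Matrix.cons_val] <;>
    fun_prop (disch := assumption)

theorem contDiffOn_normalForm {F : ℝ × ℝ → ℝ} (hU : IsOpen U) (hu : ∀ p ∈ U, p.1 ≠ 0)
    (hF : ContDiffOn ℝ ∞ F U) (i : Fin 2) (k : Fin 5) :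
    ContDiffOn ℝ ∞ (normalForm F i k) U := by
  have f1 := contDiffOn_dU hF hU
  have f2 := contDiffOn_dV hF hU
  have f3 := contDiffOn_dU f2 hU
  have f4 := contDiffOn_dV f2 hU
  fin_cases i <;> fin_cases k <;> simp only [normalForm, coeff25_eq, Fin.zero_eta, Fin.mk_one,
    Fin.reduceFinMk, Matrix.cons_val_zero, Matrix.cons_val_one, Matrix.cons_val, div_eq_mul_inv,
    mul_inv, ← inv_pow] <;>
    fun_prop (disch := assumption)

end B2

/-! ### The explicit extension commutes with the primary flow -/

namespace B2

variable {U : Set (ℝ × ℝ)} {p : ℝ × ℝ}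

-- Once the wave equations have removed repeated derivatives in `u` and the derivatives of `g 1`,
-- the remaining derivatives of `F` and `g 0` can be treated as independent variables. Each of the
-- twenty equations becomes an identity of rational functions in `u` and these variables.
set_option maxHeartbeats 4000000 in
theorem commCoeff_primaryFrob_extCoeff {F : ℝ × ℝ → ℝ} {g : Fin 2 → ℝ × ℝ → ℝ} (hU : IsOpen U)
    (hu : ∀ p ∈ U, p.1 ≠ 0) (hF : IsPotential U F) (hg : IsWave U g) (hp : p ∈ U) (i : Fin 2)
    (j : Fin 10) :
    commCoeff primaryFrob (extCoeff F (g 0)) i j p = commCoeff g (normalForm F) i j p := by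
  have h0 := hu p hp
  have bu := fun i k => (hasGrad_extCoeff hU hu hF hg hp i k).dU_eq
  have bv := fun i k => (hasGrad_extCoeff hU hu hF hg hp i k).dV_eq
  have au := fun i k => (hasGrad_normalForm hU hu hF hp i k).dU_eq
  have av := fun i k => (hasGrad_normalForm hU hu hF hp i k).dV_eq
  have e1 := commCoeff_primaryFrob (extCoeff F (g 0)) p
  simp only [bu, bv] at e1
  fin_cases i
  · refine (congrFun e1.1 j).trans ?_
    fin_cases j <;>
    simp only [commCoeff, totalCoeff, timeCoeff, au, av, hg.dU_one p hp, hg.dV_one p hp,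
      hg.dU_dU_zero hU hp, hg.dU_dU_one hU hp, hg.dU_dV_one hU hp, hg.dV_dV_one hU hp,
      hg.dU_dU_dU_zero hU hp, hg.dU_dU_dV_zero hU hp, hg.dU_dU_dU_one hU hp,
      hg.dU_dU_dV_one hU hp, hg.dU_dV_dV_one hU hp, hg.dV_dV_dV_one hU hp, Fin.zero_eta,
      Fin.mk_one, Fin.reduceFinMk, Matrix.cons_val_zero, Matrix.cons_val_one,
      Matrix.cons_val] <;>
    simp only [extCoeff, extCoeffDU, extCoeffDV, normalForm, coeff25_eq, normalFormDU,
      normalFormDV, Matrix.cons_val_zero, Matrix.cons_val_one, Matrix.cons_val] <;>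
    field_simp <;> ring
  · refine (congrFun e1.2 j).trans ?_
    fin_cases j <;>
    simp only [commCoeff, totalCoeff, timeCoeff, au, av, hg.dU_one p hp, hg.dV_one p hp,
      hg.dU_dU_zero hU hp, hg.dU_dU_one hU hp, hg.dU_dV_one hU hp, hg.dV_dV_one hU hp,
      hg.dU_dU_dU_zero hU hp, hg.dU_dU_dV_zero hU hp, hg.dU_dU_dU_one hU hp,
      hg.dU_dU_dV_one hU hp, hg.dU_dV_dV_one hU hp, hg.dV_dV_dV_one hU hp, Fin.zero_eta,
      Fin.mk_one, Fin.reduceFinMk, Matrix.cons_val_zero, Matrix.cons_val_one,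
      Matrix.cons_val] <;>
    simp only [extCoeff, extCoeffDU, extCoeffDV, normalForm, coeff25_eq, normalFormDU,
      normalFormDV, Matrix.cons_val_zero, Matrix.cons_val_one, Matrix.cons_val] <;>
    field_simp <;> ring

end B2

/-! ### The explicit extensions commute with each other -/

namespace B2

variable {U : Set (ℝ × ℝ)} {p : ℝ × ℝ}

-- The same elimination with two independent symmetries: both sides are linear in the derivatives of
-- `F` and in those of each symmetry, and they agree after reduction by the wave equations.
set_option maxHeartbeats 4000000 in
theorem commCoeff_extCoeff_comm {F : ℝ × ℝ → ℝ} {g g' : Fin 2 → ℝ × ℝ → ℝ} (hU : IsOpen U)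
    (hu : ∀ p ∈ U, p.1 ≠ 0) (hF : IsPotential U F) (hg : IsWave U g) (hg' : IsWave U g')
    (hp : p ∈ U) (i : Fin 2) (j : Fin 10) :
    commCoeff g (extCoeff F (g' 0)) i j p = commCoeff g' (extCoeff F (g 0)) i j p := by
  have h0 := hu p hp
  have bu := fun i k => (hasGrad_extCoeff hU hu hF hg hp i k).dU_eq
  have bv := fun i k => (hasGrad_extCoeff hU hu hF hg hp i k).dV_eq
  have cu := fun i k => (hasGrad_extCoeff hU hu hF hg' hp i k).dU_eq
  have cv := fun i k => (hasGrad_extCoeff hU hu hF hg' hp i k).dV_eq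
  fin_cases i <;> fin_cases j <;>
    simp only [commCoeff, totalCoeff, timeCoeff, bu, bv, cu, cv, hg.dU_one p hp, hg.dV_one p hp,
      hg.dU_dU_zero hU hp, hg.dU_dU_one hU hp, hg.dU_dV_one hU hp, hg.dV_dV_one hU hp,
      hg.dU_dU_dU_zero hU hp, hg.dU_dU_dV_zero hU hp, hg.dU_dU_dU_one hU hp,
      hg.dU_dU_dV_one hU hp, hg.dU_dV_dV_one hU hp, hg.dV_dV_dV_one hU hp, hg'.dU_one p hp,
      hg'.dV_one p hp, hg'.dU_dU_zero hU hp, hg'.dU_dU_one hU hp, hg'.dU_dV_one hU hp,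
      hg'.dV_dV_one hU hp, hg'.dU_dU_dU_zero hU hp, hg'.dU_dU_dV_zero hU hp,
      hg'.dU_dU_dU_one hU hp, hg'.dU_dU_dV_one hU hp, hg'.dU_dV_dV_one hU hp,
      hg'.dV_dV_dV_one hU hp, Fin.zero_eta, Fin.mk_one, Fin.reduceFinMk, Matrix.cons_val_zero,
      Matrix.cons_val_one, Matrix.cons_val] <;>
    simp only [extCoeff, extCoeffDU, extCoeffDV, Matrix.cons_val_zero, Matrix.cons_val_one,
      Matrix.cons_val] <;>
    field_simp <;> ring

end B2

/-! ### Uniqueness and commutation of arbitrary extensions -/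

namespace B2

variable {U : Set (ℝ × ℝ)} {p : ℝ × ℝ}

theorem isExtension_extCoeff {F : ℝ × ℝ → ℝ} {g : Fin 2 → ℝ × ℝ → ℝ} (hU : IsOpen U)
    (hu : ∀ p ∈ U, p.1 ≠ 0) (hF : IsPotential U F) (hg : IsWave U g) :
    IsExtension U primaryFrob (normalForm F) g (extCoeff F (g 0)) := by
  refine ⟨contDiffOn_extCoeff hU hu hF hg, (commuteUpToOrderTwo_iff hU
    (fun i => (contDiff_primaryFrob i).contDiffOn) hg.smooth
    (contDiffOn_normalForm hU hu hF.smooth) (contDiffOn_extCoeff hU hu hF hg)).2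
    ⟨((isSymmetry_primaryFrob_iff hU).2 hg).2, fun i j p hp => ?_⟩⟩
  exact commCoeff_primaryFrob_extCoeff hU hu hF hg hp i j

/-- The equations are linear in the extension, so the difference from the explicit one solves the
homogeneous system and vanishes. -/
theorem IsExtension.eq_extCoeff {F : ℝ × ℝ → ℝ} {g : Fin 2 → ℝ × ℝ → ℝ}
    {b : Fin 2 → Fin 5 → ℝ × ℝ → ℝ} (hU : IsOpen U) (hu : ∀ p ∈ U, p.1 ≠ 0)
    (hF : IsPotential U F) (hg : IsWave U g)
    (hb : IsExtension U primaryFrob (normalForm F) g b) (i : Fin 2) (k : Fin 5) (hp : p ∈ U) :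
    b i k p = extCoeff F (g 0) i k p := by
  have hs := contDiffOn_extCoeff hU hu hF hg
  have h1 := ((commuteUpToOrderTwo_iff hU (fun i => (contDiff_primaryFrob i).contDiffOn) hg.smooth
    (contDiffOn_normalForm hU hu hF.smooth) hb.1).1 hb.2).2
  refine sub_eq_zero.1 (eq_zero_of_commCoeff_primaryFrob hU hu
    (b := fun i k p => b i k p - extCoeff F (g 0) i k p) (fun i k => (hb.1 i k).sub (hs i k))
    (fun i j p hp => ?_) i k p hp)
  rw [commCoeff_sub hU hb.1 hs hp, h1 i j p hp, commCoeff_primaryFrob_extCoeff hU hu hF hg hp,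
    sub_self]

/-- By uniqueness it is enough to know this for the explicit extensions. -/
theorem commuteUpToOrderTwo_of_isExtension {F : ℝ × ℝ → ℝ} {g g' : Fin 2 → ℝ × ℝ → ℝ}
    {b b' : Fin 2 → Fin 5 → ℝ × ℝ → ℝ} (hU : IsOpen U) (hu : ∀ p ∈ U, p.1 ≠ 0)
    (hF : IsPotential U F) (hg : IsWave U g) (hg' : IsWave U g')
    (hb : IsExtension U primaryFrob (normalForm F) g b)
    (hb' : IsExtension U primaryFrob (normalForm F) g' b') :
    CommuteUpToOrderTwo U (deformed g b) (deformed g' b') := by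
  refine (commuteUpToOrderTwo_iff hU hg.smooth hg'.smooth hb.1 hb'.1).2
    ⟨(flowComm_dispersionless_eq_zero_iff hU hg.smooth hg'.smooth).2 fun i k p hp =>
      hg.commCoeffZero_eq_zero hg' i k hp, fun i j p hp => ?_⟩
  rw [commCoeff_congr hU (fun i k q hq => hb'.eq_extCoeff hU hu hF hg' i k hq) hp,
    commCoeff_congr hU (fun i k q hq => hb.eq_extCoeff hU hu hF hg i k hq) hp]
  exact commCoeff_extCoeff_comm hU hu hF hg hg' hp i j

/-! ### Functions of the Riemann invariants as potentials -/

/-- Along a line of constant `u` the invariant moves at unit speed with `v`. Openness makes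
smoothness of `F₁` on the image mean honest differentiability at each of its points. -/
theorem isOpen_image_r₁ (hU : IsOpen U) : IsOpen (r₁ '' U) := by
  rw [isOpen_iff_mem_nhds]
  rintro _ ⟨p, hp, rfl⟩
  have hc : Continuous fun s : ℝ => (p.1, s - p.1 ^ 2 / 4) := by fun_prop
  have h1 : (fun s : ℝ => (p.1, s - p.1 ^ 2 / 4)) ⁻¹' U ∈ nhds (r₁ p) :=
    hc.continuousAt.preimage_mem_nhds (hU.mem_nhds (by simpa [r₁] using hp))
  filter_upwards [h1] with s hs
  exact ⟨_, hs, by simp [r₁]⟩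

theorem isOpen_image_r₂ (hU : IsOpen U) : IsOpen (r₂ '' U) := by
  rw [isOpen_iff_mem_nhds]
  rintro _ ⟨p, hp, rfl⟩
  have hc : Continuous fun s : ℝ => (p.1, s + p.1 ^ 2 / 4) := by fun_prop
  have h1 : (fun s : ℝ => (p.1, s + p.1 ^ 2 / 4)) ⁻¹' U ∈ nhds (r₂ p) := by
    refine hc.continuousAt.preimage_mem_nhds (hU.mem_nhds ?_)
    have e : (p.1, r₂ p + p.1 ^ 2 / 4) = p := by ext <;> simp [r₂]; ring
    rw [e]; exact hp
  filter_upwards [h1] with s hs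
  exact ⟨_, hs, by simp [r₂]; ring⟩

theorem hasGrad_r₁ (p : ℝ × ℝ) : HasGrad r₁ (p.1 / 2) 1 p :=
  ((hasGrad_sq_div p).add HasGrad.snd).congr_val (by ring) (by ring)

theorem hasGrad_r₂ (p : ℝ × ℝ) : HasGrad r₂ (-(p.1 / 2)) 1 p :=
  (((hasGrad_sq_div p).neg.add HasGrad.snd).congr_val (c := -(p.1 / 2)) (d := 1)
    (by ring) (by ring)).congr (.of_forall fun q => by simp [r₂]; ring)

theorem hasDerivAt_of_contDiffOn {f : ℝ → ℝ} {S : Set ℝ} (hS : IsOpen S)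
    (hf : ContDiffOn ℝ ∞ f S) {x : ℝ} (hx : x ∈ S) : HasDerivAt f (deriv f x) x :=
  ((hf.contDiffAt (hS.mem_nhds hx)).differentiableAt (by simp)).hasDerivAt

theorem hasGrad_potential {F₁ F₂ : ℝ → ℝ} (hU : IsOpen U) (h₁ : ContDiffOn ℝ ∞ F₁ (r₁ '' U))
    (h₂ : ContDiffOn ℝ ∞ F₂ (r₂ '' U)) (hp : p ∈ U) :
    HasGrad (potential F₁ F₂) (p.1 / 2 * deriv F₁ (r₁ p) - p.1 / 2 * deriv F₂ (r₂ p))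
      (deriv F₁ (r₁ p) + deriv F₂ (r₂ p)) p := by
  have e₁ := hasDerivAt_of_contDiffOn (isOpen_image_r₁ hU) h₁ ⟨p, hp, rfl⟩
  have e₂ := hasDerivAt_of_contDiffOn (isOpen_image_r₂ hU) h₂ ⟨p, hp, rfl⟩
  exact ((HasGrad.comp e₁ (hasGrad_r₁ p)).add (HasGrad.comp e₂ (hasGrad_r₂ p))).congr_val
    (by ring) (by ring)

theorem contDiffOn_potential {F₁ F₂ : ℝ → ℝ} (h₁ : ContDiffOn ℝ ∞ F₁ (r₁ '' U))
    (h₂ : ContDiffOn ℝ ∞ F₂ (r₂ '' U)) : ContDiffOn ℝ ∞ (potential F₁ F₂) U := by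
  have k₁ : ContDiff ℝ ∞ r₁ := by unfold r₁; fun_prop
  have k₂ : ContDiff ℝ ∞ r₂ := by unfold r₂; fun_prop
  exact (h₁.comp k₁.contDiffOn (Set.mapsTo_image _ _)).add
    (h₂.comp k₂.contDiffOn (Set.mapsTo_image _ _))

/-- Since `F_u = (u/2)(F₁' - F₂')` and `F_v = F₁' + F₂'`, another derivative in `u` gives `(u²/4)
F_vv` from the invariants and `F_u / u` from the factor `u/2`. -/
theorem isPotential_potential {F₁ F₂ : ℝ → ℝ} (hU : IsOpen U) (hu : ∀ p ∈ U, p.1 ≠ 0)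
    (h₁ : ContDiffOn ℝ ∞ F₁ (r₁ '' U)) (h₂ : ContDiffOn ℝ ∞ F₂ (r₂ '' U)) :
    IsPotential U (potential F₁ F₂) := by
  refine ⟨contDiffOn_potential h₁ h₂, fun p hp => ?_⟩
  have h0 := hu p hp
  have d₁ : ContDiffOn ℝ ∞ (deriv F₁) (r₁ '' U) :=
    h₁.deriv_of_isOpen (isOpen_image_r₁ hU) (by simp)
  have d₂ : ContDiffOn ℝ ∞ (deriv F₂) (r₂ '' U) :=
    h₂.deriv_of_isOpen (isOpen_image_r₂ hU) (by simp)
  have e₁ := hasDerivAt_of_contDiffOn (isOpen_image_r₁ hU) d₁ ⟨p, hp, rfl⟩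
  have e₂ := hasDerivAt_of_contDiffOn (isOpen_image_r₂ hU) d₂ ⟨p, hp, rfl⟩
  have k₁ := HasGrad.comp e₁ (hasGrad_r₁ p)
  have k₂ := HasGrad.comp e₂ (hasGrad_r₂ p)
  have hh : HasGrad (fun q : ℝ × ℝ => q.1 / 2) (1 / 2) 0 p :=
    ((HasGrad.fst.mul (HasGrad.const (1 / 2))).congr
      (.of_forall fun q => by simp; ring)).congr_val (by simp) (by simp)
  rw [dU_congr_on hU hp fun q hq => (hasGrad_potential hU h₁ h₂ hq).dU_eq,
    dV_congr_on hU hp fun q hq => (hasGrad_potential hU h₁ h₂ hq).dV_eq,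
    (hasGrad_potential hU h₁ h₂ hp).dU_eq, ((hh.mul k₁).sub (hh.mul k₂)).dU_eq,
    (k₁.add k₂).dV_eq]
  field_simp
  ring

end B2

/-! ### Infinitesimal Miura transformations -/

namespace B2

variable {U : Set (ℝ × ℝ)} {p : ℝ × ℝ} {z : Jet}

/-- The change of the deformation of the flow of `f` under the infinitesimal Miura transformation
with coefficients `K`. -/
noncomputable def gaugeCoeff (f : Fin 2 → ℝ × ℝ → ℝ) (K : Fin 2 → Fin 2 → ℝ × ℝ → ℝ) :
    Fin 2 → Fin 5 → ℝ × ℝ → ℝ :=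
  ![![fun p => dU (f 1) p * K 0 1 p - dV (f 0) p * K 1 0 p,
      fun p => dV (f 0) p * K 0 0 p + dV (f 1) p * K 0 1 p - dV (f 0) p * K 1 1 p
        - dU (f 0) p * K 0 1 p,
      fun p => dU (dU (f 0)) p * K 0 0 p + dU (f 1) p * dV (K 0 0) p + dU (dU (f 1)) p * K 0 1 p
        - dV (f 0) p * dU (K 1 0) p,
      fun p => dV (f 0) p * dU (K 0 1) p + dV (dV (f 0)) p * K 0 0 p + dV (f 1) p * dV (K 0 1) p
        + dV (dV (f 1)) p * K 0 1 p - dV (f 0) p * dV (K 1 1) p - dU (f 0) p * dV (K 0 1) p,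
      fun p => dV (f 0) p * dU (K 0 0) p + 2 * dU (dV (f 0)) p * K 0 0 p
        + dV (f 1) p * dV (K 0 0) p + dU (f 1) p * dV (K 0 1) p + 2 * dU (dV (f 1)) p * K 0 1 p
        - dV (f 0) p * dV (K 1 0) p - dV (f 0) p * dU (K 1 1) p - dU (f 0) p * dV (K 0 0) p],
    ![fun p => dU (f 0) p * K 1 0 p + dU (f 1) p * K 1 1 p - dV (f 1) p * K 1 0 p
        - dU (f 1) p * K 0 0 p,
      fun p => dV (f 0) p * K 1 0 p - dU (f 1) p * K 0 1 p,
      fun p => dU (f 0) p * dU (K 1 0) p + dU (dU (f 0)) p * K 1 0 p + dU (f 1) p * dV (K 1 0) p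
        + dU (dU (f 1)) p * K 1 1 p - dV (f 1) p * dU (K 1 0) p - dU (f 1) p * dU (K 0 0) p,
      fun p => dV (f 0) p * dU (K 1 1) p + dV (dV (f 0)) p * K 1 0 p + dV (dV (f 1)) p * K 1 1 p
        - dU (f 1) p * dV (K 0 1) p,
      fun p => dV (f 0) p * dU (K 1 0) p + dU (f 0) p * dU (K 1 1) p
        + 2 * dU (dV (f 0)) p * K 1 0 p + dU (f 1) p * dV (K 1 1) p
        + 2 * dU (dV (f 1)) p * K 1 1 p - dV (f 1) p * dU (K 1 1) p - dU (f 1) p * dV (K 0 0) p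
        - dU (f 1) p * dU (K 0 1) p]]

/-- The derivatives of `gaugeCoeff` with respect to `u`. -/
noncomputable def gaugeCoeffDU (f : Fin 2 → ℝ × ℝ → ℝ) (K : Fin 2 → Fin 2 → ℝ × ℝ → ℝ) :
    Fin 2 → Fin 5 → ℝ × ℝ → ℝ :=
  ![![fun p => dU (f 1) p * dU (K 0 1) p + dU (dU (f 1)) p * K 0 1 p - dV (f 0) p * dU (K 1 0) p
        - dU (dV (f 0)) p * K 1 0 p,
      fun p => dV (f 0) p * dU (K 0 0) p + dU (dV (f 0)) p * K 0 0 p + dV (f 1) p * dU (K 0 1) p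
        + dU (dV (f 1)) p * K 0 1 p - dV (f 0) p * dU (K 1 1) p - dU (f 0) p * dU (K 0 1) p
        - dU (dV (f 0)) p * K 1 1 p - dU (dU (f 0)) p * K 0 1 p,
      fun p => dU (dU (f 0)) p * dU (K 0 0) p + dU (dU (dU (f 0))) p * K 0 0 p
        + dU (f 1) p * dU (dV (K 0 0)) p + dU (dU (f 1)) p * dV (K 0 0) p
        + dU (dU (f 1)) p * dU (K 0 1) p + dU (dU (dU (f 1))) p * K 0 1 p
        - dV (f 0) p * dU (dU (K 1 0)) p - dU (dV (f 0)) p * dU (K 1 0) p,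
      fun p => dV (f 0) p * dU (dU (K 0 1)) p + dV (dV (f 0)) p * dU (K 0 0) p
        + dU (dV (f 0)) p * dU (K 0 1) p + dU (dV (dV (f 0))) p * K 0 0 p
        + dV (f 1) p * dU (dV (K 0 1)) p + dV (dV (f 1)) p * dU (K 0 1) p
        + dU (dV (f 1)) p * dV (K 0 1) p + dU (dV (dV (f 1))) p * K 0 1 p
        - dV (f 0) p * dU (dV (K 1 1)) p - dU (f 0) p * dU (dV (K 0 1)) p
        - dU (dV (f 0)) p * dV (K 1 1) p - dU (dU (f 0)) p * dV (K 0 1) p,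
      fun p => dV (f 0) p * dU (dU (K 0 0)) p + 3 * dU (dV (f 0)) p * dU (K 0 0) p
        + 2 * dU (dU (dV (f 0))) p * K 0 0 p + dV (f 1) p * dU (dV (K 0 0)) p
        + dU (f 1) p * dU (dV (K 0 1)) p + dU (dV (f 1)) p * dV (K 0 0) p
        + 2 * dU (dV (f 1)) p * dU (K 0 1) p + dU (dU (f 1)) p * dV (K 0 1) p
        + 2 * dU (dU (dV (f 1))) p * K 0 1 p - dV (f 0) p * dU (dV (K 1 0)) p
        - dV (f 0) p * dU (dU (K 1 1)) p - dU (f 0) p * dU (dV (K 0 0)) p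
        - dU (dV (f 0)) p * dV (K 1 0) p - dU (dV (f 0)) p * dU (K 1 1) p
        - dU (dU (f 0)) p * dV (K 0 0) p],
    ![fun p => dU (f 0) p * dU (K 1 0) p + dU (dU (f 0)) p * K 1 0 p + dU (f 1) p * dU (K 1 1) p
        + dU (dU (f 1)) p * K 1 1 p - dV (f 1) p * dU (K 1 0) p - dU (f 1) p * dU (K 0 0) p
        - dU (dV (f 1)) p * K 1 0 p - dU (dU (f 1)) p * K 0 0 p,
      fun p => dV (f 0) p * dU (K 1 0) p + dU (dV (f 0)) p * K 1 0 p - dU (f 1) p * dU (K 0 1) p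
        - dU (dU (f 1)) p * K 0 1 p,
      fun p => dU (f 0) p * dU (dU (K 1 0)) p + 2 * dU (dU (f 0)) p * dU (K 1 0) p
        + dU (dU (dU (f 0))) p * K 1 0 p + dU (f 1) p * dU (dV (K 1 0)) p
        + dU (dU (f 1)) p * dV (K 1 0) p + dU (dU (f 1)) p * dU (K 1 1) p
        + dU (dU (dU (f 1))) p * K 1 1 p - dV (f 1) p * dU (dU (K 1 0)) p
        - dU (f 1) p * dU (dU (K 0 0)) p - dU (dV (f 1)) p * dU (K 1 0) p
        - dU (dU (f 1)) p * dU (K 0 0) p,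
      fun p => dV (f 0) p * dU (dU (K 1 1)) p + dV (dV (f 0)) p * dU (K 1 0) p
        + dU (dV (f 0)) p * dU (K 1 1) p + dU (dV (dV (f 0))) p * K 1 0 p
        + dV (dV (f 1)) p * dU (K 1 1) p + dU (dV (dV (f 1))) p * K 1 1 p
        - dU (f 1) p * dU (dV (K 0 1)) p - dU (dU (f 1)) p * dV (K 0 1) p,
      fun p => dV (f 0) p * dU (dU (K 1 0)) p + dU (f 0) p * dU (dU (K 1 1)) p
        + 3 * dU (dV (f 0)) p * dU (K 1 0) p + dU (dU (f 0)) p * dU (K 1 1) p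
        + 2 * dU (dU (dV (f 0))) p * K 1 0 p + dU (f 1) p * dU (dV (K 1 1)) p
        + dU (dV (f 1)) p * dU (K 1 1) p + dU (dU (f 1)) p * dV (K 1 1) p
        + 2 * dU (dU (dV (f 1))) p * K 1 1 p - dV (f 1) p * dU (dU (K 1 1)) p
        - dU (f 1) p * dU (dV (K 0 0)) p - dU (f 1) p * dU (dU (K 0 1)) p
        - dU (dU (f 1)) p * dV (K 0 0) p - dU (dU (f 1)) p * dU (K 0 1) p]]

/-- The derivatives of `gaugeCoeff` with respect to `v`. -/
noncomputable def gaugeCoeffDV (f : Fin 2 → ℝ × ℝ → ℝ) (K : Fin 2 → Fin 2 → ℝ × ℝ → ℝ) :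
    Fin 2 → Fin 5 → ℝ × ℝ → ℝ :=
  ![![fun p => dU (f 1) p * dV (K 0 1) p + dU (dV (f 1)) p * K 0 1 p - dV (f 0) p * dV (K 1 0) p
        - dV (dV (f 0)) p * K 1 0 p,
      fun p => dV (f 0) p * dV (K 0 0) p + dV (dV (f 0)) p * K 0 0 p + dV (f 1) p * dV (K 0 1) p
        + dV (dV (f 1)) p * K 0 1 p - dV (f 0) p * dV (K 1 1) p - dV (dV (f 0)) p * K 1 1 p
        - dU (f 0) p * dV (K 0 1) p - dU (dV (f 0)) p * K 0 1 p,
      fun p => dU (dU (f 0)) p * dV (K 0 0) p + dU (dU (dV (f 0))) p * K 0 0 p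
        + dU (f 1) p * dV (dV (K 0 0)) p + dU (dV (f 1)) p * dV (K 0 0) p
        + dU (dU (f 1)) p * dV (K 0 1) p + dU (dU (dV (f 1))) p * K 0 1 p
        - dV (f 0) p * dU (dV (K 1 0)) p - dV (dV (f 0)) p * dU (K 1 0) p,
      fun p => dV (f 0) p * dU (dV (K 0 1)) p + dV (dV (f 0)) p * dV (K 0 0) p
        + dV (dV (f 0)) p * dU (K 0 1) p + dV (dV (dV (f 0))) p * K 0 0 p
        + dV (f 1) p * dV (dV (K 0 1)) p + 2 * dV (dV (f 1)) p * dV (K 0 1) p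
        + dV (dV (dV (f 1))) p * K 0 1 p - dV (f 0) p * dV (dV (K 1 1)) p
        - dV (dV (f 0)) p * dV (K 1 1) p - dU (f 0) p * dV (dV (K 0 1)) p
        - dU (dV (f 0)) p * dV (K 0 1) p,
      fun p => dV (f 0) p * dU (dV (K 0 0)) p + dV (dV (f 0)) p * dU (K 0 0) p
        + dU (dV (f 0)) p * dV (K 0 0) p + 2 * dU (dV (dV (f 0))) p * K 0 0 p
        + dV (f 1) p * dV (dV (K 0 0)) p + dV (dV (f 1)) p * dV (K 0 0) p
        + dU (f 1) p * dV (dV (K 0 1)) p + 3 * dU (dV (f 1)) p * dV (K 0 1) p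
        + 2 * dU (dV (dV (f 1))) p * K 0 1 p - dV (f 0) p * dV (dV (K 1 0)) p
        - dV (f 0) p * dU (dV (K 1 1)) p - dV (dV (f 0)) p * dV (K 1 0) p
        - dV (dV (f 0)) p * dU (K 1 1) p - dU (f 0) p * dV (dV (K 0 0)) p],
    ![fun p => dU (f 0) p * dV (K 1 0) p + dU (dV (f 0)) p * K 1 0 p + dU (f 1) p * dV (K 1 1) p
        + dU (dV (f 1)) p * K 1 1 p - dV (f 1) p * dV (K 1 0) p - dV (dV (f 1)) p * K 1 0 p
        - dU (f 1) p * dV (K 0 0) p - dU (dV (f 1)) p * K 0 0 p,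
      fun p => dV (f 0) p * dV (K 1 0) p + dV (dV (f 0)) p * K 1 0 p - dU (f 1) p * dV (K 0 1) p
        - dU (dV (f 1)) p * K 0 1 p,
      fun p => dU (f 0) p * dU (dV (K 1 0)) p + dU (dV (f 0)) p * dU (K 1 0) p
        + dU (dU (f 0)) p * dV (K 1 0) p + dU (dU (dV (f 0))) p * K 1 0 p
        + dU (f 1) p * dV (dV (K 1 0)) p + dU (dV (f 1)) p * dV (K 1 0) p
        + dU (dU (f 1)) p * dV (K 1 1) p + dU (dU (dV (f 1))) p * K 1 1 p
        - dV (f 1) p * dU (dV (K 1 0)) p - dV (dV (f 1)) p * dU (K 1 0) p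
        - dU (f 1) p * dU (dV (K 0 0)) p - dU (dV (f 1)) p * dU (K 0 0) p,
      fun p => dV (f 0) p * dU (dV (K 1 1)) p + dV (dV (f 0)) p * dV (K 1 0) p
        + dV (dV (f 0)) p * dU (K 1 1) p + dV (dV (dV (f 0))) p * K 1 0 p
        + dV (dV (f 1)) p * dV (K 1 1) p + dV (dV (dV (f 1))) p * K 1 1 p
        - dU (f 1) p * dV (dV (K 0 1)) p - dU (dV (f 1)) p * dV (K 0 1) p,
      fun p => dV (f 0) p * dU (dV (K 1 0)) p + dV (dV (f 0)) p * dU (K 1 0) p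
        + dU (f 0) p * dU (dV (K 1 1)) p + 2 * dU (dV (f 0)) p * dV (K 1 0) p
        + dU (dV (f 0)) p * dU (K 1 1) p + 2 * dU (dV (dV (f 0))) p * K 1 0 p
        + dU (f 1) p * dV (dV (K 1 1)) p + 3 * dU (dV (f 1)) p * dV (K 1 1) p
        + 2 * dU (dV (dV (f 1))) p * K 1 1 p - dV (f 1) p * dU (dV (K 1 1)) p
        - dV (dV (f 1)) p * dU (K 1 1) p - dU (f 1) p * dV (dV (K 0 0)) p
        - dU (f 1) p * dU (dV (K 0 1)) p - dU (dV (f 1)) p * dV (K 0 0) p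
        - dU (dV (f 1)) p * dU (K 0 1) p]]

theorem hasGrad_gaugeCoeff {f : Fin 2 → ℝ × ℝ → ℝ} {K : Fin 2 → Fin 2 → ℝ × ℝ → ℝ} (hU : IsOpen U)
    (hf : ∀ i, ContDiffOn ℝ ∞ (f i) U) (hK : ∀ i j, ContDiffOn ℝ ∞ (K i j) U) (hp : p ∈ U)
    (i : Fin 2) (k : Fin 5) :
    HasGrad (gaugeCoeff f K i k) (gaugeCoeffDU f K i k p) (gaugeCoeffDV f K i k p) p := by
  have k0 := fun i j => hasGrad_of_contDiffOn (hK i j) hU hp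
  have k1 := fun i j => (hasGrad_of_contDiffOn (contDiffOn_dU (hK i j) hU) hU hp).congr_val rfl
    (dV_dU hU (hK i j) hp)
  have k2 := fun i j => hasGrad_of_contDiffOn (contDiffOn_dV (hK i j) hU) hU hp
  have fv := fun i => contDiffOn_dV (hf i) hU
  have f1 := fun i => (hasGrad_of_contDiffOn (contDiffOn_dU (hf i) hU) hU hp).congr_val rfl
    (dV_dU hU (hf i) hp)
  have f2 := fun i => hasGrad_of_contDiffOn (fv i) hU hp
  have f3 := fun i => (hasGrad_of_contDiffOn (contDiffOn_dU (contDiffOn_dU (hf i) hU) hU)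
    hU hp).congr_val rfl (dV_dU_dU (hf i) hU hp)
  have f4 := fun i => (hasGrad_of_contDiffOn (contDiffOn_dU (fv i) hU) hU hp).congr_val rfl
    (dV_dU_dV hU (hf i) hp)
  have f5 := fun i => hasGrad_of_contDiffOn (contDiffOn_dV (fv i) hU) hU hp
  fin_cases i <;> fin_cases k <;> simp only [gaugeCoeff, gaugeCoeffDU, gaugeCoeffDV, Fin.zero_eta,
    Fin.mk_one, Fin.reduceFinMk, Matrix.cons_val_zero, Matrix.cons_val_one, Matrix.cons_val] <;>
    (apply HasGrad.congr_val
     · repeat' first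
        | exact k0 _ _ | exact k1 _ _ | exact k2 _ _ | exact f1 _ | exact f2 _ | exact f3 _
        | exact f4 _ | exact f5 _ | exact HasGrad.const _ | with_reducible apply HasGrad.add
        | with_reducible apply HasGrad.sub | with_reducible apply HasGrad.mul
     all_goals ring)

theorem contDiffOn_gaugeCoeff {f : Fin 2 → ℝ × ℝ → ℝ} {K : Fin 2 → Fin 2 → ℝ × ℝ → ℝ}
    (hU : IsOpen U) (hf : ∀ i, ContDiffOn ℝ ∞ (f i) U) (hK : ∀ i j, ContDiffOn ℝ ∞ (K i j) U)
    (i : Fin 2) (k : Fin 5) : ContDiffOn ℝ ∞ (gaugeCoeff f K i k) U := by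
  have ku := fun i j => contDiffOn_dU (hK i j) hU
  have kv := fun i j => contDiffOn_dV (hK i j) hU
  have fu := fun i => contDiffOn_dU (hf i) hU
  have fv := fun i => contDiffOn_dV (hf i) hU
  have fuu := fun i => contDiffOn_dU (fu i) hU
  have fuv := fun i => contDiffOn_dU (fv i) hU
  have fvv := fun i => contDiffOn_dV (fv i) hU
  fin_cases i <;> fin_cases k <;> simp only [gaugeCoeff, Fin.zero_eta, Fin.mk_one,
    Fin.reduceFinMk, Matrix.cons_val_zero, Matrix.cons_val_one, Matrix.cons_val] <;> fun_prop

/-- This is where the formulas of `gaugeCoeff` come from: the density of the transformed flow gains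
the time derivative of `degOne (K i)`, while rewriting `f i` in the new variables costs its
differential applied to the shift. -/
theorem degTwo_gaugeCoeff {f : Fin 2 → ℝ × ℝ → ℝ} {K : Fin 2 → Fin 2 → ℝ × ℝ → ℝ} (hU : IsOpen U)
    (hf : ∀ i, ContDiffOn ℝ ∞ (f i) U) (hK : ∀ i j, ContDiffOn ℝ ∞ (K i j) U) (hz : base z ∈ U)
    (i : Fin 2) :
    degTwo (gaugeCoeff f K i) z = timeD (dispersionless f) (degOne (K i)) z
      - (dU (f i) (base z) * totalD (degOne (K 0)) z
        + dV (f i) (base z) * totalD (degOne (K 1)) z) := by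
  have e0 : ∀ k, jetOf (dispersionless f) z 0 k
      = dU (f k) (base z) * z 1 0 + dV (f k) (base z) * z 1 1 := fun k =>
    totalD_base (hf k) hU hz
  have e1 : ∀ k, jetOf (dispersionless f) z 1 k = _ := fun k => totalD_totalD_base hU (hf k) hz
  rw [timeD_eq, totalD_eq, totalD_eq, dirD_degOne hU (hK i) hz, dirD_degOne hU (hK 0) hz,
    dirD_degOne hU (hK 1) hz]
  simp only [e0, e1, shift]
  fin_cases i <;> simp [degTwo, gaugeCoeff] <;> ring

/-- The primary flow is one of its own symmetries, so `commCoeff_gaugeCoeff_comm` applies to it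
paired with any other symmetry. -/
theorem isWave_primaryFrob : IsWave U primaryFrob where
  smooth i := (contDiff_primaryFrob i).contDiffOn
  dV_one p _ := by rw [dV_primaryFrob_one, dU_primaryFrob_zero]
  dU_one p _ := by simp [dU_primaryFrob_one, dV_primaryFrob_zero]

set_option maxHeartbeats 4000000 in
/-- Infinitesimal Miura transformations act on commuting deformations. -/
theorem commCoeff_gaugeCoeff_comm {K : Fin 2 → Fin 2 → ℝ × ℝ → ℝ} {g g' : Fin 2 → ℝ × ℝ → ℝ}
    (hU : IsOpen U) (hK : ∀ i j, ContDiffOn ℝ ∞ (K i j) U) (hg : IsWave U g) (hg' : IsWave U g')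
    (hp : p ∈ U) (i : Fin 2) (j : Fin 10) :
    commCoeff g (gaugeCoeff g' K) i j p = commCoeff g' (gaugeCoeff g K) i j p := by
  have bu := fun i k => (hasGrad_gaugeCoeff hU hg.smooth hK hp i k).dU_eq
  have bv := fun i k => (hasGrad_gaugeCoeff hU hg.smooth hK hp i k).dV_eq
  have cu := fun i k => (hasGrad_gaugeCoeff hU hg'.smooth hK hp i k).dU_eq
  have cv := fun i k => (hasGrad_gaugeCoeff hU hg'.smooth hK hp i k).dV_eq
  fin_cases i <;> fin_cases j <;>
    simp only [commCoeff, totalCoeff, timeCoeff, bu, bv, cu, cv, Fin.zero_eta,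
      Fin.mk_one, Fin.reduceFinMk, Matrix.cons_val_zero,
      Matrix.cons_val_one, Matrix.cons_val] <;>
    simp only [gaugeCoeff, gaugeCoeffDU, gaugeCoeffDV, Matrix.cons_val_zero, Matrix.cons_val_one,
      Matrix.cons_val, hg.dU_one p hp, hg.dV_one p hp,
      hg.dU_dU_zero hU hp, hg.dU_dU_one hU hp, hg.dU_dV_one hU hp, hg.dV_dV_one hU hp,
      hg.dU_dU_dU_zero hU hp, hg.dU_dU_dV_zero hU hp, hg.dU_dU_dU_one hU hp,
      hg.dU_dU_dV_one hU hp, hg.dU_dV_dV_one hU hp, hg.dV_dV_dV_one hU hp, hg'.dU_one p hp,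
      hg'.dV_one p hp, hg'.dU_dU_zero hU hp, hg'.dU_dU_one hU hp, hg'.dU_dV_one hU hp,
      hg'.dV_dV_one hU hp, hg'.dU_dU_dU_zero hU hp, hg'.dU_dU_dV_zero hU hp,
      hg'.dU_dU_dU_one hU hp, hg'.dU_dU_dV_one hU hp, hg'.dU_dV_dV_one hU hp,
      hg'.dV_dV_dV_one hU hp] <;>
    ring

end B2

/-! ### The normalising Miura transformation -/

namespace B2

variable {U : Set (ℝ × ℝ)} {p : ℝ × ℝ} {z : Jet}

/-- The off-diagonal coefficient of the normalising Miura transformation. -/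
noncomputable def miuraOff (a : Fin 2 → Fin 5 → ℝ × ℝ → ℝ) (p : ℝ × ℝ) : ℝ :=
  -2 * p.1⁻¹ * (a 1 4 p + dU (a 0 0) p + p.1 ^ 2 / 4 * dV (a 0 1) p)

/-- The diagonal coefficient of the normalising Miura transformation. -/
noncomputable def miuraDiag (a : Fin 2 → Fin 5 → ℝ × ℝ → ℝ) (p : ℝ × ℝ) : ℝ :=
  -2 * p.1⁻¹ * (a 1 2 p + p.1 ^ 2 / 4 * a 1 3 p + p.1 ^ 2 / 4 * dV (a 0 0) p
    + p.1 ^ 2 / 4 * dU (a 0 1) p)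

/-- The coefficients of the Miura transformation which brings a deformation of the primary flow to
a form with vanishing `uₓₓ` and `vₓₓ` terms in the first density, no `uₓ vₓ` term in the second
density, and proportional `uₓ²` and `vₓ²` terms there. -/
noncomputable def miuraNormalizer (a : Fin 2 → Fin 5 → ℝ × ℝ → ℝ) : Fin 2 → Fin 2 → ℝ × ℝ → ℝ :=
  ![![fun p => miuraDiag a p - a 0 1 p, miuraOff a],
    ![fun p => p.1 ^ 2 / 4 * miuraOff a p + a 0 0 p, miuraDiag a]]

theorem contDiffOn_miuraOff {a : Fin 2 → Fin 5 → ℝ × ℝ → ℝ} (hU : IsOpen U)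
    (hu : ∀ p ∈ U, p.1 ≠ 0) (ha : ∀ i k, ContDiffOn ℝ ∞ (a i k) U) :
    ContDiffOn ℝ ∞ (miuraOff a) U := by
  have h1 := contDiffOn_dU (ha 0 0) hU
  have h2 := contDiffOn_dV (ha 0 1) hU
  unfold miuraOff
  fun_prop (disch := assumption)

theorem contDiffOn_miuraDiag {a : Fin 2 → Fin 5 → ℝ × ℝ → ℝ} (hU : IsOpen U)
    (hu : ∀ p ∈ U, p.1 ≠ 0) (ha : ∀ i k, ContDiffOn ℝ ∞ (a i k) U) :
    ContDiffOn ℝ ∞ (miuraDiag a) U := by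
  have h1 := contDiffOn_dV (ha 0 0) hU
  have h2 := contDiffOn_dU (ha 0 1) hU
  unfold miuraDiag
  fun_prop (disch := assumption)

theorem contDiffOn_miuraNormalizer {a : Fin 2 → Fin 5 → ℝ × ℝ → ℝ} (hU : IsOpen U)
    (hu : ∀ p ∈ U, p.1 ≠ 0) (ha : ∀ i k, ContDiffOn ℝ ∞ (a i k) U) (i j : Fin 2) :
    ContDiffOn ℝ ∞ (miuraNormalizer a i j) U := by
  have h1 := contDiffOn_miuraOff hU hu ha
  have h2 := contDiffOn_miuraDiag hU hu ha
  fin_cases i <;> fin_cases j <;> simp [miuraNormalizer] <;> fun_prop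

/-- The normalised deformation. -/
noncomputable def normalized (a : Fin 2 → Fin 5 → ℝ × ℝ → ℝ) : Fin 2 → Fin 5 → ℝ × ℝ → ℝ :=
  fun i k p => a i k p + gaugeCoeff primaryFrob (miuraNormalizer a) i k p

theorem contDiffOn_normalized {a : Fin 2 → Fin 5 → ℝ × ℝ → ℝ} (hU : IsOpen U)
    (hu : ∀ p ∈ U, p.1 ≠ 0) (ha : ∀ i k, ContDiffOn ℝ ∞ (a i k) U) (i : Fin 2) (k : Fin 5) :
    ContDiffOn ℝ ∞ (normalized a i k) U :=
  (ha i k).add (contDiffOn_gaugeCoeff hU isWave_primaryFrob.smooth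
    (contDiffOn_miuraNormalizer hU hu ha) i k)

/-- The algebraic conditions satisfied by normalised deformations of the primary flow. -/
structure IsNormalized (U : Set (ℝ × ℝ)) (a : Fin 2 → Fin 5 → ℝ × ℝ → ℝ) : Prop where
  smooth : ∀ i k, ContDiffOn ℝ ∞ (a i k) U
  uxx : ∀ p ∈ U, a 0 0 p = 0
  vxx : ∀ p ∈ U, a 0 1 p = 0
  vx_sq : ∀ p ∈ U, a 1 3 p = -4 * a 1 2 p * p.1⁻¹ ^ 2
  ux_vx : ∀ p ∈ U, a 1 4 p = 0

/-- The `uₓₓ` and `vₓₓ` conditions fix `K₁₀` and `K₀₀` in terms of `K₀₁` and `K₁₁`. After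
substitution the derivatives of `K₀₁` and `K₁₁` cancel from the two remaining conditions, each of
which becomes `(u/2) K` plus known terms. Division by `u` gives `miuraOff` and `miuraDiag`. -/
theorem isNormalized_normalized {a : Fin 2 → Fin 5 → ℝ × ℝ → ℝ} (hU : IsOpen U)
    (hu : ∀ p ∈ U, p.1 ≠ 0) (ha : ∀ i k, ContDiffOn ℝ ∞ (a i k) U) :
    IsNormalized U (normalized a) := by
  have hA := fun i k p (hp : p ∈ U) => hasGrad_of_contDiffOn (ha i k) hU hp
  have g1 := fun p (hp : p ∈ U) => hasGrad_of_contDiffOn (contDiffOn_miuraOff hU hu ha) hU hp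
  have g2 := fun p (hp : p ∈ U) => hasGrad_of_contDiffOn (contDiffOn_miuraDiag hU hu ha) hU hp
  have e1 := fun p hp => (g2 p hp).sub (hA 0 1 p hp)
  have e2 := fun p hp => ((hasGrad_sq_div p).mul (g1 p hp)).add (hA 0 0 p hp)
  refine ⟨contDiffOn_normalized hU hu ha, ?_, ?_, ?_, ?_⟩ <;> intro p hp <;> have h0 := hu p hp <;>
    simp only [normalized, gaugeCoeff, dU_primaryFrob_zero, dV_primaryFrob_zero,
      dU_primaryFrob_one, dV_primaryFrob_one, dU_const, dV_const, dU_sq_div, miuraNormalizer,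
      Matrix.cons_val_zero, Matrix.cons_val_one, Matrix.cons_val, (e1 p hp).dU_eq,
      (e1 p hp).dV_eq, (e2 p hp).dU_eq, (e2 p hp).dV_eq]
  · ring
  · ring
  · simp only [miuraDiag]; field_simp; ring
  · simp only [miuraOff]; field_simp; ring

/-! ### The quadratic test symmetry -/

/-- The symmetry `u_τ = ∂ₓ (u v)`, `v_τ = ∂ₓ (v² / 2 + u⁴ / 16)` of the primary flow. -/
noncomputable def quadraticSymmetry : Fin 2 → ℝ × ℝ → ℝ :=
  ![fun p => p.1 * p.2, fun p => 1 / 2 * p.2 ^ 2 + 1 / 16 * p.1 ^ 4]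

theorem hasGrad_quadraticSymmetry_zero : HasGrad (quadraticSymmetry 0) p.2 p.1 p :=
  (HasGrad.fst.mul HasGrad.snd).congr_val (by ring) (by ring)

theorem hasGrad_quadraticSymmetry_one : HasGrad (quadraticSymmetry 1) (p.1 ^ 3 / 4) p.2 p :=
  (((HasGrad.const _).mul (HasGrad.snd.pow 2)).add
    ((HasGrad.const _).mul (HasGrad.fst.pow 4))).congr_val
    (by push_cast; ring) (by push_cast; ring)

theorem isWave_quadraticSymmetry : IsWave U quadraticSymmetry where
  smooth i := by
    refine ContDiff.contDiffOn ?_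
    fin_cases i <;> simp [quadraticSymmetry] <;> fun_prop
  dV_one p _ := by
    rw [hasGrad_quadraticSymmetry_one.dV_eq, hasGrad_quadraticSymmetry_zero.dU_eq]
  dU_one p _ := by
    rw [hasGrad_quadraticSymmetry_one.dU_eq, hasGrad_quadraticSymmetry_zero.dV_eq]; ring

theorem commCoeff_add {f : Fin 2 → ℝ × ℝ → ℝ} {b b' : Fin 2 → Fin 5 → ℝ × ℝ → ℝ}
    (hU : IsOpen U) (hb : ∀ i k, ContDiffOn ℝ ∞ (b i k) U) (hb' : ∀ i k, ContDiffOn ℝ ∞ (b' i k) U)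
    (hp : p ∈ U) (i : Fin 2) (j : Fin 10) :
    commCoeff f (fun i k p => b i k p + b' i k p) i j p
      = commCoeff f b i j p + commCoeff f b' i j p := by
  have G := fun i k => (hasGrad_of_contDiffOn (hb i k) hU hp).add
    (hasGrad_of_contDiffOn (hb' i k) hU hp)
  fin_cases j <;>
    simp [commCoeff, totalCoeff, timeCoeff, (G _ _).dU_eq, (G _ _).dV_eq] <;> ring

/-- Integrability provides an extension of the quadratic symmetry to the normalised deformation. -/
theorem exists_commCoeff_normalized {a : Fin 2 → Fin 5 → ℝ × ℝ → ℝ} (hU : IsOpen U)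
    (hu : ∀ p ∈ U, p.1 ≠ 0) (ha : ∀ i k, ContDiffOn ℝ ∞ (a i k) U)
    (h : IsIntegrable U primaryFrob a) :
    ∃ b : Fin 2 → Fin 5 → ℝ × ℝ → ℝ, (∀ i k, ContDiffOn ℝ ∞ (b i k) U) ∧
      ∀ i j, ∀ p ∈ U, commCoeff primaryFrob b i j p
        = commCoeff quadraticSymmetry (normalized a) i j p := by
  have hw : IsWave U quadraticSymmetry := isWave_quadraticSymmetry
  obtain ⟨b, hb, hc⟩ := h _ ((isSymmetry_primaryFrob_iff hU).2 hw)
  have hK := contDiffOn_miuraNormalizer hU hu ha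
  have h1 := ((commuteUpToOrderTwo_iff hU isWave_primaryFrob.smooth hw.smooth ha hb).1 hc).2
  have hs := contDiffOn_gaugeCoeff hU hw.smooth hK
  -- The extension is transformed by the same Miura transformation as the primary flow; the two
  -- gauge contributions to the commutator cancel.
  refine ⟨fun i k p => b i k p + gaugeCoeff quadraticSymmetry (miuraNormalizer a) i k p,
    fun i k => (hb i k).add (hs i k), fun i j p hp => ?_⟩
  unfold normalized
  rw [commCoeff_add hU hb hs hp, commCoeff_add hU ha
    (contDiffOn_gaugeCoeff hU isWave_primaryFrob.smooth hK) hp, h1 i j p hp,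
    commCoeff_gaugeCoeff_comm hU hK isWave_primaryFrob hw hp]

end B2

/-! ### Integrability conditions from the quadratic symmetry -/

namespace B2

variable {U : Set (ℝ × ℝ)} {p : ℝ × ℝ} {z : Jet}

theorem dU_snd : dU (fun p : ℝ × ℝ => p.2) = fun _ => 0 := funext fun _ => HasGrad.snd.dU_eq

theorem dV_snd : dV (fun p : ℝ × ℝ => p.2) = fun _ => 1 := funext fun _ => HasGrad.snd.dV_eq

theorem dU_fst : dU (fun p : ℝ × ℝ => p.1) = fun _ => 1 := funext fun _ => HasGrad.fst.dU_eq

theorem dV_fst : dV (fun p : ℝ × ℝ => p.1) = fun _ => 0 := funext fun _ => HasGrad.fst.dV_eq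

theorem dU_quadraticSymmetry_zero : dU (quadraticSymmetry 0) = fun p => p.2 :=
  funext fun _ => hasGrad_quadraticSymmetry_zero.dU_eq

theorem dV_quadraticSymmetry_zero : dV (quadraticSymmetry 0) = fun p => p.1 :=
  funext fun _ => hasGrad_quadraticSymmetry_zero.dV_eq

theorem dU_quadraticSymmetry_one : dU (quadraticSymmetry 1) = fun p => p.1 ^ 3 / 4 :=
  funext fun _ => hasGrad_quadraticSymmetry_one.dU_eq

theorem dV_quadraticSymmetry_one : dV (quadraticSymmetry 1) = fun p => p.2 :=
  funext fun _ => hasGrad_quadraticSymmetry_one.dV_eq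

theorem hasGrad_cube_div (p : ℝ × ℝ) :
    HasGrad (fun q : ℝ × ℝ => q.1 ^ 3 / 4) (3 * (p.1 ^ 2 / 4)) 0 p :=
  (((HasGrad.fst.pow 3).mul (.const (1 / 4))).congr
    (.of_forall fun _ => by simp; ring)).congr_val (by push_cast; ring) (by ring)

theorem dU_cube_div : dU (fun p : ℝ × ℝ => p.1 ^ 3 / 4) = fun p => 3 * (p.1 ^ 2 / 4) :=
  funext fun _ => (hasGrad_cube_div _).dU_eq

theorem dU_const_mul_sq_div :
    dU (fun p : ℝ × ℝ => 3 * (p.1 ^ 2 / 4)) = fun p => 3 * (p.1 / 2) :=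
  funext fun _ => ((HasGrad.const 3).mul (hasGrad_sq_div _)).dU_eq.trans (by ring)

theorem hasGrad_inv (h : p.1 ≠ 0) : HasGrad (fun q : ℝ × ℝ => q.1⁻¹) (-p.1⁻¹ ^ 2) 0 p :=
  (HasGrad.fst.inv h).congr_val (by simp) (by ring)

theorem hasGrad_inv_sq (h : p.1 ≠ 0) :
    HasGrad (fun q : ℝ × ℝ => q.1⁻¹ ^ 2) (-2 * p.1⁻¹ ^ 3) 0 p :=
  ((HasGrad.fst.inv h).pow 2).congr_val (by simp; field_simp) (by ring)

/-- The right-hand sides of the twenty equations. Normalisation removes four of the ten coefficients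
of `a` together with their derivatives. -/
theorem commCoeff_quadraticSymmetry {a : Fin 2 → Fin 5 → ℝ × ℝ → ℝ} (hU : IsOpen U)
    (hu : ∀ p ∈ U, p.1 ≠ 0) (ha : IsNormalized U a) (hp : p ∈ U) :
    (fun j => commCoeff quadraticSymmetry a 0 j p) =
      ![p.1 * a 1 0 p, p.1 * a 1 1 p,
        p.1 * dU (a 1 0) p + 2 * p.1 * a 1 2 p - p.1 ^ 3 / 4 * a 0 4 p,
        p.1 * dV (a 1 0) p - p.1 ^ 3 / 2 * a 0 3 p,
        p.1 * dU (a 1 1) p - 2 * p.1 * a 0 2 p,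
        p.1 * dV (a 1 1) p - p.1 * a 0 4 p - 8 * a 1 2 p / p.1,
        p.1 * dU (a 1 2) p - p.1 ^ 3 / 4 * dV (a 0 2) p - 3 / 4 * p.1 ^ 2 * a 0 4 p,
        p.1 * dV (a 1 2) p - p.1 * dU (a 0 2) p - p.1 ^ 3 / 4 * dV (a 0 4) p - 4 * a 0 2 p
          - 3 / 2 * p.1 ^ 2 * a 0 3 p,
        8 * a 1 2 p / p.1 ^ 2 - 4 * dU (a 1 2) p / p.1 - p.1 ^ 3 / 4 * dV (a 0 3) p
          - p.1 * dU (a 0 4) p - 3 * a 0 4 p,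
        -4 * dV (a 1 2) p / p.1 - p.1 * dU (a 0 3) p - 2 * a 0 3 p] ∧
    (fun j => commCoeff quadraticSymmetry a 1 j p) =
      ![-(p.1 ^ 3 / 4) * a 1 1 p, -p.1 * a 1 0 p,
        p.1 ^ 3 / 2 * a 0 2 p - p.1 ^ 3 / 4 * dV (a 1 0) p - 9 / 4 * p.1 ^ 2 * a 1 1 p,
        p.1 ^ 3 / 4 * a 0 4 p - p.1 * dU (a 1 0) p - 3 * a 1 0 p + 2 * p.1 * a 1 2 p,
        p.1 ^ 3 / 4 * a 0 4 p - p.1 ^ 3 / 4 * dV (a 1 1) p - 3 * a 1 0 p - 2 * p.1 * a 1 2 p,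
        p.1 ^ 3 / 2 * a 0 3 p - p.1 * dU (a 1 1) p - 3 * a 1 1 p,
        p.1 ^ 3 / 4 * dU (a 0 2) p - p.1 ^ 3 / 4 * dV (a 1 2) p - 3 / 2 * p.1 * a 1 1 p,
        p.1 ^ 3 / 4 * dV (a 0 2) p + p.1 ^ 3 / 4 * dU (a 0 4) p - p.1 * dU (a 1 2) p
          + 2 * a 1 2 p,
        p.1 ^ 3 / 4 * dU (a 0 3) p + p.1 ^ 3 / 4 * dV (a 0 4) p + p.1 * dV (a 1 2) p,
        p.1 ^ 3 / 4 * dV (a 0 3) p + 4 * dU (a 1 2) p / p.1] := by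
  have h0 := hu p hp
  have g := ((HasGrad.const (-4)).mul (hasGrad_of_contDiffOn (ha.smooth 1 2) hU hp)).mul
    (hasGrad_inv_sq h0)
  have e3u := (dU_congr_on hU hp ha.vx_sq).trans g.dU_eq
  have e3v := (dV_congr_on hU hp ha.vx_sq).trans g.dV_eq
  have e0u := dU_eq_zero_of_eqOn (p := p) hU ha.uxx hp
  have e0v := dV_eq_zero_of_eqOn (p := p) hU ha.uxx hp
  have e1u := dU_eq_zero_of_eqOn (p := p) hU ha.vxx hp
  have e1v := dV_eq_zero_of_eqOn (p := p) hU ha.vxx hp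
  have e4u := dU_eq_zero_of_eqOn (p := p) hU ha.ux_vx hp
  have e4v := dV_eq_zero_of_eqOn (p := p) hU ha.ux_vx hp
  constructor <;> funext j <;> fin_cases j <;>
    simp [commCoeff, totalCoeff, timeCoeff, dU_quadraticSymmetry_zero, dV_quadraticSymmetry_zero,
      dU_quadraticSymmetry_one, dV_quadraticSymmetry_one, dU_const, dV_const, dU_cube_div, dU_fst,
      dV_fst, dU_snd, dV_snd, dU_const_mul_sq_div, ha.uxx p hp, ha.vxx p hp, ha.ux_vx p hp,
      ha.vx_sq p hp, e0u, e0v, e1u, e1v, e3u, e3v, e4u, e4v] <;>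
    first | done | (field_simp; done) | (field_simp; ring)

/-- The conditions on a normalised deformation which express integrability. -/
structure IsReduced (U : Set (ℝ × ℝ)) (a : Fin 2 → Fin 5 → ℝ × ℝ → ℝ) : Prop where
  dV_uxx : ∀ p ∈ U, dV (a 1 0) p = dU (a 1 1) p
  dU_uxx : ∀ p ∈ U, dU (a 1 0) p = a 1 0 p / p.1 + p.1 ^ 2 / 4 * dV (a 1 1) p
  ux_sq : ∀ p ∈ U, a 0 2 p = -(3 / 4) * dU (a 1 1) p
  vx_sq : ∀ p ∈ U, a 0 3 p = dU (a 1 1) p / p.1 ^ 2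
  ux_vx : ∀ p ∈ U, a 0 4 p = -(1 / 2) * dV (a 1 1) p
  ux_sq' : ∀ p ∈ U, a 1 2 p = p.1 ^ 2 / 8 * dV (a 1 1) p - a 1 0 p / (4 * p.1)

/-- Twenty equations constrain ten unknowns `b`. The eliminations of the homogeneous uniqueness
proof, now with a right-hand side, express `b` through `a`; what is left over are conditions on `a`
alone. -/
theorem isReduced_of_commCoeff {a b : Fin 2 → Fin 5 → ℝ × ℝ → ℝ} (hU : IsOpen U)
    (hu : ∀ p ∈ U, p.1 ≠ 0) (ha : IsNormalized U a) (hb : ∀ i k, ContDiffOn ℝ ∞ (b i k) U)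
    (h : ∀ i j, ∀ p ∈ U, commCoeff primaryFrob b i j p = commCoeff quadraticSymmetry a i j p) :
    IsReduced U a := by
  have E1 := fun p hp j => (congrFun (commCoeff_primaryFrob b p).1 j).symm.trans
    ((h 0 j p hp).trans (congrFun (commCoeff_quadraticSymmetry hU hu ha hp).1 j))
  have E2 := fun p hp j => (congrFun (commCoeff_primaryFrob b p).2 j).symm.trans
    ((h 1 j p hp).trans (congrFun (commCoeff_quadraticSymmetry hU hu ha hp).2 j))
  have G := fun i k p (hp : p ∈ U) => hasGrad_of_contDiffOn (hb i k) hU hp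
  have A := fun i k p (hp : p ∈ U) => hasGrad_of_contDiffOn (ha.smooth i k) hU hp
  have c3 : ∀ p ∈ U, b 1 0 p = p.1 ^ 2 / 4 * b 0 1 p + p.1 * a 1 0 p := fun p hp => by
    have := E1 p hp 0; simp at this; linear_combination this
  have c4 : ∀ p ∈ U, b 1 1 p = b 0 0 p + p.1 * a 1 1 p := fun p hp => by
    have := E1 p hp 1; simp at this; linear_combination this
  have c3g := fun p hp => ((hasGrad_sq_div p).mul (G 0 1 p hp)).add (HasGrad.fst.mul (A 1 0 p hp))
  have c3u := fun p hp => (dU_congr_on hU hp c3).trans (c3g p hp).dU_eq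
  have c3v := fun p hp => (dV_congr_on hU hp c3).trans (c3g p hp).dV_eq
  have c4g := fun p hp => (G 0 0 p hp).add (HasGrad.fst.mul (A 1 1 p hp))
  have c4u := fun p hp => (dU_congr_on hU hp c4).trans (c4g p hp).dU_eq
  have c4v := fun p hp => (dV_congr_on hU hp c4).trans (c4g p hp).dV_eq
  have b4 : ∀ p ∈ U, b 0 1 p = 4 * (a 1 0 p * p.1⁻¹) := fun p hp => by
    have h0 := hu p hp
    have h1 := E1 p hp 2
    have h2 := E2 p hp 4
    have h3 := E1 p hp 5
    have h4 := E2 p hp 3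
    simp [c3u p hp, c4v p hp] at h1 h2 h3 h4
    refine mul_left_cancel₀ h0 ?_
    linear_combination (norm := (field_simp; ring)) -2 / 3 * (h1 + h2 + p.1 ^ 2 / 4 * h3 + h4)
  have b4g := fun p hp => (HasGrad.const 4).mul
    ((A 1 0 p hp).mul (hasGrad_inv (hu p hp)))
  have b4u := fun p hp => (dU_congr_on hU hp b4).trans (b4g p hp).dU_eq
  have b4v := fun p hp => (dV_congr_on hU hp b4).trans (b4g p hp).dV_eq
  have b3 : ∀ p ∈ U, b 0 0 p = p.1 * a 1 1 p := fun p hp => by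
    have h0 := hu p hp
    have h1 := E1 p hp 3
    have h2 := E2 p hp 5
    have h3 := E1 p hp 4
    have h4 := E2 p hp 2
    simp [c3v p hp, c4u p hp, c4 p hp, b4v p hp] at h1 h2 h3 h4
    refine mul_left_cancel₀ h0 ?_
    linear_combination (norm := (field_simp; ring))
      -2 / 3 * (h4 + p.1 ^ 2 / 4 * h3) - p.1 ^ 2 / 6 * (h1 + h2)
  have b3g := fun p hp => HasGrad.fst.mul (A 1 1 p hp)
  have b3u := fun p hp => (dU_congr_on hU hp b3).trans (b3g p hp).dU_eq
  have b3v := fun p hp => (dV_congr_on hU hp b3).trans (b3g p hp).dV_eq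
  -- With `b₀₀` and `b₀₁` known, adding two equations removes `b₁₂`, `b₀₄` and leaves the first
  -- relation free of `b`.
  have qu : ∀ p ∈ U, dU (a 1 0) p = a 1 0 p / p.1 + p.1 ^ 2 / 4 * dV (a 1 1) p := fun p hp => by
    have h0 := hu p hp
    have h1 := E1 p hp 2
    have h2 := E2 p hp 4
    simp [c3u p hp, c4v p hp, b4u p hp, b3v p hp, b4 p hp] at h1 h2
    refine mul_left_cancel₀ h0 ?_
    linear_combination (norm := (field_simp; ring)) (h1 + h2) / 2
  have qv : ∀ p ∈ U, dV (a 1 0) p = dU (a 1 1) p := fun p hp => by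
    have h0 := hu p hp
    have h1 := E1 p hp 3
    have h2 := E2 p hp 5
    simp [c3v p hp, c4u p hp, b4v p hp, b3u p hp, b3 p hp] at h1 h2
    refine mul_left_cancel₀ h0 ?_
    linear_combination (norm := (field_simp; ring)) (h1 + h2) / 2
  have b7 : ∀ p ∈ U, b 0 4 p = 2 * b 1 3 p + p.1 * a 0 4 p + 8 * (a 1 2 p * p.1⁻¹) :=
    fun p hp => by
    have h0 := hu p hp
    have h1 := E1 p hp 5
    simp [c4v p hp, b4u p hp, b3v p hp, qu p hp] at h1
    linear_combination (norm := (field_simp; ring)) -h1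
  have c7 : ∀ p ∈ U, b 1 4 p = p.1 ^ 2 / 2 * b 0 3 p + a 1 1 p - p.1 ^ 3 / 2 * a 0 3 p :=
    fun p hp => by
    have h0 := hu p hp
    have h1 := E1 p hp 3
    simp [c3v p hp, b4v p hp, b3u p hp, qv p hp] at h1
    linear_combination (norm := (field_simp; ring)) h1
  have b5 : ∀ p ∈ U, b 0 2 p
      = p.1 ^ 2 / 4 * b 0 3 p + 3 / 2 * a 1 1 p + p.1 * a 0 2 p - p.1 ^ 3 / 4 * a 0 3 p :=
    fun p hp => by
    have h0 := hu p hp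
    have h1 := E1 p hp 4
    simp [c4u p hp, b4v p hp, b3u p hp, qv p hp, c7 p hp] at h1
    linear_combination (norm := (field_simp; ring)) -h1 / 2
  have c5 : ∀ p ∈ U, b 1 2 p
      = p.1 ^ 2 / 4 * b 1 3 p + 3 / 2 * a 1 0 p + 2 * (p.1 * a 1 2 p) := fun p hp => by
    have h0 := hu p hp
    have h1 := E1 p hp 2
    simp [c3u p hp, b4u p hp, b3v p hp, b4 p hp, qu p hp, b7 p hp] at h1
    linear_combination (norm := (field_simp; ring)) h1 / 2
  have c6 : ∀ p ∈ U, b 1 3 p = 1 / 2 * (p.1 * a 0 4 p) - a 1 0 p * p.1⁻¹ ^ 2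
      - 4 * (a 1 2 p * p.1⁻¹) := fun p hp => by
    have h0 := hu p hp
    have e1 := (dU_congr_on hU hp c5).trans (((((hasGrad_sq_div p).mul (G 1 3 p hp)).add
      ((HasGrad.const _).mul (A 1 0 p hp))).add
      ((HasGrad.const _).mul (HasGrad.fst.mul (A 1 2 p hp))))).dU_eq
    have e2 := (dV_congr_on hU hp b5).trans ((((((hasGrad_sq_div p).mul (G 0 3 p hp)).add
      ((HasGrad.const _).mul (A 1 1 p hp))).add (HasGrad.fst.mul (A 0 2 p hp))).sub
      ((hasGrad_cube_div p).mul (A 0 3 p hp)))).dV_eq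
    have h1 := E1 p hp 6
    have h2 := E2 p hp 9
    simp [e1, e2, b4 p hp, b7 p hp, qu p hp] at h1 h2
    refine mul_left_cancel₀ h0 ?_
    linear_combination (norm := (field_simp; ring)) -2 * (h1 + p.1 ^ 2 / 4 * h2)
  have b6 : ∀ p ∈ U, b 0 3 p = 2 * (a 0 2 p * p.1⁻¹) + 3 / 2 * (p.1 * a 0 3 p) := fun p hp => by
    have h0 := hu p hp
    have e1 := (dV_congr_on hU hp c5).trans (((((hasGrad_sq_div p).mul (G 1 3 p hp)).add
      ((HasGrad.const _).mul (A 1 0 p hp))).add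
      ((HasGrad.const _).mul (HasGrad.fst.mul (A 1 2 p hp))))).dV_eq
    have e2 := (dU_congr_on hU hp b5).trans ((((((hasGrad_sq_div p).mul (G 0 3 p hp)).add
      ((HasGrad.const _).mul (A 1 1 p hp))).add (HasGrad.fst.mul (A 0 2 p hp))).sub
      ((hasGrad_cube_div p).mul (A 0 3 p hp)))).dU_eq
    have h1 := E2 p hp 6
    have h2 := E1 p hp 9
    simp [e1, e2, c4 p hp, b3 p hp, c7 p hp, qv p hp] at h1 h2
    refine mul_left_cancel₀ (pow_ne_zero 3 h0) ?_
    linear_combination (norm := (field_simp; ring)) -8 * (h1 + p.1 ^ 4 / 16 * h2)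
  -- With `b₀₃` and `b₁₃` now known, the remaining unknowns are rewritten in terms of `a` only, so
  -- that they can be differentiated.
  have c7' : ∀ p ∈ U, b 1 4 p = a 1 1 p + p.1 * a 0 2 p + p.1 ^ 3 / 4 * a 0 3 p :=
    fun p hp => by
    have h0 := hu p hp
    rw [c7 p hp, b6 p hp]; field_simp; ring
  have b5' : ∀ p ∈ U, b 0 2 p = 3 / 2 * a 1 1 p + 3 / 2 * (p.1 * a 0 2 p)
      + 1 / 2 * (p.1 ^ 3 / 4 * a 0 3 p) := fun p hp => by
    have h0 := hu p hp
    rw [b5 p hp, b6 p hp]; field_simp; ring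
  have b7' : ∀ p ∈ U, b 0 4 p = 2 * (p.1 * a 0 4 p) - 2 * (a 1 0 p * p.1⁻¹ ^ 2) := fun p hp => by
    have h0 := hu p hp
    rw [b7 p hp, c6 p hp]; field_simp; ring
  have c5' : ∀ p ∈ U, b 1 2 p = 5 / 4 * a 1 0 p + 1 / 2 * (p.1 ^ 3 / 4 * a 0 4 p)
      + p.1 * a 1 2 p := fun p hp => by
    have h0 := hu p hp
    rw [c5 p hp, c6 p hp]; field_simp; ring
  have c7g := fun p hp => ((A 1 1 p hp).add (HasGrad.fst.mul (A 0 2 p hp))).add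
    ((hasGrad_cube_div p).mul (A 0 3 p hp))
  have c7u := fun p hp => (dU_congr_on hU hp c7').trans (c7g p hp).dU_eq
  have c7v := fun p hp => (dV_congr_on hU hp c7').trans (c7g p hp).dV_eq
  have b5g := fun p hp => (((HasGrad.const (3 / 2)).mul (A 1 1 p hp)).add
    ((HasGrad.const (3 / 2)).mul (HasGrad.fst.mul (A 0 2 p hp)))).add
    ((HasGrad.const (1 / 2)).mul ((hasGrad_cube_div p).mul (A 0 3 p hp)))
  have b5u := fun p hp => (dU_congr_on hU hp b5').trans (b5g p hp).dU_eq
  have b5v := fun p hp => (dV_congr_on hU hp b5').trans (b5g p hp).dV_eq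
  have b7g := fun p hp => ((HasGrad.const 2).mul (HasGrad.fst.mul (A 0 4 p hp))).sub
    ((HasGrad.const 2).mul ((A 1 0 p hp).mul (hasGrad_inv_sq (hu p hp))))
  have b7u := fun p hp => (dU_congr_on hU hp b7').trans (b7g p hp).dU_eq
  have b7v := fun p hp => (dV_congr_on hU hp b7').trans (b7g p hp).dV_eq
  have c5g := fun p hp => (((HasGrad.const (5 / 4)).mul (A 1 0 p hp)).add
    ((HasGrad.const (1 / 2)).mul ((hasGrad_cube_div p).mul (A 0 4 p hp)))).add
    (HasGrad.fst.mul (A 1 2 p hp))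
  have c5u := fun p hp => (dU_congr_on hU hp c5').trans (c5g p hp).dU_eq
  have c5v := fun p hp => (dV_congr_on hU hp c5').trans (c5g p hp).dV_eq
  have y : ∀ p ∈ U, a 0 2 p + p.1 ^ 2 / 4 * a 0 3 p = -(1 / 2) * dU (a 1 1) p := fun p hp => by
    have h0 := hu p hp
    have h1 := E1 p hp 7
    have h2 := E2 p hp 6
    simp [c5v p hp, c7u p hp, b5u p hp, b7v p hp, b6 p hp, c4 p hp, b3 p hp, c7' p hp,
      qv p hp] at h1 h2
    linear_combination (norm := (field_simp; ring)) (h1 - 4 / p.1 ^ 2 * h2) / 2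
  have w : ∀ p ∈ U, a 0 4 p = -(1 / 2) * dV (a 1 1) p := fun p hp => by
    have h0 := hu p hp
    have h1 := E1 p hp 6
    have h2 := E2 p hp 7
    simp [c5u p hp, c7v p hp, b5v p hp, b7u p hp, c6 p hp, b4 p hp, b7' p hp, qu p hp] at h1 h2
    refine mul_left_cancel₀ (pow_ne_zero 2 h0) ?_
    linear_combination (norm := (field_simp; ring)) 2 * (h1 - h2)
  have S1 := fun p (hp : p ∈ U) =>
    hasGrad_of_contDiffOn (contDiffOn_dU (ha.smooth 1 1) hU) hU hp
  have S2 := fun p (hp : p ∈ U) =>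
    hasGrad_of_contDiffOn (contDiffOn_dV (ha.smooth 1 1) hU) hU hp
  -- Equality of the mixed derivatives of `a₁₀`, computed from `qv` and from `qu`.
  have suu : ∀ p ∈ U, dU (dU (a 1 1)) p = dU (a 1 1) p / p.1 + p.1 ^ 2 / 4 * dV (dV (a 1 1)) p :=
    fun p hp => by
    have h0 := hu p hp
    have e1 := dU_dV (ha.smooth 1 0) hU hp
    rw [dU_congr_on hU hp qv, dV_congr_on hU hp (f := fun p => a 1 0 p * p.1⁻¹
      + p.1 ^ 2 / 4 * dV (a 1 1) p) fun p hp => by rw [qu p hp, div_eq_mul_inv],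
      (((A 1 0 p hp).mul (hasGrad_inv h0)).add ((hasGrad_sq_div p).mul (S2 p hp))).dV_eq,
      qv p hp] at e1
    rw [e1]; ring
  have yg := fun p hp => (A 0 2 p hp).add ((hasGrad_sq_div p).mul (A 0 3 p hp))
  have yu := fun p hp => (yg p hp).dU_eq.symm.trans ((dU_congr_on hU hp y).trans
    ((HasGrad.const _).mul (S1 p hp)).dU_eq)
  have yv := fun p hp => (yg p hp).dV_eq.symm.trans ((dV_congr_on hU hp y).trans
    ((HasGrad.const _).mul (S1 p hp)).dV_eq)
  have wu := fun p hp => (dU_congr_on hU hp w).trans ((HasGrad.const _).mul (S2 p hp)).dU_eq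
  have wv := fun p hp => (dV_congr_on hU hp w).trans ((HasGrad.const _).mul (S2 p hp)).dV_eq
  -- Relation `y` determines only a combination of `a₀₂` and `a₀₃`. Its derivative in `u`, reduced
  -- by `suu`, removes the derivatives from one further equation and separates the two.
  have hx : ∀ p ∈ U, a 0 3 p = dU (a 1 1) p / p.1 ^ 2 := fun p hp => by
    have h0 := hu p hp
    have h1 := E1 p hp 7
    have h2 := yu p hp
    simp [c5v p hp, c7u p hp, b5u p hp, b7v p hp, b6 p hp, c4 p hp, b3 p hp, c7' p hp,
      qv p hp, wv p hp] at h1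
    rw [suu p hp] at h2
    have h3 := y p hp
    refine mul_left_cancel₀ (pow_ne_zero 2 h0) ?_
    linear_combination (norm := (field_simp; ring)) -4 * h1 + 2 * p.1 * h2 + 6 * h3
  refine ⟨qv, qu, fun p hp => ?_, hx, w, fun p hp => ?_⟩
  · have h0 := hu p hp
    have h1 := y p hp
    rw [hx p hp] at h1
    linear_combination (norm := (field_simp; ring)) h1
  · have h0 := hu p hp
    have h1 := E1 p hp 6
    have h2 := yv p hp
    rw [← dU_dV (ha.smooth 1 1) hU hp] at h2
    simp [c5u p hp, c7v p hp, b5v p hp, b7u p hp, c6 p hp, b4 p hp, b7' p hp, qu p hp, w p hp,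
      wu p hp] at h1
    linear_combination (norm := (field_simp; ring)) h1 + p.1 ^ 3 / 8 * h2

end B2

/-! ### Integration in Riemann invariants -/

namespace B2

variable {U : Set (ℝ × ℝ)} {p : ℝ × ℝ} {z : Jet}

theorem exists_primitive_ball {f : ℝ → ℝ} {x ε : ℝ} (hf : ContDiffOn ℝ ∞ f (Metric.ball x ε)) :
    ∃ F : ℝ → ℝ, ContDiffOn ℝ ∞ F (Metric.ball x ε) ∧
      ∀ y ∈ Metric.ball x ε, deriv F y = f y := by
  have h : ∀ y ∈ Metric.ball x ε, HasDerivAt (fun y => ∫ t in x..y, f t) (f y) y := by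
    intro y hy
    have hx : x ∈ Metric.ball x ε := Metric.mem_ball_self (dist_nonneg.trans_lt hy)
    have hs : Set.uIcc x y ⊆ Metric.ball x ε :=
      (convex_ball x ε).ordConnected.uIcc_subset hx hy
    exact intervalIntegral.integral_hasDerivAt_right
      ((hf.continuousOn.mono hs).intervalIntegrable)
      (hf.continuousOn.stronglyMeasurableAtFilter Metric.isOpen_ball y hy)
      (hf.continuousOn.continuousAt (Metric.isOpen_ball.mem_nhds hy))
  refine ⟨_, ?_, fun y hy => (h y hy).deriv⟩
  rw [contDiffOn_infty_iff_deriv_of_isOpen Metric.isOpen_ball]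
  exact ⟨fun y hy => (h y hy).differentiableAt.differentiableWithinAt,
    hf.congr fun y hy => (h y hy).deriv⟩

/-- The point with `σ u > 0` at which the Riemann invariants have given values, where
`σ = 1` or `σ = -1`. -/
noncomputable def ofInvariants (σ : ℝ) (x : ℝ × ℝ) : ℝ × ℝ :=
  (σ * √(2 * (x.1 - x.2)), (x.1 + x.2) / 2)

/-- Since `r₁ - r₂ = u²/2`, the invariants forget only the sign of `u`, which `σ` restores. -/
theorem ofInvariants_eq {σ : ℝ} (hσ : σ ^ 2 = 1) (h : 0 < σ * p.1) :
    ofInvariants σ (r₁ p, r₂ p) = p := by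
  have e : √(2 * (r₁ p - r₂ p)) = σ * p.1 := by
    rw [show 2 * (r₁ p - r₂ p) = (σ * p.1) ^ 2 by
      rw [mul_pow, hσ, r₁, r₂]; ring, Real.sqrt_sq h.le]
  refine Prod.ext ?_ ?_
  · simp only [ofInvariants, e]; linear_combination p.1 * hσ
  · simp only [ofInvariants, r₁, r₂]; ring

theorem contDiffOn_ofInvariants (σ : ℝ) :
    ContDiffOn ℝ ∞ (ofInvariants σ) {x | x.2 < x.1} := by
  refine ContDiffOn.prodMk (contDiffOn_const.mul (ContDiffOn.sqrt (by fun_prop) ?_)) (by fun_prop)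
  intro x (hx : x.2 < x.1)
  linarith

theorem hasDerivAt_ofInvariants {σ : ℝ} (hσ : σ ^ 2 = 1) {x : ℝ × ℝ} (hx : x.2 < x.1) :
    HasDerivAt (fun t => ofInvariants σ (t, x.2)) ((ofInvariants σ x).1⁻¹, 1 / 2) x.1 ∧
    HasDerivAt (fun t => ofInvariants σ (x.1, t)) (-(ofInvariants σ x).1⁻¹, 1 / 2) x.2 := by
  have h0 : 2 * (x.1 - x.2) ≠ 0 := by linarith
  have hs : √(2 * (x.1 - x.2)) ≠ 0 := Real.sqrt_ne_zero'.2 (by linarith)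
  have hσ0 : σ ≠ 0 := by rintro rfl; norm_num at hσ
  constructor
  · refine HasDerivAt.prodMk ?_ ?_
    · refine (((((hasDerivAt_id x.1).sub_const x.2).const_mul 2).sqrt h0).const_mul σ).congr_deriv ?_
      simp only [ofInvariants, id]
      field_simp
      linear_combination hσ
    · exact (((hasDerivAt_id x.1).add_const x.2).div_const 2)
  · refine HasDerivAt.prodMk ?_ ?_
    · refine (((((hasDerivAt_id x.2).const_sub x.1).const_mul 2).sqrt h0).const_mul σ).congr_deriv ?_
      simp only [ofInvariants, id]
      field_simp
      linear_combination -hσ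
    · exact (((hasDerivAt_id x.2).const_add x.1).div_const 2)

theorem HasGrad.comp_hasDerivAt {f : ℝ × ℝ → ℝ} {γ : ℝ → ℝ × ℝ} {a b t : ℝ} {w : ℝ × ℝ}
    (hf : HasGrad f a b (γ t)) (hγ : HasDerivAt γ w t) :
    HasDerivAt (fun s => f (γ s)) (a * w.1 + b * w.2) t :=
  (HasFDerivAt.comp_hasDerivAt t hf hγ).congr_deriv (by simp)

theorem eq_of_deriv_eq_zero_ball {f : ℝ → ℝ} {x ε y y' : ℝ}
    (h : ∀ t ∈ Metric.ball x ε, HasDerivAt f 0 t) (hy : y ∈ Metric.ball x ε)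
    (hy' : y' ∈ Metric.ball x ε) : f y = f y' :=
  Metric.isOpen_ball.is_const_of_deriv_eq_zero (convex_ball x ε).isPreconnected
    (fun t ht => (h t ht).differentiableAt.differentiableWithinAt) (fun t ht => (h t ht).deriv)
    hy hy'

/-- Solutions of `q_v = s_u`, `q_u = q / u + (u² / 4) s_v` are locally the derivatives of
`F₁(u² / 4 + v) + F₂(-u² / 4 + v)`. -/
theorem exists_potential {q s : ℝ × ℝ → ℝ} (hU : IsOpen U) (hu : ∀ p ∈ U, p.1 ≠ 0)
    (hq : ContDiffOn ℝ ∞ q U) (hs : ContDiffOn ℝ ∞ s U) (hv : ∀ p ∈ U, dV q p = dU s p)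
    (hqu : ∀ p ∈ U, dU q p = q p / p.1 + p.1 ^ 2 / 4 * dV s p) (hp : p ∈ U) :
    ∃ V : Set (ℝ × ℝ), IsOpen V ∧ p ∈ V ∧ V ⊆ U ∧ ∃ F₁ F₂ : ℝ → ℝ,
      ContDiffOn ℝ ∞ F₁ (r₁ '' V) ∧ ContDiffOn ℝ ∞ F₂ (r₂ '' V) ∧
      ∀ y ∈ V, dU (potential F₁ F₂) y = q y ∧ dV (potential F₁ F₂) y = s y := by
  obtain ⟨σ, hσ, hσp⟩ : ∃ σ : ℝ, σ ^ 2 = 1 ∧ 0 < σ * p.1 := by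
    rcases lt_or_gt_of_ne (hu p hp) with h | h
    · exact ⟨-1, by norm_num, by linarith⟩
    · exact ⟨1, by norm_num, by linarith⟩
  have hlt : r₂ p < r₁ p := by
    have := pow_pos hσp 2
    rw [mul_pow, hσ] at this
    simp only [r₁, r₂]; linarith
  have hopen : IsOpen {x : ℝ × ℝ | x.2 < x.1} := isOpen_lt continuous_snd continuous_fst
  -- A product of intervals in the invariants is needed, so that each coordinate line inside it is
  -- connected and constancy can be deduced from a vanishing derivative.
  have hW : {x : ℝ × ℝ | x.2 < x.1} ∩ ofInvariants σ ⁻¹' U ∈ nhds (r₁ p, r₂ p) := by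
    refine ((contDiffOn_ofInvariants σ).continuousOn.isOpen_inter_preimage hopen hU).mem_nhds
      ⟨hlt, ?_⟩
    rwa [Set.mem_preimage, ofInvariants_eq hσ hσp]
  obtain ⟨ε, hε, hball⟩ := Metric.mem_nhds_iff.1 hW
  rw [← ball_prod_same] at hball
  have hx0 : r₁ p ∈ Metric.ball (r₁ p) ε := Metric.mem_ball_self hε
  have hy0 : r₂ p ∈ Metric.ball (r₂ p) ε := Metric.mem_ball_self hε
  have hbox : ∀ x ∈ Metric.ball (r₁ p) ε, ∀ y ∈ Metric.ball (r₂ p) ε,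
      y < x ∧ ofInvariants σ (x, y) ∈ U := fun x hx y hy =>
    ⟨(hball (Set.mk_mem_prod hx hy)).1, (hball (Set.mk_mem_prod hx hy)).2⟩
  have hsq := fun y (hy : y ∈ U) => hasGrad_of_contDiffOn hs hU hy
  have hqq := fun y (hy : y ∈ U) => (hasGrad_of_contDiffOn hq hU hy).mul (hasGrad_inv (hu y hy))
  -- the derivatives of `F₁` and `F₂` in terms of `u` and `v`
  let φ₁ : ℝ × ℝ → ℝ := fun y => 1 / 2 * s y + q y * y.1⁻¹
  let φ₂ : ℝ × ℝ → ℝ := fun y => 1 / 2 * s y - q y * y.1⁻¹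
  -- The gradient of `φ₁` is a multiple of `(u/2, 1)`, that of `r₁`, and the gradient of `φ₂` a
  -- multiple of that of `r₂`. So `φ₁` depends locally on `r₁` alone and `φ₂` on `r₂` alone.
  have g₁ : ∀ y ∈ U, HasGrad φ₁ (1 / 2 * (dU s y + y.1 / 2 * dV s y))
      (y.1⁻¹ * (dU s y + y.1 / 2 * dV s y)) y := fun y hy => by
    have h0 := hu y hy
    refine (((HasGrad.const (1 / 2)).mul (hsq y hy)).add (hqq y hy)).congr_val ?_ ?_
    · rw [hqu y hy]; field_simp; ring
    · rw [hv y hy]; field_simp; ring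
  have g₂ : ∀ y ∈ U, HasGrad φ₂ (1 / 2 * (dU s y - y.1 / 2 * dV s y))
      (-y.1⁻¹ * (dU s y - y.1 / 2 * dV s y)) y := fun y hy => by
    have h0 := hu y hy
    refine (((HasGrad.const (1 / 2)).mul (hsq y hy)).sub (hqq y hy)).congr_val ?_ ?_
    · rw [hqu y hy]; field_simp; ring
    · rw [hv y hy]; field_simp; ring
  have hφ₁ : ContDiffOn ℝ ∞ φ₁ U := by fun_prop (disch := assumption)
  have hφ₂ : ContDiffOn ℝ ∞ φ₂ U := by fun_prop (disch := assumption)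
  have c₁ : ∀ x ∈ Metric.ball (r₁ p) ε, ∀ y ∈ Metric.ball (r₂ p) ε,
      φ₁ (ofInvariants σ (x, y)) = φ₁ (ofInvariants σ (x, r₂ p)) := by
    intro x hx y hy
    refine eq_of_deriv_eq_zero_ball (f := fun y => φ₁ (ofInvariants σ (x, y)))
      (fun t ht => ?_) hy hy0
    obtain ⟨h1, h2⟩ := hbox x hx t ht
    have h3 := (hasDerivAt_ofInvariants hσ (x := (x, t)) h1).2
    exact (HasGrad.comp_hasDerivAt (γ := fun t => ofInvariants σ (x, t)) (g₁ _ h2) h3).congr_deriv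
      (by ring)
  have c₂ : ∀ x ∈ Metric.ball (r₁ p) ε, ∀ y ∈ Metric.ball (r₂ p) ε,
      φ₂ (ofInvariants σ (x, y)) = φ₂ (ofInvariants σ (r₁ p, y)) := by
    intro x hx y hy
    refine eq_of_deriv_eq_zero_ball (f := fun x => φ₂ (ofInvariants σ (x, y)))
      (fun t ht => ?_) hx hx0
    obtain ⟨h1, h2⟩ := hbox t ht y hy
    have h3 := (hasDerivAt_ofInvariants hσ (x := (t, y)) h1).1
    exact (HasGrad.comp_hasDerivAt (γ := fun t => ofInvariants σ (t, y)) (g₂ _ h2) h3).congr_deriv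
      (by ring)
  have s₁ : ContDiffOn ℝ ∞ (fun x => φ₁ (ofInvariants σ (x, r₂ p))) (Metric.ball (r₁ p) ε) :=
    hφ₁.comp ((contDiffOn_ofInvariants σ).comp (contDiffOn_id.prodMk contDiffOn_const)
      fun x hx => (hbox x hx _ hy0).1) fun x hx => (hbox x hx _ hy0).2
  have s₂ : ContDiffOn ℝ ∞ (fun y => φ₂ (ofInvariants σ (r₁ p, y))) (Metric.ball (r₂ p) ε) :=
    hφ₂.comp ((contDiffOn_ofInvariants σ).comp (contDiffOn_const.prodMk contDiffOn_id)
      fun y hy => (hbox _ hx0 y hy).1) fun y hy => (hbox _ hx0 y hy).2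
  obtain ⟨F₁, hF₁, hF₁'⟩ := exists_primitive_ball s₁
  obtain ⟨F₂, hF₂, hF₂'⟩ := exists_primitive_ball s₂
  -- The sign condition excludes the mirror image under `u ↦ -u`, which has the same invariants but
  -- need not lie in `U`.
  let V : Set (ℝ × ℝ) := {y | 0 < σ * y.1} ∩
    (r₁ ⁻¹' Metric.ball (r₁ p) ε ∩ r₂ ⁻¹' Metric.ball (r₂ p) ε)
  have hr₁ : Continuous r₁ := by unfold r₁; fun_prop
  have hr₂ : Continuous r₂ := by unfold r₂; fun_prop
  have hV : IsOpen V := (isOpen_lt continuous_const (by fun_prop)).inter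
    ((Metric.isOpen_ball.preimage hr₁).inter (Metric.isOpen_ball.preimage hr₂))
  have hVU : V ⊆ U := fun y hy => by
    have := (hbox _ hy.2.1 _ hy.2.2).2
    rwa [ofInvariants_eq hσ hy.1] at this
  have k₁ : ContDiffOn ℝ ∞ F₁ (r₁ '' V) := hF₁.mono (Set.image_subset_iff.2 fun y hy => hy.2.1)
  have k₂ : ContDiffOn ℝ ∞ F₂ (r₂ '' V) := hF₂.mono (Set.image_subset_iff.2 fun y hy => hy.2.2)
  refine ⟨V, hV, ⟨hσp, hx0, hy0⟩, hVU, F₁, F₂, k₁, k₂, fun y hy => ?_⟩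
  have h0 := hu y (hVU hy)
  have g := hasGrad_potential hV k₁ k₂ hy
  have e₁ : deriv F₁ (r₁ y) = φ₁ y := by
    rw [hF₁' _ hy.2.1, ← c₁ _ hy.2.1 _ hy.2.2, ofInvariants_eq hσ hy.1]
  have e₂ : deriv F₂ (r₂ y) = φ₂ y := by
    rw [hF₂' _ hy.2.2, ← c₂ _ hy.2.1 _ hy.2.2, ofInvariants_eq hσ hy.1]
  rw [g.dU_eq, g.dV_eq, e₁, e₂]
  constructor
  · simp only [φ₁, φ₂]; field_simp; ring
  · simp only [φ₁, φ₂]; ring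

/-- A reduced deformation is locally in normal form. -/
theorem exists_normalForm_eq {a : Fin 2 → Fin 5 → ℝ × ℝ → ℝ} (hU : IsOpen U)
    (hu : ∀ p ∈ U, p.1 ≠ 0) (ha : IsNormalized U a) (hr : IsReduced U a) (hp : p ∈ U) :
    ∃ V : Set (ℝ × ℝ), IsOpen V ∧ p ∈ V ∧ V ⊆ U ∧ ∃ F₁ F₂ : ℝ → ℝ,
      ContDiffOn ℝ ∞ F₁ (r₁ '' V) ∧ ContDiffOn ℝ ∞ F₂ (r₂ '' V) ∧
      ∀ i k, ∀ y ∈ V, normalForm (potential F₁ F₂) i k y = a i k y := by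
  obtain ⟨V, hV, hpV, hVU, F₁, F₂, k₁, k₂, h⟩ :=
    exists_potential hU hu (ha.smooth 1 0) (ha.smooth 1 1) hr.dV_uxx hr.dU_uxx hp
  refine ⟨V, hV, hpV, hVU, F₁, F₂, k₁, k₂, fun i k y hy => ?_⟩
  have hy' := hVU hy
  have h0 := hu y hy'
  have e1 := (h y hy).1
  have e2 := (h y hy).2
  have e3 := dU_congr_on hV hy fun y hy => (h y hy).2
  have e4 := dV_congr_on hV hy fun y hy => (h y hy).2
  fin_cases i <;> fin_cases k <;>
    simp [normalForm, coeff25, e1, e2, e3, e4, ha.uxx y hy', ha.vxx y hy', ha.vx_sq y hy',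
      ha.ux_vx y hy', hr.ux_sq y hy', hr.vx_sq y hy', hr.ux_vx y hy', hr.ux_sq' y hy'] <;>
    field_simp

end B2

/-! ### Finite Miura transformations modulo `O(ε³)` -/

namespace B2

variable {U : Set (ℝ × ℝ)} {p : ℝ × ℝ} {z : Jet}

theorem dispersionless_primaryFrob_zero (z : Jet) : dispersionless primaryFrob 0 z = z 1 1 := by
  refine (totalD_base (contDiff_primaryFrob 0).contDiffOn isOpen_univ (Set.mem_univ _)).trans ?_
  simp [dU_primaryFrob_zero, dV_primaryFrob_zero]

theorem dispersionless_primaryFrob_one (z : Jet) :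
    dispersionless primaryFrob 1 z = z 0 0 ^ 2 / 4 * z 1 0 := by
  refine (totalD_base (contDiff_primaryFrob 1).contDiffOn isOpen_univ (Set.mem_univ _)).trans ?_
  simp [dU_primaryFrob_one, dV_primaryFrob_one, base]

/-- The components `vₓ` and `(u²/4) uₓ` are polynomials of degree at most three in the jet, so their
Taylor expansion along a line is exact and the remainder explicit. -/
theorem exists_dispersionless_primaryFrob_line (i : Fin 2) (z w : Jet) :
    ∃ c d : ℝ, ∀ t : ℝ, dispersionless primaryFrob i (fun s k => z s k + t * w s k)
      = dispersionless primaryFrob i z + t * dirD (dispersionless primaryFrob i) z w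
        + t ^ 2 * c + t ^ 3 * d := by
  fin_cases i
  · refine ⟨0, 0, fun t => ?_⟩
    simp only [Fin.zero_eta, funext dispersionless_primaryFrob_zero, dirD_coord]
    ring
  · refine ⟨w 0 0 ^ 2 / 4 * z 1 0 + z 0 0 * w 0 0 / 2 * w 1 0, w 0 0 ^ 2 / 4 * w 1 0,
      fun t => ?_⟩
    have h : HasDerivAt (fun t : ℝ => (z 0 0 + t * w 0 0) ^ 2 / 4 * (z 1 0 + t * w 1 0))
        (z 0 0 * w 0 0 / 2 * z 1 0 + z 0 0 ^ 2 / 4 * w 1 0) 0 := by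
      have h0 := fun s => ((hasDerivAt_id (0 : ℝ)).mul_const (w s 0)).const_add (z s 0)
      refine ((((h0 0).pow 2).div_const 4).mul (h0 1)).congr_deriv ?_
      simp
      left; ring
    have e : dirD (fun z : Jet => z 0 0 ^ 2 / 4 * z 1 0) z w
        = z 0 0 * w 0 0 / 2 * z 1 0 + z 0 0 ^ 2 / 4 * w 1 0 := h.deriv
    simp only [Fin.mk_one, funext dispersionless_primaryFrob_one, e]
    ring

theorem isBigO_cubed_mul {g : ℝ → ℝ} (hg : Continuous g) :
    (fun ε : ℝ => ε ^ 3 * g ε) =O[nhds 0] fun ε : ℝ => ε ^ 3 := by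
  simpa using (Asymptotics.isBigO_refl (fun ε : ℝ => ε ^ 3) (nhds 0)).mul
    (hg.continuousAt.tendsto.isBigO_one ℝ)

/-- Differentiability along the line, reparametrised by `t = ε²`. -/
theorem IsDiffFn.isBigO_line {f : Jet → ℝ} (hU : IsOpen U) (hf : IsDiffFn U f) (hz : base z ∈ U)
    (w : Jet) :
    (fun ε : ℝ => f (fun s k => z s k + ε ^ 2 * w s k) - f z) =O[nhds 0] fun ε : ℝ => ε ^ 2 := by
  have h := (hf.differentiableAt hU hz w).hasDerivAt.isBigO_sub
  have ht : Filter.Tendsto (fun ε : ℝ => ε ^ 2) (nhds 0) (nhds 0) :=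
    (continuous_pow 2).tendsto' 0 0 (by simp)
  simpa [Function.comp_def] using h.comp_tendsto ht

/-- The Miura transformation with coefficients `β` changes a deformation of the primary flow by
`gaugeCoeff`. -/
theorem miuraCarries_deformed {a n : Fin 2 → Fin 5 → ℝ × ℝ → ℝ} {β : Fin 2 → Fin 2 → ℝ × ℝ → ℝ}
    (hU : IsOpen U) (ha : ∀ i k, ContDiffOn ℝ ∞ (a i k) U) (hβ : ∀ i j, ContDiffOn ℝ ∞ (β i j) U)
    (h : ∀ i k, ∀ p ∈ U, n i k p = a i k p + gaugeCoeff primaryFrob β i k p) :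
    MiuraCarries U β (deformed primaryFrob a) (deformed primaryFrob n) := by
  intro z hz i
  have hf : ∀ i, ContDiffOn ℝ ∞ (primaryFrob i) U := fun i => (contDiff_primaryFrob i).contDiffOn
  have hG := contDiffOn_gaugeCoeff hU hf hβ
  have hn : ∀ i k, ContDiffOn ℝ ∞ (n i k) U := fun i k => ((ha i k).add (hG i k)).congr (h i k)
  have hK := fun k => isDiffFn_degOne (hβ k)
  have hDK := fun k => (hK k).totalD hU
  have hP := isDiffFn_dispersionless hU hf
  have hDA := fun k => (isDiffFn_degTwo (ha k)).totalD hU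
  let κ : Jet := fun s k => totalD^[s] (totalD (degOne (β k))) z
  have hjet : ∀ ε, jetOf (miura β ε) z = fun s k => z s k + ε ^ 2 * κ s k := fun ε => by
    funext s k
    refine (iterate_totalD_add_smul hU (.coord 0 k) (hDK k) (ε ^ 2) s z hz).trans ?_
    rw [iterate_totalD_coord, zero_add]
  have hmiura : ∀ (X : Fin 2 → Jet → ℝ) (ε : ℝ), timeD X (miura β ε i) z
      = X i z + ε ^ 2 * timeD X (totalD (degOne (β i))) z := fun X ε => by
    change dirD (fun y => y 0 i + ε ^ 2 * totalD (degOne (β i)) y) z (jetOf X z) = _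
    rw [dirD_add hU (.coord 0 i) ((hDK i).const_mul (ε ^ 2)) hz, dirD_coord, dirD_const_mul hU _ (hDK i) hz]; rfl
  have hX : ∀ ε, timeD (deformed primaryFrob a ε) (miura β ε i) z
      = dispersionless primaryFrob i z
        + ε ^ 2 * timeD (dispersionless primaryFrob) (totalD (degOne (β i))) z
        + ε ^ 2 * (totalD (degTwo (a i)) z
          + ε ^ 2 * timeD (fun k => totalD (degTwo (a k))) (totalD (degOne (β i))) z) := fun ε => by
    have hm : IsDiffFn U (miura β ε i) := IsDiffFn.add (.coord 0 i) ((hDK i).const_mul (ε ^ 2))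
    rw [timeD_deformed hU hf ha hm ε hz, hmiura, hmiura]
  -- The `ε²` terms on both sides. Commuting `∂ₓ` past the derivations turns this into the identity
  -- of densities `degTwo_gaugeCoeff`.
  have key : totalD (degTwo (a i)) z
      + timeD (dispersionless primaryFrob) (totalD (degOne (β i))) z
      = dirD (dispersionless primaryFrob i) z κ + totalD (degTwo (n i)) z := by
    have e1 := timeD_totalD hU hP (hK i) z hz
    have e2 : dirD (dispersionless primaryFrob i) z κ
        = totalD (timeD (fun k => totalD (degOne (β k))) fun z => primaryFrob i (base z)) z :=
      timeD_totalD hU hDK (.ofBase _ (hf i)) z hz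
    rw [e1, e2, ← totalD_add hU (isDiffFn_degTwo (ha i)) ((hK i).timeD hU hP) hz,
      ← totalD_add hU ((IsDiffFn.ofBase _ (hf i)).timeD hU hDK) (isDiffFn_degTwo (hn i)) hz]
    refine totalD_congr hU hz fun y hy => ?_
    have e3 : degTwo (n i) y = degTwo (a i) y + degTwo (gaugeCoeff primaryFrob β i) y := by
      simp only [degTwo, h i _ _ hy]; ring
    rw [e3, degTwo_gaugeCoeff hU hf hβ hy, timeD_base (hf i) hU hy]
    ring
  obtain ⟨c, d, hcd⟩ := exists_dispersionless_primaryFrob_line i z κ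
  have hDN := (isDiffFn_degTwo (hn i)).totalD hU
  set T := timeD (fun k => totalD (degTwo (a k))) (totalD (degOne (β i))) z
  -- What remains beyond order `ε²`: the `ε⁴` and `ε⁶` terms of the expansion, and the deformation
  -- terms evaluated at the displaced jet instead of `z`, which cost `ε² · O(ε²)`.
  have hsum : (fun ε : ℝ => ε ^ 3 * (ε * (T - c) - ε ^ 3 * d)
      - ε ^ 2 * (totalD (degTwo (n i)) (fun s k => z s k + ε ^ 2 * κ s k)
        - totalD (degTwo (n i)) z)) =O[nhds 0] fun ε : ℝ => ε ^ 3 := by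
    refine (isBigO_cubed_mul (by fun_prop)).sub ?_
    refine ((Asymptotics.isBigO_refl (fun ε : ℝ => ε ^ 2) _).mul
      (hDN.isBigO_line hU hz κ)).trans ?_
    exact (isBigO_cubed_mul continuous_id).congr_left fun ε => by simp only [id]; ring
  refine hsum.congr' ?_ .rfl
  have ht : Filter.Tendsto (fun ε : ℝ => ε ^ 2) (nhds 0) (nhds 0) :=
    (continuous_pow 2).tendsto' 0 0 (by simp)
  -- The displaced jet lies over `U` only for small `ε`, and only there may the deformed flow be
  -- expanded at it.
  filter_upwards [ht.eventually (eventually_base_mem hU hz κ)] with ε hε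
  rw [hX, hjet, deformed_eq hU hf hn ε i hε, hcd]
  linear_combination -ε ^ 2 * key

end B2

/-! ### Assembly of the two directions -/

namespace B2

variable {U : Set (ℝ × ℝ)}

/-- Integrable deformations of the primary flow are locally reduced to the normal form by a Miura
transformation. -/
theorem exists_miuraCarries_normalForm {a : Fin 2 → Fin 5 → ℝ × ℝ → ℝ} (hU : IsOpen U)
    (hu : ∀ p ∈ U, p.1 ≠ 0) (ha : ∀ i k, ContDiffOn ℝ ∞ (a i k) U)
    (h : IsIntegrable U primaryFrob a) :
    ∃ β : Fin 2 → Fin 2 → ℝ × ℝ → ℝ, (∀ i j, ContDiffOn ℝ ∞ (β i j) U) ∧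
      ∀ p ∈ U, ∃ V : Set (ℝ × ℝ), IsOpen V ∧ p ∈ V ∧ V ⊆ U ∧
        ∃ F₁ F₂ : ℝ → ℝ, ContDiffOn ℝ ∞ F₁ (r₁ '' V) ∧ ContDiffOn ℝ ∞ F₂ (r₂ '' V) ∧
          MiuraCarries V β (deformed primaryFrob a)
            (deformed primaryFrob (normalForm (potential F₁ F₂))) := by
  have hA := isNormalized_normalized hU hu ha
  obtain ⟨b, hb, hc⟩ := exists_commCoeff_normalized hU hu ha h
  have hR := isReduced_of_commCoeff hU hu hA hb hc
  have hβ := contDiffOn_miuraNormalizer hU hu ha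
  refine ⟨miuraNormalizer a, hβ, fun p hp => ?_⟩
  obtain ⟨V, hV, hpV, hVU, F₁, F₂, k₁, k₂, e⟩ := exists_normalForm_eq hU hu hA hR hp
  exact ⟨V, hV, hpV, hVU, F₁, F₂, k₁, k₂, miuraCarries_deformed hV
    (fun i k => (ha i k).mono hVU) (fun i j => (hβ i j).mono hVU) e⟩

/-- The deformations in normal form are integrable, and the extended symmetries commute. -/
theorem isIntegrable_normalForm {F₁ F₂ : ℝ → ℝ} (hU : IsOpen U) (hu : ∀ p ∈ U, p.1 ≠ 0)
    (h₁ : ContDiffOn ℝ ∞ F₁ (r₁ '' U)) (h₂ : ContDiffOn ℝ ∞ F₂ (r₂ '' U)) :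
    IsIntegrable U primaryFrob (normalForm (potential F₁ F₂)) ∧
      ∀ g g' : Fin 2 → ℝ × ℝ → ℝ, ∀ b b' : Fin 2 → Fin 5 → ℝ × ℝ → ℝ,
        IsSymmetry U primaryFrob g → IsSymmetry U primaryFrob g' →
        IsExtension U primaryFrob (normalForm (potential F₁ F₂)) g b →
        IsExtension U primaryFrob (normalForm (potential F₁ F₂)) g' b' →
        CommuteUpToOrderTwo U (deformed g b) (deformed g' b') := by
  have hF := isPotential_potential hU hu h₁ h₂
  exact ⟨fun g hg => ⟨_, isExtension_extCoeff hU hu hF ((isSymmetry_primaryFrob_iff hU).1 hg)⟩,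
    fun g g' b b' hg hg' => commuteUpToOrderTwo_of_isExtension hU hu hF
      ((isSymmetry_primaryFrob_iff hU).1 hg) ((isSymmetry_primaryFrob_iff hU).1 hg')⟩

end B2

theorem mainTheorem4 (U : Set (ℝ × ℝ)) (hU : IsOpen U) (hu : ∀ p ∈ U, p.1 ≠ 0) :
    -- every integrable second order deformation is reduced to the normal form
    (∀ a : Fin 2 → Fin 5 → ℝ × ℝ → ℝ, (∀ i k, ContDiffOn ℝ ∞ (a i k) U) →
      B2.IsIntegrable U (B2.primary (-3 / 4)) a →
      ∃ β : Fin 2 → Fin 2 → ℝ × ℝ → ℝ, (∀ i j, ContDiffOn ℝ ∞ (β i j) U) ∧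
        ∀ p ∈ U, ∃ V : Set (ℝ × ℝ), IsOpen V ∧ p ∈ V ∧ V ⊆ U ∧
          ∃ F₁ F₂ : ℝ → ℝ, ContDiffOn ℝ ∞ F₁ (B2.r₁ '' V) ∧ ContDiffOn ℝ ∞ F₂ (B2.r₂ '' V) ∧
            B2.MiuraCarries V β (B2.deformed (B2.primary (-3 / 4)) a)
              (B2.deformed (B2.primary (-3 / 4)) (B2.normalForm (B2.potential F₁ F₂)))) ∧
    -- for arbitrary `F₁`, `F₂` all symmetries of the normal form extend and pairwise commute
    (∀ F₁ F₂ : ℝ → ℝ, ContDiffOn ℝ ∞ F₁ (B2.r₁ '' U) → ContDiffOn ℝ ∞ F₂ (B2.r₂ '' U) →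
      B2.IsIntegrable U (B2.primary (-3 / 4)) (B2.normalForm (B2.potential F₁ F₂)) ∧
      ∀ g g' : Fin 2 → ℝ × ℝ → ℝ, ∀ b b' : Fin 2 → Fin 5 → ℝ × ℝ → ℝ,
        B2.IsSymmetry U (B2.primary (-3 / 4)) g → B2.IsSymmetry U (B2.primary (-3 / 4)) g' →
        B2.IsExtension U (B2.primary (-3 / 4)) (B2.normalForm (B2.potential F₁ F₂)) g b →
        B2.IsExtension U (B2.primary (-3 / 4)) (B2.normalForm (B2.potential F₁ F₂)) g' b' →
        B2.CommuteUpToOrderTwo U (B2.deformed g b) (B2.deformed g' b')) := by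
  exact ⟨fun a ha h => B2.exists_miuraCarries_normalForm hU hu ha h,
    fun _ _ h₁ h₂ => B2.isIntegrable_normalForm hU hu h₁ h₂⟩
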